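/- **Theorem.** Let $M$ be a non-empty set with two functions $r:M\times M\to[0,\pi/2]$ and $\theta:M\times M\to[0,\pi]$ such that $r$ is a pseudo-metric, $\theta$ is symmetric and vanishes on the diagonal, $r(x,y)=\theta(x,y)=0$ implies $x=y$, and every sequence that is Cauchy for both $r$ and $\theta$ converges for both $r$ and $\theta$ to one and the same point of $M$. Equip $M$ with the topology generated by $r$ and $\theta$ ($U$ is open iff every $x\in U$ admits $\varepsilon>0$ with $\{y: r(x,y)<\varepsilon,\ \theta(x,y)<\varepsilon\}\subset U$), and suppose that $\theta$ is continuous on $\{(x,y): r(x,y)<\pi/2\}$. (The triangle inequality for $\theta$ is not required; if $\theta$ is a pseudo-metric, the continuity is automatic.) Let $\mu$ be a $\sigma$-finite Borel measure on $M$ that is positive on non-empty open sets. Suppose that $p_t(x,y)=p(t,r(x,y),\theta(x,y))$, $t>0$, is a heat kernel on $(M,\mu)$, where $$p(t,r,\theta)=\sum_{n=-\infty}^{\infty}\sum_{k=0}^{\infty}(2k+|n|+1)\,e^{-(4k(k+|n|+1)+2|n|)t}\,e^{in\theta}(\cos r)^{|n|}P_k^{0,|n|}(\cos 2r),$$ $$P_k^{0,|n|}(x)=\frac{(-1)^k}{2^kk!(1+x)^{|n|}}\frac{d^k}{dx^k}\left((1+x)^{|n|}(1-x^2)^k\right).$$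 That is, for all $s,t>0$, $p_t$ is measurable, and for $\mu$-almost all $x,y$: $p_t(x,y)\ge0$, $p_t(x,y)=p_t(y,x)$, $\int_M p_t(x,z)\,d\mu(z)=1$, $p_{s+t}(x,y)=\int_M p_s(x,z)p_t(z,y)\,d\mu(z)$; and $\int_M f(y)p_t(\cdot,y)\,d\mu(y)\to f$ in $L^2(\mu)$ as $t\to0^+$ for every $f\in L^2(\mu)$. Put $\delta(x,y)=\arccos(\cos r(x,y)\cos\theta(x,y))$. Let $\mathbf B=M/\!\sim$ where $x\sim y$ iff $r(x,y)=0$, with the induced metric $r$, and let $\pi:M\to\mathbf B$ be the quotient map. Let $V_1=\operatorname{Span}\{\cos r(x,\cdot)\cos\theta(x,\cdot): x\in M\}$ and $V_2=\operatorname{Span}\{\cos 2r(\mathbf x,\cdot):\mathbf x\in\mathbf B\}$. Then: 1. There are points $x_1,\dots,x_4\in M$ and a basis $\varphi_1,\dots,\varphi_4$ of $V_1$ with $\varphi_j(x_i)=\delta_{ij}$, and points $\mathbf x_1,\mathbf x_2,\mathbf x_3\in\mathbf B$ and a basis $\psi_1,\psi_2,\psi_3$ of $V_2$ with $\psi_j(\mathbf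 x_i)=\delta_{ij}$. For all such choices the bilinear forms $\beta_1$ on $\mathbb R^4$ with matrix $(\cos r(x_i,x_j)\cos\theta(x_i,x_j))$ and $\beta_2$ on $\mathbb R^3$ with matrix $(\cos 2r(\mathbf x_i,\mathbf x_j))$ are positive definite, and $\Phi=(\varphi_1,\dots,\varphi_4)$ and $\Psi=(\psi_1,\psi_2,\psi_3)$ take values in the unit spheres $\mathcal S^3$ of $(\mathbb R^4,\beta_1)$ and $\mathcal S^2$ of $(\mathbb R^3,\beta_2)$. Let $d_{\mathcal S^3},d_{\mathcal S^2}$ be the distances $2\arcsin(\|u-v\|/2)$ on these spheres. 2. For all such choices, $\Phi:(M,\delta)\to(\mathcal S^3,d_{\mathcal S^3})$ and $\Psi:(\mathbf B,r)\to(\mathcal S^2,\tfrac12d_{\mathcal S^2})$ are bijective isometries, and $\Pi:=\Psi\circ\pi\circ\Phi^{-1}$ is a smooth Riemannian submersion from $(\mathcal S^3,d_{\mathcal S^3})$ onto $(\mathcal S^2,\tfrac12d_{\mathcal S^2})$ with one-dimensional, totally geodesic fibers. Thus $\Pi\circ\Phi=\Psi\circ\pi$, and $(\Phi,\Psi)$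 is a bundle isometry between $\pi$ and $\Pi$. Here $\pi:(M,\delta)\to(\mathbf B,r)$ is a submersion with totally geodesic fibers in the metric sense: $r(\pi(x),\pi(y))\le\delta(x,y)$; for all $x\in M$ and $\mathbf b\in\mathbf B$ there is $y\in\mathbf b$ with $\delta(x,y)=r(\pi(x),\mathbf b)$; and if $x\sim y$, $\delta(x,y)<\pi$ and $\delta(x,z)+\delta(z,y)=\delta(x,y)$, then $z\sim x$. 3. Up to linear isometries of the ambient Euclidean spaces, $\Pi$ is the Hopf fibration $h(z,w)=(|z|^2-|w|^2,\,2z\bar w)$ from the unit sphere $S^3\subset\mathbb C^2$ to the unit sphere $S^2\subset\mathbb R\times\mathbb C$. Hence there are bijective isometries $\Phi':(M,\delta)\to S^3$ and $\Psi':(\mathbf B,r)\to(S^2,\tfrac12d)$ that form a bundle isometry between $\pi$ and the Hopf fibration. -/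

import Mathlib

open MeasureTheory Filter Topology
open scoped Manifold ContDiff

noncomputable section

namespace HopfRigidity

/-! ### Pseudo-metrics, heat kernels and the kernel of the sub-Laplacian on `SU(2)` -/

/-- A pseudo-metric on `X`. -/
structure IsPseudoMetric {X : Type*} (r : X → X → ℝ) : Prop where
  nonneg : ∀ x y, 0 ≤ r x y
  self : ∀ x, r x x = 0
  symm : ∀ x y, r x y = r y x
  triangle : ∀ x y z, r x z ≤ r x y + r y z

/-- The standing assumptions on the pair `(r, θ)`.  The function `r` is a pseudo-metric with values
in `[0, π/2]`.  Of `θ` we only require that it is a symmetric function with values in `[0, π]`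
vanishing on the diagonal: the triangle inequality is not imposed on `θ`.  The two functions
together separate points, and `X` is complete for them. -/
structure IsAdmissiblePair {X : Type*} (r θ : X → X → ℝ) : Prop where
  pseudoMetric : IsPseudoMetric r
  le_half_pi : ∀ x y, r x y ≤ Real.pi / 2
  angle_nonneg : ∀ x y, 0 ≤ θ x y
  angle_le_pi : ∀ x y, θ x y ≤ Real.pi
  angle_self : ∀ x, θ x x = 0
  angle_symm : ∀ x y, θ x y = θ y x
  separates : ∀ x y, r x y = 0 → θ x y = 0 → x = y
  complete : ∀ u : ℕ → X,
    (∀ ε > 0, ∃ N, ∀ m ≥ N, ∀ n ≥ N, r (u m) (u n) < ε ∧ θ (u m) (u n) < ε) →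
    ∃ x, Tendsto (fun n => r (u n) x) atTop (𝓝 0) ∧ Tendsto (fun n => θ (u n) x) atTop (𝓝 0)

/-- The topology of `X` is the one generated by `r` and `θ`, and `θ` is continuous on the open
set of pairs with `r < π/2`.  (If `θ` is a pseudo-metric, then this is the topology of the
pseudo-metric `r + θ`, and `θ` is continuous everywhere.) -/
structure IsCompatibleTopology {X : Type*} [TopologicalSpace X] (r θ : X → X → ℝ) : Prop where
  isOpen_iff : ∀ U : Set X,
    IsOpen U ↔ ∀ x ∈ U, ∃ ε > 0, ∀ y, r x y < ε → θ x y < ε → y ∈ U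
  continuousOn_angle :
    ContinuousOn (fun z : X × X => θ z.1 z.2) {z : X × X | r z.1 z.2 < Real.pi / 2}

/-- Abstract heat kernels on a measure space. -/
structure IsHeatKernel {X : Type*} [MeasurableSpace X] (μ : Measure X) (p : ℝ → X → X → ℝ) :
    Prop where
  measurable : ∀ t > 0, Measurable (fun z : X × X => p t z.1 z.2)
  nonneg : ∀ t > 0, ∀ᵐ z ∂(μ.prod μ), 0 ≤ p t z.1 z.2
  symm : ∀ t > 0, ∀ᵐ z ∂(μ.prod μ), p t z.1 z.2 = p t z.2 z.1
  conservative : ∀ t > 0, ∀ᵐ x ∂μ, Integrable (p t x) μ ∧ ∫ y, p t x y ∂μ = 1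
  semigroup : ∀ s > 0, ∀ t > 0, ∀ᵐ z ∂(μ.prod μ),
    Integrable (fun w => p s z.1 w * p t w z.2) μ ∧
      p (s + t) z.1 z.2 = ∫ w, p s z.1 w * p t w z.2 ∂μ
  approx : ∀ f : X → ℝ, MemLp f 2 μ →
    Tendsto (fun t => eLpNorm (fun x => (∫ y, f y * p t x y ∂μ) - f x) 2 μ) (𝓝[>] 0) (𝓝 0)

/-- The Jacobi polynomial `P_k^{0,n}`, by Rodrigues' formula.  At `x = -1` and `n ≥ 1` the formula
has a removable singularity, where this definition takes the value `0`; in the kernel below it is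
then multiplied by `0`. -/
def jacobiP (k n : ℕ) (x : ℝ) : ℝ :=
  (-1) ^ k / (2 ^ k * (k.factorial : ℝ) * (1 + x) ^ n) *
    iteratedDeriv k (fun y : ℝ => (1 + y) ^ n * (1 - y ^ 2) ^ k) x

/-- The coefficient of `e^{inθ}` in the `k`-th term of the `SU(2)` kernel, for `|n| = n`. -/
def kernelCoeff (t r : ℝ) (n k : ℕ) : ℝ :=
  (2 * k + n + 1) * Real.exp (-(4 * k * (k + n + 1) + 2 * n) * t) *
    Real.cos r ^ n * jacobiP k n (Real.cos (2 * r))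

/-- The sub-elliptic heat kernel on `SU(2)` in cylindrical coordinates.  For `t > 0` and
`0 ≤ r ≤ π/2` the double series converges absolutely and its sum is real. -/
def su2Kernel (t r θ : ℝ) : ℂ :=
  ∑' n : ℤ, ∑' k : ℕ, (kernelCoeff t r n.natAbs k : ℂ) * Complex.exp (Complex.I * n * θ)

/-! ### The metric `δ` and the quotient space -/

/-- The distance `δ = arccos (cos r cos θ)`. -/
def delta {X : Type*} (r θ : X → X → ℝ) (x y : X) : ℝ :=
  Real.arccos (Real.cos (r x y) * Real.cos (θ x y))

/-- The equivalence relation `r x y = 0`. -/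
def zeroSetoid {X : Type*} {r : X → X → ℝ} (hr : IsPseudoMetric r) : Setoid X where
  r x y := r x y = 0
  iseqv :=
    { refl := hr.self
      symm := fun {x y} h => (hr.symm y x).trans h
      trans := fun {x y z} h₁ h₂ => le_antisymm
        (by have := hr.triangle x y z; linarith) (hr.nonneg x z) }

/-- The quotient space `B = X / ∼`. -/
def Base {X : Type*} {r : X → X → ℝ} (hr : IsPseudoMetric r) : Type _ := Quotient (zeroSetoid hr)

/-- The quotient map `X → B`. -/
def proj {X : Type*} {r : X → X → ℝ} (hr : IsPseudoMetric r) (x : X) : Base hr :=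
  Quotient.mk (zeroSetoid hr) x

/-- The metric induced by `r` on the quotient space. -/
def baseDist {X : Type*} {r : X → X → ℝ} (hr : IsPseudoMetric r) : Base hr → Base hr → ℝ :=
  Quotient.lift₂ (s₁ := zeroSetoid hr) (s₂ := zeroSetoid hr) r (by
    intro a b a' b' (ha : r a a' = 0) (hb : r b b' = 0)
    have h1 := hr.triangle a a' b
    have h2 := hr.triangle a' b' b
    have h3 := hr.triangle a' a b'
    have h4 := hr.triangle a b b'
    have h5 := hr.symm a a'
    have h6 := hr.symm b b'
    linarith)

/-! ### The maps built from the kernels `cos r cos θ` and `cos 2r` -/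

/-- `cos r cos θ` on `X`. -/
def totalCos {X : Type*} (r θ : X → X → ℝ) (x y : X) : ℝ :=
  Real.cos (r x y) * Real.cos (θ x y)

/-- `cos 2r` on `B`. -/
def baseCos {X : Type*} {r : X → X → ℝ} (hr : IsPseudoMetric r) (b c : Base hr) : ℝ :=
  Real.cos (2 * baseDist hr b c)

/-- `φ₁, …, φ_m` is a basis of `V = Span {κ(x, ·)}` and the evaluations at the points
`x₁, …, x_m` form the dual basis of `V*`. -/
structure IsDualSystem {X : Type*} (κ : X → X → ℝ) {m : ℕ} (x : Fin m → X) (φ : Fin m → X → ℝ) :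
    Prop where
  linearIndependent : LinearIndependent ℝ φ
  span_eq : Submodule.span ℝ (Set.range φ) = Submodule.span ℝ (Set.range κ)
  dual : ∀ i j, φ j (x i) = if i = j then 1 else 0

/-- The Gram matrix `κ(x_i, x_j)`, that is, the matrix of the form `β` on `ℝ^m`. -/
def gram {X : Type*} (κ : X → X → ℝ) {m : ℕ} (x : Fin m → X) : Matrix (Fin m) (Fin m) ℝ :=
  Matrix.of fun i j => κ (x i) (x j)

/-- The unit sphere `S^n` of the Euclidean space `ℝ^{n+1}`, a smooth manifold in Mathlib. -/
abbrev Sph (n : ℕ) : Type := Metric.sphere (0 : EuclideanSpace ℝ (Fin (n + 1))) 1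

/-- The length distance of the unit sphere. -/
def sphereDist {n : ℕ} (u v : Sph n) : ℝ :=
  2 * Real.arcsin (‖(u : EuclideanSpace ℝ (Fin (n + 1))) - v‖ / 2)

/-- `F` is the map `y ↦ (φ₁(y), …, φ_m(y))` from `X` to `(ℝ^m, β)`, `m = n + 1`, where `β` is the
form with matrix `κ(x_i, x_j)`.  The inner product space `(ℝ^m, β)` is identified with the standard
Euclidean space by a basis `e` of the latter with Gram matrix `κ(x_i, x_j)`, so that the sphere
`{β(ζ, ζ) = 1}` becomes the standard unit sphere. -/
def IsCoordinateMap {X : Type*} (κ : X → X → ℝ) {n : ℕ} (x : Fin (n + 1) → X)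
    (φ : Fin (n + 1) → X → ℝ) (F : X → Sph n) : Prop :=
  ∃ e : Module.Basis (Fin (n + 1)) ℝ (EuclideanSpace ℝ (Fin (n + 1))),
    (∀ i j, inner ℝ (e i) (e j) = gram κ x i j) ∧
      ∀ y, (F y : EuclideanSpace ℝ (Fin (n + 1))) = ∑ j, φ j y • e j

/-! ### Riemannian submersions of round spheres -/

/-- The inclusion of the tangent space of the sphere in the ambient Euclidean space. -/
def tangentIncl {n : ℕ} (u : Sph n) :
    TangentSpace (𝓡 n) u →L[ℝ] EuclideanSpace ℝ (Fin (n + 1)) :=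
  mfderiv (𝓡 n) 𝓘(ℝ, EuclideanSpace ℝ (Fin (n + 1)))
    (Subtype.val : Sph n → EuclideanSpace ℝ (Fin (n + 1))) u

/-- The Riemannian metric of the sphere `S^n` with the distance `c` times that of the unit
sphere. -/
def sphereMetric {n : ℕ} (c : ℝ) (u : Sph n) (v w : TangentSpace (𝓡 n) u) : ℝ :=
  c ^ 2 * inner ℝ (tangentIncl u v) (tangentIncl u w)

/-- The horizontal vectors of `P` at `u`: those orthogonal to the kernel of `dP_u`. -/
def IsHorizontal {m n : ℕ} (P : Sph m → Sph n) (u : Sph m) (v : TangentSpace (𝓡 m) u) : Prop :=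
  ∀ w : TangentSpace (𝓡 m) u, mfderiv (𝓡 m) (𝓡 n) P u w = 0 → sphereMetric 1 u v w = 0

/-- `P` is a Riemannian submersion from the unit sphere `S^m` with its distance `d` to the sphere
`S^n` with the distance `c d`: a surjective smooth map whose differential is surjective and is an
isometry on the orthogonal complement of its kernel. -/
structure IsRiemannianSubmersion {m n : ℕ} (c : ℝ) (P : Sph m → Sph n) : Prop where
  smooth : ContMDiff (𝓡 m) (𝓡 n) ∞ P
  surjective : Function.Surjective P
  submersion : ∀ u, Function.Surjective (mfderiv (𝓡 m) (𝓡 n) P u)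
  isometry : ∀ u (v w : TangentSpace (𝓡 m) u), IsHorizontal P u v → IsHorizontal P u w →
    sphereMetric c (P u) (mfderiv (𝓡 m) (𝓡 n) P u v) (mfderiv (𝓡 m) (𝓡 n) P u w) =
      sphereMetric 1 u v w

/-- The second derivative in the ambient space of a curve on the sphere. -/
def acceleration {n : ℕ} (γ : ℝ → Sph n) (t : ℝ) : EuclideanSpace ℝ (Fin (n + 1)) :=
  iteratedDeriv 2 (fun s => (γ s : EuclideanSpace ℝ (Fin (n + 1)))) t

/-- `γ` restricted to `(a, b)` is a geodesic of the sphere: a smooth curve whose acceleration is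
orthogonal to the tangent space of the sphere. -/
def IsSphereGeodesic {n : ℕ} (γ : ℝ → Sph n) (a b : ℝ) : Prop :=
  ContDiffOn ℝ ∞ (fun s => (γ s : EuclideanSpace ℝ (Fin (n + 1)))) (Set.Ioo a b) ∧
    ∀ t ∈ Set.Ioo a b, ∀ w : TangentSpace (𝓡 n) (γ t),
      inner ℝ (acceleration γ t) (tangentIncl (γ t) w) = 0

/-- `γ` restricted to `(a, b)` is a geodesic of a fiber of the submersion `P`, for the metric
induced on the fiber: a smooth curve in the fiber whose acceleration is orthogonal to the tangent
space of the fiber, which is the kernel of `dP`. -/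
def IsFiberGeodesic {m n : ℕ} (P : Sph m → Sph n) (γ : ℝ → Sph m) (a b : ℝ) : Prop :=
  ContDiffOn ℝ ∞ (fun s => (γ s : EuclideanSpace ℝ (Fin (m + 1)))) (Set.Ioo a b) ∧
    (∀ s ∈ Set.Ioo a b, ∀ t ∈ Set.Ioo a b, P (γ s) = P (γ t)) ∧
    ∀ t ∈ Set.Ioo a b, ∀ w : TangentSpace (𝓡 m) (γ t), mfderiv (𝓡 m) (𝓡 n) P (γ t) w = 0 →
      inner ℝ (acceleration γ t) (tangentIncl (γ t) w) = 0

/-- The fibers of `P` are totally geodesic: their geodesics are geodesics of the sphere. -/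
def HasTotallyGeodesicFibers {m n : ℕ} (P : Sph m → Sph n) : Prop :=
  ∀ (γ : ℝ → Sph m) (a b : ℝ), IsFiberGeodesic P γ a b → IsSphereGeodesic γ a b

/-- The fibers of the submersion `P` are of dimension `d`. -/
def HasFiberDim {m n : ℕ} (P : Sph m → Sph n) (d : ℕ) : Prop :=
  ∀ u, Module.finrank ℝ (LinearMap.ker (mfderiv (𝓡 m) (𝓡 n) P u).toLinearMap) = d

/-! ### Bundle isometries -/

/-- The form in which the quotient map `(X, δ) → (B, r)` is a Riemannian submersion with totally
geodesic fibers when `X` and `B` are only metric spaces: it is distance non-increasing, each fiber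
can be reached from each point `x` by a point at distance equal to that of the base points, and
the `δ`-geodesics (of length less than `π`) between points of a fiber stay in the fiber. -/
structure IsMetricSubmersion {X : Type*} {r : X → X → ℝ} (hr : IsPseudoMetric r)
    (θ : X → X → ℝ) : Prop where
  contracting : ∀ x y, baseDist hr (proj hr x) (proj hr y) ≤ delta r θ x y
  lifts : ∀ x (b : Base hr), ∃ y, proj hr y = b ∧ delta r θ x y = baseDist hr (proj hr x) b
  fiber_geodesic : ∀ x y z, proj hr x = proj hr y → delta r θ x y < Real.pi →
    delta r θ x z + delta r θ z y = delta r θ x y → proj hr z = proj hr x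

/-- `(Φ, Ψ)` is a bundle isometry between the quotient map `(X, δ) → (B, r)` and the map
`P : (S^3, d) → (S^2, d/2)`. -/
structure IsBundleIsometry {X : Type*} {r : X → X → ℝ} (hr : IsPseudoMetric r)
    (θ : X → X → ℝ) (Φ : X ≃ Sph 3) (Ψ : Base hr ≃ Sph 2) (P : Sph 3 → Sph 2) : Prop where
  isometry_total : ∀ x y, sphereDist (Φ x) (Φ y) = delta r θ x y
  isometry_base : ∀ b c, 1 / 2 * sphereDist (Ψ b) (Ψ c) = baseDist hr b c
  comm : ∀ x, P (Φ x) = Ψ (proj hr x)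
  submersion_source : IsMetricSubmersion hr θ
  submersion_target : IsRiemannianSubmersion (1 / 2) P
  totallyGeodesic_target : HasTotallyGeodesicFibers P

/-- The Hopf fibration `(z, w) ↦ (|z|² - |w|², 2 z w̄)`, with `z = x₀ + i x₁`, `w = x₂ + i x₃`. -/
def hopf (u : Sph 3) : Sph 2 :=
  ⟨!₂[u.1 0 ^ 2 + u.1 1 ^ 2 - u.1 2 ^ 2 - u.1 3 ^ 2,
      2 * (u.1 0 * u.1 2 + u.1 1 * u.1 3), 2 * (u.1 1 * u.1 2 - u.1 0 * u.1 3)], by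
    have h : ‖u.1‖ ^ 2 = 1 := by rw [mem_sphere_zero_iff_norm.1 u.2]; norm_num
    rw [EuclideanSpace.norm_sq_eq] at h
    simp only [Real.norm_eq_abs, sq_abs] at h
    have h4 : u.1 0 ^ 2 + u.1 1 ^ 2 + u.1 2 ^ 2 + u.1 3 ^ 2 = 1 :=
      (Fin.sum_univ_four (fun i => u.1 i ^ 2)).symm.trans h
    rw [mem_sphere_zero_iff_norm, ← sq_eq_sq₀ (norm_nonneg _) zero_le_one,
      EuclideanSpace.norm_sq_eq]
    simp only [Fin.sum_univ_three, Real.norm_eq_abs, sq_abs]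
    simp only [Matrix.cons_val_zero, Matrix.cons_val_one, Matrix.cons_val]
    calc _ = (u.1 0 ^ 2 + u.1 1 ^ 2 + u.1 2 ^ 2 + u.1 3 ^ 2) ^ 2 := by ring
      _ = 1 ^ 2 := by rw [h4]⟩

end HopfRigidity

end

/-!
For large `t` the kernel is a power series `∑ q^j e_j` in `q = e^{-2t}`, where `e_j` collects the
terms of eigenvalue `2j`.  All kernels are then continuous, the identities that are assumed almost
everywhere hold everywhere, and by comparison of coefficients the semigroup property says that the
`e_j` are kernels of mutually orthogonal projections of `L²(μ)`, with `μ` a probability measure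
(`eigenKernel_orthogonal`).  This is the only way in which the heat kernel enters the proof.

*The map to the three-sphere.*  Put `a = cos r cos θ` and `b = cos² r`.  The projection `e_1 = 4a`
is equal to `4` on the diagonal, so its rank is `4` (`exists_orthonormal_of_reproducing`) and
`a(x, y) = ⟨f(x), f(y)⟩` for a map `f` to the unit sphere of `ℝ⁴`.  Orthogonality of `e_0, …, e_6`
determines the mean of `a⁶`; as the squares of the differences sum to zero, this forces all moments
of degree six of `f_*μ` to be those of a cubature formula (`mean_prod_six`).  In particular the
fourth moments are those of the uniform measure, and a cubic form that vanishes on the image of `f`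
is zero (`cubic_eq_zero`).

*The map to the two-sphere.*  By a trace computation the projection `e_2 = 6(2a² - b)` consists of
quadratic forms in `f`.  Hence so does `3 cos 2r`, which is the complementary projection in the
traceless quadratic forms and has rank `3`: `3 cos 2r(x, y) = ∑_s H_s(f(x)) H_s(f(y))`
(`IsSpectralPair.exists_quadratic_forms`).  Orthogonality of `e_1` and `e_3` gives a cubic identity
for the `H_s`, which holds identically since it holds on the image of `f`.  It makes the matrices of
the `H_s`, suitably scaled, anticommuting symmetric involutions (`anticommute_of_quadratic_identity`),
and three such matrices have a normal form (`exists_basis_of_clifford`): in suitable coordinates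
`(H_1, H_2, H_3)` is the Hopf map (`IsSpectralPair.exists_map_sphere`).

*Surjectivity.*  Every summand of the kernel is now the zonal kernel of an irreducible representation
of `SU(2)`, evaluated at `f(x)` and `f(y)`, and the addition formula (`sum_matrixCoeff_mul_conj`)
writes it as a sum of products of matrix coefficients.  The double mean of `e_j`, `j ≠ 0`, is zero and
is a sum of squares of moduli of means of matrix coefficients, so all of these means vanish
(`integral_herm_pow_mul_jacobiSum_eq_zero`).  Consequently the mean of `⟨u, f⟩^m` does not depend on
the unit vector `u`.  If the image of `f`, which is closed by completeness of `M`, were not the whole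
sphere, a bump function around a missing point would contradict this (`exists_equiv_sphere`).

*Geometry.*  The differential of the Hopf map multiplies lengths by `2` on the complement of the
vertical direction, and its fibers are great circles; this gives the Riemannian and the metric
statements (`IsHopfLike`, `isMetricSubmersion_of_equiv`).  Finally, the coordinate maps of any two
dual systems differ by a linear isometry (`IsDualSystem.exists_isometry`), so that the statements for
one choice of points and bases imply those for all choices.
-/

noncomputable section

namespace HopfRigidity

open scoped BoundedContinuousFunction

/-! ### The spectral expansion of the kernel -/

/-- The Jacobi polynomial `P_k^{0,n}(2b - 1)` as a polynomial in `b`. -/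
def jacobiSum (k n : ℕ) (b : ℝ) : ℝ :=
  ∑ s ∈ Finset.range (k + 1), (k.choose s : ℝ) * ((n + k).choose s) * (b - 1) ^ s * b ^ (k - s)

lemma iteratedDeriv_rodrigues (k n : ℕ) (x : ℝ) :
    iteratedDeriv k (fun y : ℝ => (1 + y) ^ n * (1 - y ^ 2) ^ k) x =
      ∑ s ∈ Finset.range (k + 1), (k.choose s : ℝ) *
        (((n + k).descFactorial s : ℝ) * (1 + x) ^ (n + k - s)) *
        ((-1) ^ (k - s) * ((k.descFactorial (k - s) : ℝ) * (1 - x) ^ (k - (k - s)))) := by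
  have h : (fun y : ℝ => (1 + y) ^ n * (1 - y ^ 2) ^ k) =
      fun y : ℝ => (1 + y) ^ (n + k) * (1 - y) ^ k := by
    funext y
    rw [pow_add, mul_assoc, ← mul_pow]
    ring
  rw [h, iteratedDeriv_fun_mul (by fun_prop) (by fun_prop)]
  refine Finset.sum_congr rfl fun s _ => ?_
  rw [iteratedDeriv_comp_const_add s (fun z : ℝ => z ^ (n + k)),
    iteratedDeriv_comp_const_sub (k - s) (fun z : ℝ => z ^ k)]
  simp only [iteratedDeriv_pow, smul_eq_mul]

lemma jacobiP_eq_jacobiSum (k n : ℕ) {x : ℝ} (hx : 1 + x ≠ 0 ∨ n = 0) :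
    jacobiP k n x = jacobiSum k n ((1 + x) / 2) := by
  have hx' : (1 + x) ^ n ≠ 0 := by
    rcases hx with hx | rfl
    · exact pow_ne_zero _ hx
    · simp
  rw [jacobiP, iteratedDeriv_rodrigues, jacobiSum, Finset.mul_sum]
  refine Finset.sum_congr rfl fun s hs => ?_
  have hs' : s ≤ k := Nat.lt_succ_iff.1 (Finset.mem_range.1 hs)
  obtain ⟨m, rfl⟩ := Nat.exists_eq_add_of_le hs'
  have e1 : n + (s + m) - s = n + m := by omega
  have e2 : s + m - s = m := by omega
  have e3 : s + m - m = s := by omega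
  rw [e1, e2, e3, pow_add (1 + x) n m]
  have d1 : ((n + (s + m)).descFactorial s : ℝ) = (s.factorial : ℝ) * ((n + (s + m)).choose s) := by
    rw [Nat.descFactorial_eq_factorial_mul_choose]; push_cast; ring
  have d2 : ((s + m).factorial : ℝ) = (s.factorial : ℝ) * ((s + m).descFactorial m) := by
    have := Nat.factorial_mul_descFactorial (n := s + m) (k := m) (by omega)
    rw [e3] at this
    exact_mod_cast this.symm
  have d3 : ((s + m).factorial : ℝ) ≠ 0 := by positivity
  have e4 : ((1 + x) / 2 - 1) ^ s = (-1) ^ s * (1 - x) ^ s / 2 ^ s := by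
    rw [← mul_pow, ← div_pow]; ring
  have e5 : ((-1 : ℝ)) ^ (s + m) * (-1) ^ m = (-1) ^ s := by
    rw [pow_add, mul_assoc, ← mul_pow]; simp
  rw [d1, e4, div_pow, div_mul_eq_mul_div, div_eq_iff (by positivity), ← e5, d2, pow_add 2 s m]
  field_simp

/-- Rodrigues' formula divides by `(1 + x)^n`, which vanishes for `r = π/2`.  In the kernel the
Jacobi polynomial is multiplied by `(cos r)^n`, so that it can be replaced by `jacobiSum` for all
`r`. -/
lemma cos_pow_mul_jacobiP (k n : ℕ) (r : ℝ) :
    Real.cos r ^ n * jacobiP k n (Real.cos (2 * r)) =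
      Real.cos r ^ n * jacobiSum k n (Real.cos r ^ 2) := by
  by_cases h : Real.cos r = 0 ∧ n ≠ 0
  · rw [h.1, zero_pow h.2, zero_mul, zero_mul]
  · rw [jacobiP_eq_jacobiSum]
    · congr 2
      rw [Real.cos_two_mul]; ring
    · rw [Real.cos_two_mul]
      by_cases hn : n = 0
      · exact Or.inr hn
      · refine Or.inl ?_
        have : Real.cos r ≠ 0 := fun h0 => h ⟨h0, hn⟩
        intro h0
        apply this
        have : Real.cos r ^ 2 = 0 := by linarith
        exact pow_eq_zero_iff (two_ne_zero) |>.1 this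

lemma abs_jacobiSum_le (k n : ℕ) {b : ℝ} (h0 : 0 ≤ b) (h1 : b ≤ 1) :
    |jacobiSum k n b| ≤ 2 ^ (2 * k + n) := by
  calc |jacobiSum k n b| ≤ ∑ s ∈ Finset.range (k + 1), (k.choose s : ℝ) * 2 ^ (n + k) := by
        refine (Finset.abs_sum_le_sum_abs _ _).trans (Finset.sum_le_sum fun s _ => ?_)
        rw [abs_mul, abs_mul, abs_mul, abs_pow, abs_pow, Nat.abs_cast, Nat.abs_cast]
        have a1 : |b - 1| ^ s ≤ 1 :=
          pow_le_one₀ (abs_nonneg _) (by rw [abs_le]; constructor <;> linarith)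
        have a2 : |b| ^ (k - s) ≤ 1 :=
          pow_le_one₀ (abs_nonneg _) (by rw [abs_le]; constructor <;> linarith)
        have a3 : ((n + k).choose s : ℝ) ≤ 2 ^ (n + k) := by
          exact_mod_cast Nat.choose_le_two_pow (n + k) s
        calc (k.choose s : ℝ) * ((n + k).choose s) * |b - 1| ^ s * |b| ^ (k - s)
            ≤ (k.choose s : ℝ) * 2 ^ (n + k) * 1 * 1 := by gcongr
          _ = _ := by ring
    _ = 2 ^ (2 * k + n) := by
        rw [← Finset.sum_mul]
        have := Nat.sum_range_choose k
        have h : ∑ s ∈ Finset.range (k + 1), (k.choose s : ℝ) = 2 ^ k := by exact_mod_cast this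
        rw [h]; ring

/-- The real part of the matrix coefficient of the unitary representation of `SU(2)` of dimension
`2k + n + 1` in the weight vector of weight `n`, in cylindrical coordinates. -/
def cylTerm (n k : ℕ) (r θ : ℝ) : ℝ :=
  Real.cos r ^ n * Real.cos (n * θ) * jacobiSum k n (Real.cos r ^ 2)

lemma abs_cylTerm_le (n k : ℕ) (r θ : ℝ) : |cylTerm n k r θ| ≤ 2 ^ (2 * k + n) := by
  rw [cylTerm, abs_mul, abs_mul, abs_pow]
  have h1 : |Real.cos r| ^ n ≤ 1 := pow_le_one₀ (abs_nonneg _) (Real.abs_cos_le_one r)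
  have h2 := Real.abs_cos_le_one (n * θ)
  have h3 := abs_jacobiSum_le k n (sq_nonneg (Real.cos r)) (Real.cos_sq_le_one r)
  calc |Real.cos r| ^ n * |Real.cos (n * θ)| * |jacobiSum k n (Real.cos r ^ 2)|
      ≤ 1 * 1 * 2 ^ (2 * k + n) := by gcongr
    _ = 2 ^ (2 * k + n) := by rw [one_mul, one_mul]

/-- Half of the eigenvalue `4k(k + |n| + 1) + 2|n|`. -/
def level (i : ℤ × ℕ) : ℕ := 2 * i.2 * (i.2 + i.1.natAbs + 1) + i.1.natAbs

/-- The dimension of the representation with index `(n, k)`. -/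
def mult (i : ℤ × ℕ) : ℝ := 2 * i.2 + i.1.natAbs + 1

lemma mult_pos (i : ℤ × ℕ) : 0 < mult i := by unfold mult; positivity

/-- The indices of the eigenvalue `2j`. -/
def levelSet (j : ℕ) : Finset (ℤ × ℕ) :=
  (Finset.Icc (-(j : ℤ)) j ×ˢ Finset.range (j + 1)).filter fun i => level i = j

lemma le_level (i : ℤ × ℕ) : 2 * i.2 + i.1.natAbs ≤ level i := by
  unfold level
  have : 2 * i.2 * 1 ≤ 2 * i.2 * (i.2 + i.1.natAbs + 1) := Nat.mul_le_mul_left _ (by omega)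
  omega

lemma mem_levelSet {j : ℕ} {i : ℤ × ℕ} : i ∈ levelSet j ↔ level i = j := by
  have := le_level i
  simp only [levelSet, Finset.mem_filter, Finset.mem_product, Finset.mem_Icc, Finset.mem_range]
  constructor
  · exact fun h => h.2
  · intro h
    refine ⟨⟨⟨?_, ?_⟩, ?_⟩, h⟩ <;> omega

/-- The coefficient of `e^{-2jt}` in the kernel. -/
def eigenKernel (j : ℕ) (r θ : ℝ) : ℝ :=
  ∑ i ∈ levelSet j, mult i * cylTerm i.1.natAbs i.2 r θ

lemma abs_mult_mul_cylTerm_le (i : ℤ × ℕ) (r θ : ℝ) :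
    |mult i * cylTerm i.1.natAbs i.2 r θ| ≤ 4 ^ (2 * i.2 + i.1.natAbs) := by
  rw [abs_mul, abs_of_pos (mult_pos i)]
  have h1 : mult i ≤ 2 ^ (2 * i.2 + i.1.natAbs) := by
    have := Nat.lt_two_pow_self (n := 2 * i.2 + i.1.natAbs)
    have h : 2 * i.2 + i.1.natAbs + 1 ≤ 2 ^ (2 * i.2 + i.1.natAbs) := this
    unfold mult
    exact_mod_cast h
  have h2 := abs_cylTerm_le i.1.natAbs i.2 r θ
  calc _ ≤ (2 : ℝ) ^ (2 * i.2 + i.1.natAbs) * 2 ^ (2 * i.2 + i.1.natAbs) := by gcongr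
    _ = _ := by rw [← mul_pow]; norm_num

lemma abs_eigenKernel_le (j : ℕ) (r θ : ℝ) : |eigenKernel j r θ| ≤ 2 * 16 ^ j := by
  have hcard : ((levelSet j).card : ℝ) ≤ 2 * 4 ^ j := by
    have h1 : (levelSet j).card ≤ (2 * j + 1) * (j + 1) := by
      refine (Finset.card_filter_le _ _).trans ?_
      rw [Finset.card_product, Int.card_Icc, Finset.card_range]
      gcongr
      omega
    have h2 : j + 1 ≤ 2 ^ j := Nat.lt_two_pow_self
    have h3 : (2 * j + 1) * (j + 1) ≤ (2 * 2 ^ j) * 2 ^ j := by gcongr; omega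
    have h4 : (2 * 2 ^ j) * 2 ^ j = 2 * 4 ^ j := by rw [mul_assoc, ← mul_pow]; norm_num
    exact_mod_cast (h1.trans h3).trans h4.le
  calc |eigenKernel j r θ| ≤ ∑ i ∈ levelSet j, (4 : ℝ) ^ j := by
        refine (Finset.abs_sum_le_sum_abs _ _).trans (Finset.sum_le_sum fun i hi => ?_)
        refine (abs_mult_mul_cylTerm_le i r θ).trans ?_
        rw [← mem_levelSet.1 hi]
        exact pow_le_pow_right₀ (by norm_num) (le_level i)
    _ = (levelSet j).card * (4 : ℝ) ^ j := by rw [Finset.sum_const, nsmul_eq_mul]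
    _ ≤ 2 * 4 ^ j * 4 ^ j := by gcongr
    _ = 2 * 16 ^ j := by rw [mul_assoc, ← mul_pow]; norm_num

/-- For `q ≤ 1/32` the term with index `(n, k)` is at most `(4q)^(2k + |n|) ≤ 8^(-(2k + |n|))`. -/
lemma summable_level {q : ℝ} (h0 : 0 ≤ q) (h1 : q ≤ 1 / 32) (r θ : ℝ) :
    Summable fun i : ℤ × ℕ => q ^ level i * (mult i * cylTerm i.1.natAbs i.2 r θ) := by
  have s1 : Summable fun n : ℤ => ((1 : ℝ) / 8) ^ n.natAbs := by
    refine Summable.of_nat_of_neg ?_ ?_ <;>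
    simpa using summable_geometric_of_lt_one (r := (1 : ℝ) / 8) (by norm_num) (by norm_num)
  have s2 : Summable fun k : ℕ => (((1 : ℝ) / 8) ^ 2) ^ k :=
    summable_geometric_of_lt_one (by norm_num) (by norm_num)
  refine Summable.of_norm_bounded (s1.mul_of_nonneg s2 (fun _ => by positivity)
    (fun _ => by positivity)) fun i => ?_
  rw [norm_mul, Real.norm_eq_abs, Real.norm_eq_abs, abs_of_nonneg (pow_nonneg h0 _)]
  calc q ^ level i * |mult i * cylTerm i.1.natAbs i.2 r θ|
      ≤ q ^ (2 * i.2 + i.1.natAbs) * 4 ^ (2 * i.2 + i.1.natAbs) := by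
        gcongr ?_ * ?_
        · exact pow_le_pow_of_le_one h0 (by linarith) (le_level i)
        · exact abs_mult_mul_cylTerm_le i r θ
    _ = (q * 4) ^ (2 * i.2 + i.1.natAbs) := by rw [mul_pow]
    _ ≤ (1 / 8) ^ (2 * i.2 + i.1.natAbs) := by gcongr; linarith
    _ = _ := by rw [pow_add, pow_mul]; ring

lemma su2Kernel_term (t r θ : ℝ) (i : ℤ × ℕ) :
    ((kernelCoeff t r i.1.natAbs i.2 : ℂ) * Complex.exp (Complex.I * i.1 * θ)).re =
      Real.exp (-2 * t) ^ level i * (mult i * cylTerm i.1.natAbs i.2 r θ) := by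
  have e1 : Complex.exp (Complex.I * i.1 * θ) =
      Complex.exp (((i.1 * θ : ℝ) : ℂ) * Complex.I) := by congr 1; push_cast; ring
  rw [Complex.re_ofReal_mul, e1, Complex.exp_ofReal_mul_I_re, kernelCoeff,
    mul_assoc _ _ (jacobiP _ _ _), cos_pow_mul_jacobiP, ← Real.exp_nat_mul, cylTerm, mult, level]
  have e2 : Real.cos ((i.1.natAbs : ℝ) * θ) = Real.cos (i.1 * θ) := by
    rcases Int.natAbs_eq i.1 with h | h
    · conv_rhs => rw [h]
      simp
    · conv_rhs => rw [h]
      simp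
  rw [e2]
  have e3 : (-(4 * (i.2 : ℝ) * (i.2 + i.1.natAbs + 1) + 2 * i.1.natAbs) * t) =
      (((2 * i.2 * (i.2 + i.1.natAbs + 1) + i.1.natAbs : ℕ) : ℝ) * (-2 * t)) := by
    push_cast; ring
  rw [e3]
  ring

lemma summable_su2Kernel {t : ℝ} (ht : Real.exp (-2 * t) ≤ 1 / 32) (r θ : ℝ) :
    Summable fun i : ℤ × ℕ =>
      (kernelCoeff t r i.1.natAbs i.2 : ℂ) * Complex.exp (Complex.I * i.1 * θ) := by
  -- the norms of the terms are the values at `θ = 0`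
  refine Summable.of_norm ?_
  have h := (summable_level (Real.exp_pos _).le ht r 0).norm
  refine h.congr fun i => ?_
  rw [← su2Kernel_term]
  have e1 : Complex.exp (Complex.I * i.1 * θ) =
      Complex.exp (((i.1 * θ : ℝ) : ℂ) * Complex.I) := by congr 1; push_cast; ring
  rw [norm_mul, e1, Complex.norm_exp_ofReal_mul_I]
  simp

/-- For large `t` the kernel is a power series in `e^{-2t}`. -/
lemma hasSum_eigenKernel {t : ℝ} (ht : Real.exp (-2 * t) ≤ 1 / 32) (r θ : ℝ) :
    HasSum (fun j => Real.exp (-2 * t) ^ j * eigenKernel j r θ) (su2Kernel t r θ).re := by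
  have h1 : su2Kernel t r θ = ∑' i : ℤ × ℕ,
      (kernelCoeff t r i.1.natAbs i.2 : ℂ) * Complex.exp (Complex.I * i.1 * θ) :=
    ((summable_su2Kernel ht r θ).tsum_prod).symm
  have h2 := Complex.hasSum_re (summable_su2Kernel ht r θ).hasSum
  rw [← h1] at h2
  simp only [su2Kernel_term] at h2
  refine (h2.tsum_fiberwise level).congr_fun fun j => ?_
  have h3 : level ⁻¹' {j} = (levelSet j : Set (ℤ × ℕ)) := by
    ext i; simp [mem_levelSet]
  rw [h3, Finset.tsum_subtype' (levelSet j)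
    (fun i : ℤ × ℕ => Real.exp (-2 * t) ^ level i * (mult i * cylTerm i.1.natAbs i.2 r θ)),
    eigenKernel, Finset.mul_sum]
  refine Finset.sum_congr rfl fun i hi => ?_
  rw [mem_levelSet.1 hi]

lemma cos_add_two_mul (n : ℕ) (θ : ℝ) : Real.cos ((n + 2 : ℕ) * θ) =
    2 * Real.cos θ * Real.cos ((n + 1 : ℕ) * θ) - Real.cos (n * θ) := by
  have e1 : ((n + 2 : ℕ) : ℝ) * θ = (n + 1 : ℕ) * θ + θ := by push_cast; ring
  have e2 : (n : ℝ) * θ = (n + 1 : ℕ) * θ - θ := by push_cast; ring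
  rw [e1, e2, Real.cos_add, Real.cos_sub]
  ring

lemma cylTerm_zero_right (n : ℕ) (r θ : ℝ) :
    cylTerm n 0 r θ = Real.cos r ^ n * Real.cos (n * θ) := by
  simp [cylTerm, jacobiSum]

lemma cylTerm_zero_one (r θ : ℝ) : cylTerm 0 1 r θ = 2 * Real.cos r ^ 2 - 1 := by
  simp [cylTerm, jacobiSum, Finset.sum_range_succ]
  ring

section LowLevels

variable (r θ : ℝ)

lemma eigenKernel_zero : eigenKernel 0 r θ = 1 := by
  rw [eigenKernel, show levelSet 0 = {(0, 0)} by decide]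
  simp [mult, cylTerm_zero_right]

/-- The levels that are attained only for `k = 0`. -/
lemma eigenKernel_of_levelSet {j : ℕ} (hj : j ≠ 0)
    (h : levelSet j = {((j : ℤ), 0), (-(j : ℤ), 0)}) :
    eigenKernel j r θ = 2 * (j + 1) * (Real.cos r ^ j * Real.cos (j * θ)) := by
  rw [eigenKernel, h, Finset.sum_pair (by simp; omega)]
  simp [mult, cylTerm_zero_right]
  ring

lemma cos_nat_mul_expand :
    Real.cos ((2 : ℕ) * θ) = 2 * Real.cos θ ^ 2 - 1 ∧
    Real.cos ((3 : ℕ) * θ) = 4 * Real.cos θ ^ 3 - 3 * Real.cos θ ∧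
    Real.cos ((4 : ℕ) * θ) = 8 * Real.cos θ ^ 4 - 8 * Real.cos θ ^ 2 + 1 ∧
    Real.cos ((5 : ℕ) * θ) = 16 * Real.cos θ ^ 5 - 20 * Real.cos θ ^ 3 + 5 * Real.cos θ ∧
    Real.cos ((6 : ℕ) * θ) =
      32 * Real.cos θ ^ 6 - 48 * Real.cos θ ^ 4 + 18 * Real.cos θ ^ 2 - 1 := by
  have h0 : Real.cos ((0 : ℕ) * θ) = 1 := by simp
  have h1 : Real.cos ((1 : ℕ) * θ) = Real.cos θ := by simp
  have h2 := cos_add_two_mul 0 θ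
  have h3 := cos_add_two_mul 1 θ
  have h4 := cos_add_two_mul 2 θ
  have h5 := cos_add_two_mul 3 θ
  have h6 := cos_add_two_mul 4 θ
  simp only [Nat.reduceAdd] at h2 h3 h4 h5 h6
  rw [h0, h1] at h2
  rw [h1, h2] at h3
  rw [h2, h3] at h4
  rw [h3, h4] at h5
  rw [h4, h5] at h6
  refine ⟨?_, ?_, ?_, ?_, ?_⟩
  · rw [h2]; ring
  · rw [h3]; ring
  · rw [h4]; ring
  · rw [h5]; ring
  · rw [h6]; ring

lemma eigenKernel_one : eigenKernel 1 r θ = 4 * (Real.cos r * Real.cos θ) := by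
  rw [eigenKernel_of_levelSet r θ (by norm_num) (by decide)]
  push_cast
  ring_nf

lemma eigenKernel_two : eigenKernel 2 r θ =
    6 * (2 * (Real.cos r * Real.cos θ) ^ 2 - Real.cos r ^ 2) := by
  rw [eigenKernel_of_levelSet r θ (by norm_num) (by decide), (cos_nat_mul_expand θ).1]
  push_cast
  ring

lemma eigenKernel_three : eigenKernel 3 r θ =
    8 * (4 * (Real.cos r * Real.cos θ) ^ 3 - 3 * (Real.cos r * Real.cos θ) * Real.cos r ^ 2) := by
  rw [eigenKernel_of_levelSet r θ (by norm_num) (by decide), (cos_nat_mul_expand θ).2.1]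
  push_cast
  ring

/-- The first level to which an index with `k ≠ 0` contributes: `level (0, 1) = 4`. -/
lemma eigenKernel_four : eigenKernel 4 r θ =
    10 * (8 * (Real.cos r * Real.cos θ) ^ 4 - 8 * (Real.cos r * Real.cos θ) ^ 2 * Real.cos r ^ 2
      + (Real.cos r ^ 2) ^ 2) + 3 * (2 * Real.cos r ^ 2 - 1) := by
  rw [eigenKernel, show levelSet 4 = {(4, 0), (-4, 0), (0, 1)} by decide,
    Finset.sum_insert (by decide), Finset.sum_pair (by decide)]
  have h := (cos_nat_mul_expand θ).2.2.1
  norm_num at h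
  simp [mult, cylTerm_zero_right, cylTerm_zero_one, h]
  ring

lemma eigenKernel_five : eigenKernel 5 r θ =
    12 * (16 * (Real.cos r * Real.cos θ) ^ 5 - 20 * (Real.cos r * Real.cos θ) ^ 3 * Real.cos r ^ 2
      + 5 * (Real.cos r * Real.cos θ) * (Real.cos r ^ 2) ^ 2) := by
  rw [eigenKernel_of_levelSet r θ (by norm_num) (by decide), (cos_nat_mul_expand θ).2.2.2.1]
  push_cast
  ring

lemma eigenKernel_six : eigenKernel 6 r θ =
    14 * (32 * (Real.cos r * Real.cos θ) ^ 6 - 48 * (Real.cos r * Real.cos θ) ^ 4 * Real.cos r ^ 2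
      + 18 * (Real.cos r * Real.cos θ) ^ 2 * (Real.cos r ^ 2) ^ 2 - (Real.cos r ^ 2) ^ 3) := by
  rw [eigenKernel_of_levelSet r θ (by norm_num) (by decide), (cos_nat_mul_expand θ).2.2.2.2]
  push_cast
  ring

end LowLevels

/-! ### Uniqueness of power series coefficients -/

lemma coeff_eq_zero_of_hasSum_zero {a : ℕ → ℝ} {C ρ ε : ℝ} (hε : 0 < ε)
    (ha : ∀ j, |a j| ≤ C * ρ ^ j) (hρ : 0 ≤ ρ) (hερ : ε * ρ < 1)
    (h : ∀ q, 0 < q → q ≤ ε → HasSum (fun j => q ^ j * a j) 0) (m : ℕ) : a m = 0 := by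
  induction m using Nat.strong_induction_on with
  | _ m ih =>
    have hC : 0 ≤ C := by
      have := (abs_nonneg _).trans (ha 0)
      simpa using this
    have hS : ∀ q, 0 < q → q ≤ ε → ∑' j, q ^ j * a (j + m) = 0 := by
      intro q hq hqε
      have h1 := (hasSum_nat_add_iff' m).2 (h q hq hqε)
      rw [Finset.sum_eq_zero (fun i hi => by rw [ih i (Finset.mem_range.1 hi), mul_zero]),
        sub_zero] at h1
      have h2 := h1.mul_left ((q ^ m)⁻¹)
      rw [mul_zero] at h2
      refine HasSum.tsum_eq (h2.congr_fun fun j => ?_)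
      rw [pow_add]
      have : q ^ m ≠ 0 := pow_ne_zero _ hq.ne'
      field_simp
    have hT : Tendsto (fun q : ℝ => ∑' j, q ^ j * a (j + m)) (𝓝[>] 0)
        (𝓝 (∑' j, (0 : ℝ) ^ j * a (j + m))) := by
      refine tendsto_tsum_of_dominated_convergence
        (bound := fun j => C * ρ ^ m * (ε * ρ) ^ j) ?_ ?_ ?_
      · exact (summable_geometric_of_lt_one (by positivity) hερ).mul_left _
      · intro j
        refine Tendsto.mul_const _ ?_
        exact ((continuous_pow j).tendsto 0).mono_left nhdsWithin_le_nhds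
      · have : Set.Ioc (0 : ℝ) ε ∈ 𝓝[>] (0 : ℝ) := Ioc_mem_nhdsGT hε
        filter_upwards [this] with q hq j
        rw [Real.norm_eq_abs, abs_mul, abs_of_nonneg (pow_nonneg hq.1.le _)]
        calc q ^ j * |a (j + m)| ≤ ε ^ j * (C * ρ ^ (j + m)) := by
              gcongr
              · exact hq.1.le
              · exact hq.2
              · exact ha _
          _ = C * ρ ^ m * (ε * ρ) ^ j := by rw [pow_add, mul_pow]; ring
    have h0 : ∑' j, (0 : ℝ) ^ j * a (j + m) = a m := by
      rw [tsum_eq_single 0]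
      · simp
      · intro j hj; simp [hj]
    rw [h0] at hT
    refine tendsto_nhds_unique hT (tendsto_const_nhds.congr' ?_)
    have : Set.Ioc (0 : ℝ) ε ∈ 𝓝[>] (0 : ℝ) := Ioc_mem_nhdsGT hε
    filter_upwards [this] with q hq
    exact (hS q hq.1 hq.2).symm

lemma coeff_eq_of_hasSum {a b : ℕ → ℝ} {C D ρ ε : ℝ} (hε : 0 < ε)
    (ha : ∀ j, |a j| ≤ C * ρ ^ j) (hb : ∀ j, |b j| ≤ D * ρ ^ j) (hρ : 0 ≤ ρ) (hερ : ε * ρ < 1)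
    (h : ∀ q, 0 < q → q ≤ ε →
      ∃ S, HasSum (fun j => q ^ j * a j) S ∧ HasSum (fun j => q ^ j * b j) S) (m : ℕ) :
    a m = b m := by
  refine sub_eq_zero.1 (coeff_eq_zero_of_hasSum_zero (a := fun j => a j - b j) (C := C + D)
    hε (fun j => ?_) hρ hερ (fun q h1 h2 => ?_) m)
  · calc |a j - b j| ≤ |a j| + |b j| := abs_sub _ _
      _ ≤ (C + D) * ρ ^ j := by rw [add_mul]; exact add_le_add (ha j) (hb j)
  · obtain ⟨S, h3, h4⟩ := h q h1 h2
    simpa [mul_sub] using h3.sub h4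

/-! ### The topology generated by `r` and `θ` -/

section Topology

variable {M : Type*} [TopologicalSpace M] {r θ : M → M → ℝ}

lemma continuous_r (hrθ : IsAdmissiblePair r θ) (htop : IsCompatibleTopology r θ) :
    Continuous fun z : M × M => r z.1 z.2 := by
  have hr := hrθ.pseudoMetric
  have hball : ∀ x, ∀ ε > 0, {y | r x y < ε} ∈ 𝓝 x := by
    intro x ε hε
    refine IsOpen.mem_nhds ((htop.isOpen_iff _).2 fun y hy => ?_) (by simpa [hr.self] using hε)
    refine ⟨ε - r x y, sub_pos.2 hy, fun z hz _ => ?_⟩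
    have := hr.triangle x y z
    simp only [Set.mem_ofPred_eq]
    linarith
  rw [continuous_iff_continuousAt]
  rintro ⟨x, y⟩
  rw [ContinuousAt, Metric.tendsto_nhds]
  intro ε hε
  filter_upwards [prod_mem_nhds (hball x (ε / 2) (half_pos hε)) (hball y (ε / 2) (half_pos hε))]
  rintro ⟨x', y'⟩ ⟨h1, h2⟩
  simp only [Set.mem_ofPred_eq] at h1 h2
  have t1 := hr.triangle x x' y
  have t2 := hr.triangle x' y' y
  have t3 := hr.triangle x' x y'
  have t4 := hr.triangle x y y'
  rw [hr.symm y' y] at t2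
  rw [hr.symm x' x] at t3
  rw [Real.dist_eq, abs_lt]
  constructor <;> simp only <;> linarith

/-- The topology is determined by the distance-like function `max r θ`, although `θ` need not
satisfy the triangle inequality. -/
lemma nhds_eq_comap (hrθ : IsAdmissiblePair r θ) (htop : IsCompatibleTopology r θ) (x : M) :
    𝓝 x = comap (fun y => max (r x y) (θ x y)) (𝓝 0) := by
  have hr := hrθ.pseudoMetric
  have hc := continuous_r hrθ htop
  have hopen : IsOpen {z : M × M | r z.1 z.2 < Real.pi / 2} := isOpen_lt hc continuous_const
  apply le_antisymm
  · rw [← tendsto_iff_comap]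
    have h1 : Tendsto (fun y => r x y) (𝓝 x) (𝓝 0) := by
      have := (hc.comp (Continuous.prodMk_right x)).tendsto x
      simpa [Function.comp_def, hr.self] using this
    have h2 : Tendsto (fun y => θ x y) (𝓝 x) (𝓝 0) := by
      have h3 : ContinuousAt (fun z : M × M => θ z.1 z.2) (x, x) :=
        htop.continuousOn_angle.continuousAt (hopen.mem_nhds (by
          simp [hr.self, Real.pi_pos]))
      have h4 : ContinuousAt (fun y : M => (x, y)) x := (Continuous.prodMk_right x).continuousAt
      have := ContinuousAt.comp_of_eq h3 h4 rfl
      simpa [ContinuousAt, Function.comp_def, hrθ.angle_self] using this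
    simpa using h1.max h2
  · intro U hU
    obtain ⟨V, hVU, hV, hxV⟩ := mem_nhds_iff.1 hU
    obtain ⟨ε, hε, h⟩ := (htop.isOpen_iff V).1 hV x hxV
    refine ⟨Set.Iio ε, Iio_mem_nhds hε, fun y hy => hVU ?_⟩
    have hy' : max (r x y) (θ x y) < ε := hy
    exact h y ((le_max_left _ _).trans_lt hy') ((le_max_right _ _).trans_lt hy')

lemma firstCountableTopology_of_compatible (hrθ : IsAdmissiblePair r θ)
    (htop : IsCompatibleTopology r θ) : FirstCountableTopology M :=
  ⟨fun x => by rw [nhds_eq_comap hrθ htop x]; infer_instance⟩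

/-- The function `θ` is continuous only for `r < π/2`; the factor `(cos r)^n` removes the
discontinuity. -/
lemma continuous_cos_pow_mul_cos (hrθ : IsAdmissiblePair r θ) (htop : IsCompatibleTopology r θ)
    (n : ℕ) : Continuous fun z : M × M =>
      Real.cos (r z.1 z.2) ^ n * Real.cos (n * θ z.1 z.2) := by
  have hc := continuous_r hrθ htop
  have hopen : IsOpen {z : M × M | r z.1 z.2 < Real.pi / 2} := isOpen_lt hc continuous_const
  rcases eq_or_ne n 0 with rfl | hn
  · simpa using continuous_const
  rw [continuous_iff_continuousAt]
  intro z
  rcases lt_or_eq_of_le (hrθ.le_half_pi z.1 z.2) with h | h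
  · have h3 : ContinuousAt (fun z : M × M => θ z.1 z.2) z :=
      htop.continuousOn_angle.continuousAt (hopen.mem_nhds h)
    have h4 := hc.continuousAt (x := z)
    fun_prop
  · -- the factor `cos r` tends to `0`, whatever `θ` does
    have h0 : Real.cos (r z.1 z.2) = 0 := by rw [h, Real.cos_pi_div_two]
    have h1 : Tendsto (fun z : M × M => |Real.cos (r z.1 z.2)| ^ n) (𝓝 z) (𝓝 0) := by
      have : Continuous fun z : M × M => |Real.cos (r z.1 z.2)| ^ n := by fun_prop
      have := this.tendsto z
      simpa [h0, hn] using this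
    rw [ContinuousAt, h0, zero_pow hn, zero_mul]
    refine squeeze_zero_norm (fun z => ?_) h1
    rw [norm_mul, norm_pow, Real.norm_eq_abs]
    exact mul_le_of_le_one_right (by positivity) (Real.abs_cos_le_one _)

lemma continuous_cylTerm (hrθ : IsAdmissiblePair r θ) (htop : IsCompatibleTopology r θ)
    (n k : ℕ) : Continuous fun z : M × M => cylTerm n k (r z.1 z.2) (θ z.1 z.2) := by
  have hc := continuous_r hrθ htop
  refine (continuous_cos_pow_mul_cos hrθ htop n).mul ?_
  unfold jacobiSum
  fun_prop

lemma continuous_eigenKernel (hrθ : IsAdmissiblePair r θ) (htop : IsCompatibleTopology r θ)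
    (j : ℕ) : Continuous fun z : M × M => eigenKernel j (r z.1 z.2) (θ z.1 z.2) := by
  unfold eigenKernel
  exact continuous_finsetSum _ fun i _ => (continuous_cylTerm hrθ htop _ _).const_mul _

end Topology

/-! ### The eigenvalue expansion is an orthogonal decomposition -/

section Orthogonality

variable {M : Type*} {r θ : M → M → ℝ} {p : ℝ → M → M → ℝ}

/-- Termwise integration of a power series in `q` with coefficients of the size of `eigenKernel`. -/
lemma hasSum_integral_mul_of_bound {X : Type*} [MeasurableSpace X] {ν : Measure X}
    [IsFiniteMeasure ν] {e : ℕ → X → ℝ} {g s : X → ℝ} {C q : ℝ}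
    (he : ∀ j, AEStronglyMeasurable (e j) ν) (hbd : ∀ j w, |e j w| ≤ 2 * 16 ^ j)
    (hg : AEStronglyMeasurable g ν) (hgC : ∀ w, |g w| ≤ C) (hq0 : 0 < q) (hq : q ≤ 1 / 32)
    (hs : ∀ w, HasSum (fun j => q ^ j * e j w) (s w)) :
    HasSum (fun j => q ^ j * ∫ w, e j w * g w ∂ν) (∫ w, s w * g w ∂ν) := by
  have h := hasSum_integral_of_dominated_convergence (μ := ν)
    (F := fun j w => q ^ j * (e j w * g w)) (f := fun w => s w * g w)
    (bound := fun j _ => (1 / 2 : ℝ) ^ j * (2 * C)) (fun j => ((he j).mul hg).const_mul _)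
    (fun j => Eventually.of_forall fun w => ?_) (Eventually.of_forall fun w => ?_) ?_
    (Eventually.of_forall fun w => ?_)
  · simpa only [integral_const_mul] using h
  · rw [Real.norm_eq_abs, abs_mul, abs_mul, abs_of_nonneg (pow_nonneg hq0.le _)]
    calc q ^ j * (|e j w| * |g w|) ≤ (1 / 32) ^ j * ((2 * 16 ^ j) * C) := by
          gcongr
          · exact hbd j w
          · exact hgC w
      _ = (1 / 2) ^ j * (2 * C) := by
          rw [show (1 / 2 : ℝ) = 1 / 32 * 16 by norm_num, mul_pow]; ring
  · exact (summable_geometric_of_lt_one (by norm_num) (by norm_num)).mul_right _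
  · exact integrable_const _
  · simpa only [mul_assoc] using (hs w).mul_right (g w)

lemma hasSum_heatKernel (hform : ∀ t > 0, ∀ x y, (p t x y : ℂ) = su2Kernel t (r x y) (θ x y))
    {t : ℝ} (ht0 : 0 < t) (ht : Real.exp (-2 * t) ≤ 1 / 32) (x y : M) :
    HasSum (fun j => Real.exp (-2 * t) ^ j * eigenKernel j (r x y) (θ x y)) (p t x y) := by
  have := hasSum_eigenKernel ht (r x y) (θ x y)
  rwa [← hform t ht0, Complex.ofReal_re] at this

lemma abs_pow_mul_eigenKernel_le {q : ℝ} (hq0 : 0 ≤ q) {c : ℝ} (hq : q ≤ c) (j : ℕ) (r θ : ℝ) :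
    |q ^ j * eigenKernel j r θ| ≤ 2 * (16 * c) ^ j := by
  rw [abs_mul, abs_of_nonneg (pow_nonneg hq0 _)]
  have hc : 0 ≤ c := hq0.trans hq
  calc q ^ j * |eigenKernel j r θ| ≤ c ^ j * (2 * 16 ^ j) := by
        gcongr
        exact abs_eigenKernel_le j r θ
    _ = 2 * (16 * c) ^ j := by rw [mul_pow]; ring

lemma exists_exp_eq {q : ℝ} (hq0 : 0 < q) (hq : q ≤ 1 / 32) :
    ∃ t > 0, Real.exp (-2 * t) = q := by
  refine ⟨-Real.log q / 2, ?_, ?_⟩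
  · have : Real.log q < 0 := Real.log_neg hq0 (by linarith)
    linarith
  · rw [show -2 * (-Real.log q / 2) = Real.log q by ring, Real.exp_log hq0]

/-- For large `t` the constant term `1` dominates the expansion of the kernel. -/
lemma half_le_heatKernel
    (hform : ∀ t > 0, ∀ x y, (p t x y : ℂ) = su2Kernel t (r x y) (θ x y))
    {t : ℝ} (ht0 : 0 < t) (ht : Real.exp (-2 * t) ≤ 1 / 128) (x y : M) : 1 / 2 ≤ p t x y := by
  have h := hasSum_heatKernel hform ht0 (ht.trans (by norm_num)) x y
  have h1 := (hasSum_nat_add_iff' 1).2 h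
  simp only [Finset.sum_range_one, pow_zero, one_mul, eigenKernel_zero] at h1
  have hg : HasSum (fun j : ℕ => 2 * (16 * (1 / 128 : ℝ)) ^ (j + 1))
      (2 / 8 * (1 - 1 / 8)⁻¹) := by
    have := (hasSum_geometric_of_lt_one (r := (1 / 8 : ℝ)) (by norm_num) (by norm_num)).mul_left
      (2 / 8)
    refine this.congr_fun fun j => ?_
    rw [pow_succ, show (16 * (1 / 128) : ℝ) = 1 / 8 by norm_num]
    ring
  have h2 : |p t x y - 1| ≤ 2 / 8 * (1 - 1 / 8)⁻¹ := by
    rw [← h1.tsum_eq, ← Real.norm_eq_abs]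
    exact tsum_of_norm_bounded hg fun j =>
      abs_pow_mul_eigenKernel_le (Real.exp_pos _).le ht (j + 1) _ _
  have := (abs_le.1 h2).1
  norm_num at this
  linarith

variable [Nonempty M] [TopologicalSpace M] [MeasurableSpace M] {μ : Measure M}
  [μ.IsOpenPosMeasure]

/-- The integral of the kernel is `1` while the kernel is bounded below, so the total mass is
finite. -/
lemma isFiniteMeasure_of_heatKernel (hp : IsHeatKernel μ p)
    (hform : ∀ t > 0, ∀ x y, (p t x y : ℂ) = su2Kernel t (r x y) (θ x y)) :
    IsFiniteMeasure μ := by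
  obtain ⟨t, ht0, ht⟩ := exists_exp_eq (q := 1 / 128) (by norm_num) (by norm_num)
  have : NeZero μ := inferInstance
  obtain ⟨x, hx, -⟩ := (hp.conservative t ht0).exists
  have h : Integrable (fun _ : M => (1 / 2 : ℝ)) μ := by
    refine hx.mono' aestronglyMeasurable_const (Eventually.of_forall fun y => ?_)
    rw [Real.norm_of_nonneg (by norm_num)]
    exact half_le_heatKernel hform ht0 ht.le x y
  exact (integrable_const_iff.1 h).resolve_left (by norm_num)

variable [BorelSpace M] [SigmaFinite μ]

/-- The semigroup identity is assumed almost everywhere.  For large times both sides are continuous,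
so that it holds everywhere. -/
lemma heatKernel_semigroup (hrθ : IsAdmissiblePair r θ) (htop : IsCompatibleTopology r θ)
    (hp : IsHeatKernel μ p)
    (hform : ∀ t > 0, ∀ x y, (p t x y : ℂ) = su2Kernel t (r x y) (θ x y))
    {s t : ℝ} (hs0 : 0 < s) (hs : Real.exp (-2 * s) ≤ 1 / 32) (ht0 : 0 < t)
    (ht : Real.exp (-2 * t) ≤ 1 / 32) (x y : M) :
    p (s + t) x y = ∫ w, p s x w * p t w y ∂μ := by
  have := isFiniteMeasure_of_heatKernel hp hform
  have := firstCountableTopology_of_compatible hrθ htop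
  have hsum : Summable fun j : ℕ => 2 * (16 * (1 / 32 : ℝ)) ^ j :=
    (summable_geometric_of_lt_one (by norm_num) (by norm_num)).mul_left _
  have hcont : ∀ t, 0 < t → Real.exp (-2 * t) ≤ 1 / 32 →
      Continuous fun z : M × M => p t z.1 z.2 := by
    intro t h0 h1
    have h2 : (fun z : M × M => p t z.1 z.2) = fun z : M × M => ∑' j,
        Real.exp (-2 * t) ^ j * eigenKernel j (r z.1 z.2) (θ z.1 z.2) :=
      funext fun z => (hasSum_heatKernel hform h0 h1 z.1 z.2).tsum_eq.symm
    rw [h2]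
    exact continuous_tsum (fun j => (continuous_eigenKernel hrθ htop j).const_mul _) hsum
      fun j z => abs_pow_mul_eigenKernel_le (Real.exp_pos _).le h1 j _ _
  have hbd : ∀ t, 0 < t → Real.exp (-2 * t) ≤ 1 / 32 → ∀ x y, |p t x y| ≤
      ∑' j : ℕ, 2 * (16 * (1 / 32 : ℝ)) ^ j := by
    intro t h0 h1 x y
    rw [← (hasSum_heatKernel hform h0 h1 x y).tsum_eq, ← Real.norm_eq_abs]
    exact tsum_of_norm_bounded hsum.hasSum
      fun j => abs_pow_mul_eigenKernel_le (Real.exp_pos _).le h1 j _ _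
  set C := ∑' j : ℕ, 2 * (16 * (1 / 32 : ℝ)) ^ j
  have hst : Real.exp (-2 * (s + t)) ≤ 1 / 32 := by
    refine le_trans (Real.exp_le_exp.2 ?_) hs
    linarith
  have c1 := hcont (s + t) (by positivity) hst
  have c2 : Continuous fun z : M × M => ∫ w, p s z.1 w * p t w z.2 ∂μ := by
    refine continuous_of_dominated (bound := fun _ => C * C) (fun z => ?_) (fun z => ?_)
      (integrable_const _) ?_
    · have h1 := (hcont s hs0 hs).comp (Continuous.prodMk_right z.1)
      have h2 := (hcont t ht0 ht).comp (Continuous.prodMk_left z.2)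
      exact (h1.mul h2).aestronglyMeasurable
    · refine Eventually.of_forall fun w => ?_
      rw [norm_mul]
      exact mul_le_mul (hbd s hs0 hs _ _) (hbd t ht0 ht _ _) (abs_nonneg _)
        ((abs_nonneg _).trans (hbd s hs0 hs z.1 w))
    · refine Eventually.of_forall fun w => ?_
      have h1 := (hcont s hs0 hs).comp (g := fun z : M × M => p s z.1 z.2)
        (f := fun z : M × M => (z.1, w)) (by fun_prop)
      have h2 := (hcont t ht0 ht).comp (g := fun z : M × M => p t z.1 z.2)
        (f := fun z : M × M => (w, z.2)) (by fun_prop)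
      exact h1.mul h2
  have hae := (hp.semigroup s hs0 t ht0).mono fun z hz => hz.2
  exact congrFun ((Continuous.ae_eq_iff_eq (μ.prod μ) c1 c2).1 hae) (x, y)

/-- The kernels `eigenKernel j` are the kernels of mutually orthogonal projections of `L²(μ)`, and
`μ` is a probability measure. -/
theorem eigenKernel_orthogonal (hrθ : IsAdmissiblePair r θ) (htop : IsCompatibleTopology r θ)
    (hp : IsHeatKernel μ p)
    (hform : ∀ t > 0, ∀ x y, (p t x y : ℂ) = su2Kernel t (r x y) (θ x y)) :
    IsProbabilityMeasure μ ∧ ∀ (j l : ℕ) (x y : M),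
      ∫ w, eigenKernel j (r x w) (θ x w) * eigenKernel l (r w y) (θ w y) ∂μ =
        if j = l then eigenKernel j (r x y) (θ x y) else 0 := by
  have := isFiniteMeasure_of_heatKernel hp hform
  have hsum : Summable fun j : ℕ => 2 * (16 * (1 / 32 : ℝ)) ^ j :=
    (summable_geometric_of_lt_one (by norm_num) (by norm_num)).mul_left _
  have hmR : ∀ j x, AEStronglyMeasurable (fun w => eigenKernel j (r x w) (θ x w)) μ := fun j x =>
    ((continuous_eigenKernel hrθ htop j).comp (Continuous.prodMk_right x)).aestronglyMeasurable
  have hmL : ∀ j y, AEStronglyMeasurable (fun w => eigenKernel j (r w y) (θ w y)) μ := fun j y =>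
    ((continuous_eigenKernel hrθ htop j).comp (Continuous.prodMk_left y)).aestronglyMeasurable
  have key : ∀ (j l : ℕ) (x y : M),
      ∫ w, eigenKernel j (r x w) (θ x w) * eigenKernel l (r w y) (θ w y) ∂μ =
        if j = l then eigenKernel j (r x y) (θ x y) else 0 := by
    intro j l x y
    -- the coefficients of the expansion in the first time variable
    have hfirst : ∀ t, 0 < t → Real.exp (-2 * t) ≤ 1 / 32 →
        ∫ w, eigenKernel j (r x w) (θ x w) * p t w y ∂μ =
          Real.exp (-2 * t) ^ j * eigenKernel j (r x y) (θ x y) := by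
      intro t ht0 ht
      have hgm : AEStronglyMeasurable (fun w => p t w y) μ :=
        ((hp.measurable t ht0).comp measurable_prodMk_right).aestronglyMeasurable
      have hgC : ∀ w, |p t w y| ≤ ∑' j : ℕ, 2 * (16 * (1 / 32 : ℝ)) ^ j := fun w => by
        rw [← (hasSum_heatKernel hform ht0 ht w y).tsum_eq, ← Real.norm_eq_abs]
        exact tsum_of_norm_bounded hsum.hasSum
          fun j => abs_pow_mul_eigenKernel_le (Real.exp_pos _).le ht j _ _
      set C := ∑' j : ℕ, 2 * (16 * (1 / 32 : ℝ)) ^ j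
      have hC : 0 ≤ C := (abs_nonneg _).trans (hgC x)
      refine coeff_eq_of_hasSum (a := fun j => ∫ w, eigenKernel j (r x w) (θ x w) * p t w y ∂μ)
        (b := fun j => Real.exp (-2 * t) ^ j * eigenKernel j (r x y) (θ x y))
        (C := 2 * C * μ.real Set.univ) (D := 2) (ρ := 16)
        (ε := 1 / 32) (by norm_num) (fun j => ?_) (fun j => ?_) (by norm_num) (by norm_num)
        (fun q hq0 hq => ?_) j
      · rw [← Real.norm_eq_abs]
        refine (norm_integral_le_of_norm_le_const (C := 2 * 16 ^ j * C)
          (Eventually.of_forall fun w => ?_)).trans (le_of_eq (by ring))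
        rw [norm_mul]
        exact mul_le_mul (abs_eigenKernel_le _ _ _) (hgC w) (abs_nonneg _) (by positivity)
      · refine (abs_pow_mul_eigenKernel_le (Real.exp_pos _).le (c := 1)
          (ht.trans (by norm_num)) j _ _).trans (by rw [mul_one])
      · obtain ⟨s, hs0, rfl⟩ := exists_exp_eq hq0 hq
        refine ⟨p (s + t) x y, ?_, ?_⟩
        · rw [heatKernel_semigroup hrθ htop hp hform hs0 hq ht0 ht]
          exact hasSum_integral_mul_of_bound (fun j => hmR j x)
            (fun j w => abs_eigenKernel_le j _ _) hgm hgC hq0 hq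
            (fun w => hasSum_heatKernel hform hs0 hq x w)
        · have hst : Real.exp (-2 * (s + t)) ≤ 1 / 32 := by
            refine le_trans (Real.exp_le_exp.2 ?_) hq
            linarith
          have := hasSum_heatKernel hform (by positivity : 0 < s + t) hst x y
          refine this.congr_fun fun j => ?_
          rw [← mul_assoc, ← mul_pow, ← Real.exp_add]
          ring_nf
    refine coeff_eq_of_hasSum
      (a := fun l => ∫ w, eigenKernel j (r x w) (θ x w) * eigenKernel l (r w y) (θ w y) ∂μ)
      (b := fun l => if j = l then eigenKernel j (r x y) (θ x y) else 0)
      (C := 2 * (2 * 16 ^ j) * μ.real Set.univ) (D := 2) (ρ := 16)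
      (ε := 1 / 32) (by norm_num) (fun l => ?_) (fun l => ?_) (by norm_num) (by norm_num)
      (fun q hq0 hq => ?_) l
    · rw [← Real.norm_eq_abs]
      refine (norm_integral_le_of_norm_le_const (C := 2 * 16 ^ j * (2 * 16 ^ l))
        (Eventually.of_forall fun w => ?_)).trans (le_of_eq (by ring))
      rw [norm_mul]
      exact mul_le_mul (abs_eigenKernel_le _ _ _) (abs_eigenKernel_le _ _ _) (abs_nonneg _)
        (by positivity)
    · split_ifs with h
      · rw [← h]; exact abs_eigenKernel_le _ _ _
      · rw [abs_zero]; positivity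
    · obtain ⟨t, ht0, rfl⟩ := exists_exp_eq hq0 hq
      refine ⟨∫ w, eigenKernel j (r x w) (θ x w) * p t w y ∂μ, ?_, ?_⟩
      rotate_left
      · have := hasSum_ite_eq j
          (Real.exp (-2 * t) ^ j * eigenKernel j (r x y) (θ x y))
        rw [← hfirst t ht0 hq] at this
        refine this.congr_fun fun l => ?_
        by_cases h : l = j
        · subst h; simp [hfirst t ht0 hq]
        · simp [h, Ne.symm h]
      · have := hasSum_integral_mul_of_bound (ν := μ) (fun l => hmL l y)
            (fun l w => abs_eigenKernel_le l _ _) (hmR j x)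
            (fun w => abs_eigenKernel_le j _ _) hq0 hq
            (fun w => hasSum_heatKernel hform ht0 hq w y)
        simpa only [mul_comm] using this
  refine ⟨⟨?_⟩, key⟩
  obtain ⟨x⟩ := ‹Nonempty M›
  have h := key 0 0 x x
  simp only [eigenKernel_zero, mul_one, integral_const, smul_eq_mul, if_true] at h
  rwa [measureReal_def, ENNReal.toReal_eq_one_iff] at h

end Orthogonality

/-! ### Reproducing kernels of finite rank -/

section Reproducing

variable {M : Type*} [TopologicalSpace M]

/-- A strictly positive, normalized linear functional on bounded continuous functions: the
integral with respect to a probability measure that is positive on non-empty open sets. -/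
structure IsMean (L : (M →ᵇ ℝ) →ₗ[ℝ] ℝ) : Prop where
  nonneg : ∀ f : M →ᵇ ℝ, (∀ x, 0 ≤ f x) → 0 ≤ L f
  eq_zero : ∀ f : M →ᵇ ℝ, (∀ x, 0 ≤ f x) → L f = 0 → f = 0
  one : L 1 = 1

variable {L : (M →ᵇ ℝ) →ₗ[ℝ] ℝ}

lemma IsMean.sq_nonneg (hL : IsMean L) (f : M →ᵇ ℝ) : 0 ≤ L (f * f) :=
  hL.nonneg _ fun x => mul_self_nonneg (f x)

lemma IsMean.eq_zero_of_sq (hL : IsMean L) {f : M →ᵇ ℝ} (h : L (f * f) = 0) : f = 0 := by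
  have := hL.eq_zero (f * f) (fun x => mul_self_nonneg (f x)) h
  ext x
  have h1 : f x * f x = 0 := congrArg (fun g : M →ᵇ ℝ => g x) this
  simpa using h1

lemma IsMean.const (hL : IsMean L) (c : ℝ) : L (c • 1) = c := by
  rw [map_smul, hL.one, smul_eq_mul, mul_one]

/-- A kernel that reproduces itself and is equal to `m` on the diagonal is the kernel of a
projection of rank `m`: it is `∑ f_i(x) f_i(y)` for an orthonormal system of `m` functions.  The
system is a maximal orthonormal system of functions reproduced by the kernel; by Bessel's inequality
it has at most `m` elements. -/
theorem exists_orthonormal_of_reproducing (hL : IsMean L) (κ : M → M →ᵇ ℝ) (m : ℕ)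
    (hκ : ∀ x y, L (κ x * κ y) = κ x y) (hd : ∀ x, κ x x = m) :
    ∃ f : Fin m → M →ᵇ ℝ, (∀ x, κ x = ∑ i, f i x • f i) ∧
      (∀ i j, L (f i * f j) = if i = j then 1 else 0) ∧ ∀ i x, L (κ x * f i) = f i x := by
  classical
  let P : ℕ → Prop := fun N => ∃ f : Fin N → M →ᵇ ℝ,
    (∀ i j, L (f i * f j) = if i = j then 1 else 0) ∧ ∀ i x, L (κ x * f i) = f i x
  -- the component of `κ x` orthogonal to an orthonormal system
  have hinner : ∀ {N : ℕ} (f : Fin N → M →ᵇ ℝ),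
      (∀ i j, L (f i * f j) = if i = j then 1 else 0) → (∀ i x, L (κ x * f i) = f i x) →
      ∀ x j, L ((κ x - ∑ i, f i x • f i) * f j) = 0 := by
    intro N f h1 h2 x j
    simp [sub_mul, Finset.sum_mul, smul_mul_assoc, h1, h2]
  have hbessel : ∀ {N : ℕ} (f : Fin N → M →ᵇ ℝ),
      (∀ i j, L (f i * f j) = if i = j then 1 else 0) → (∀ i x, L (κ x * f i) = f i x) →
      ∀ x, L ((κ x - ∑ i, f i x • f i) * (κ x - ∑ i, f i x • f i)) =
        m - ∑ i, f i x * f i x := by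
    intro N f h1 h2 x
    have h3 := hinner f h1 h2 x
    rw [mul_sub, map_sub, Finset.mul_sum, map_sum]
    have h4 : ∀ i, L ((κ x - ∑ i, f i x • f i) * (f i x • f i)) = 0 := fun i => by
      rw [mul_smul_comm, map_smul, h3, smul_zero]
    simp only [h4, Finset.sum_const_zero, sub_zero]
    simp only [sub_mul, Finset.sum_mul, map_sub, map_sum, hκ, hd, smul_mul_assoc, map_smul,
      smul_eq_mul]
    congr 1
    refine Finset.sum_congr rfl fun i _ => ?_
    rw [mul_comm (f i) (κ x), h2]
  have hmean : ∀ {N : ℕ} (f : Fin N → M →ᵇ ℝ),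
      (∀ i j, L (f i * f j) = if i = j then 1 else 0) →
      L ((m : ℝ) • 1 - ∑ i, f i * f i) = m - N := by
    intro N f h1
    rw [map_sub, hL.const, map_sum]
    simp [h1]
  have hle : ∀ N, P N → N ≤ m := by
    rintro N ⟨f, h1, h2⟩
    have h5 : 0 ≤ L ((m : ℝ) • 1 - ∑ i, f i * f i) := by
      refine hL.nonneg _ fun x => ?_
      have := hL.sq_nonneg (κ x - ∑ i, f i x • f i)
      rw [hbessel f h1 h2] at this
      simpa using this
    rw [hmean f h1] at h5
    exact_mod_cast sub_nonneg.1 h5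
  obtain ⟨N, hN, hN'⟩ : ∃ N, P N ∧ ¬ P (N + 1) := by
    by_contra! h
    have : ∀ N, P N := fun N => by
      induction N with
      | zero => exact ⟨Fin.elim0, fun i => i.elim0, fun i => i.elim0⟩
      | succ N ih => exact h N ih
    have := hle (m + 1) (this _)
    omega
  obtain ⟨f, h1, h2⟩ := hN
  have hfull : ∀ x, κ x = ∑ i, f i x • f i := by
    intro x
    by_contra hne
    set g := κ x - ∑ i, f i x • f i with hg
    have hg0 : L (g * g) ≠ 0 := fun h0 => hne (sub_eq_zero.1 (hL.eq_zero_of_sq h0))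
    have hgpos : 0 < L (g * g) := lt_of_le_of_ne (hL.sq_nonneg g) (Ne.symm hg0)
    have hgf : ∀ j, L (g * f j) = 0 := hinner f h1 h2 x
    have hrep : ∀ y, L (κ y * g) = g y := by
      intro y
      rw [hg, mul_sub, map_sub, hκ, Finset.mul_sum, map_sum]
      have hs : κ y x = κ x y := by rw [← hκ y x, ← hκ x y, mul_comm]
      simp [mul_smul_comm, h2, hs]
    refine hN' ⟨Fin.snoc f ((Real.sqrt (L (g * g)))⁻¹ • g), ?_, ?_⟩
    · intro i j
      refine Fin.lastCases ?_ (fun i => ?_) i <;> refine Fin.lastCases ?_ (fun j => ?_) j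
      · simp only [Fin.snoc_last, smul_mul_smul_comm, map_smul, smul_eq_mul, if_true]
        rw [← mul_inv, Real.mul_self_sqrt hgpos.le, inv_mul_cancel₀ hg0]
      · simp [smul_mul_assoc, hgf, (Fin.castSucc_lt_last j).ne']
      · rw [mul_comm]
        simp [smul_mul_assoc, hgf, (Fin.castSucc_lt_last i).ne]
      · simp [h1]
    · intro i y
      refine Fin.lastCases ?_ (fun i => ?_) i
      · simp [mul_smul_comm, hrep]
      · simp [h2]
  have hNm : N = m := by
    have h6 : (m : ℝ) • (1 : M →ᵇ ℝ) - ∑ i, f i * f i = 0 := by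
      ext x
      have h7 : κ x x = ∑ i, f i x * f i x := by
        conv_lhs => rw [hfull x]
        simp
      rw [hd] at h7
      simp [h7]
    have h8 := hmean f h1
    rw [h6, map_zero] at h8
    have : (N : ℝ) = m := by linarith
    exact_mod_cast this
  subst hNm
  exact ⟨f, hfull, h1, h2⟩

end Reproducing

/-! ### A cubature formula of degree six on the three-sphere -/

/-- The vertices of a 24-cell and of its dual, up to sign and normalization. -/
def cubPoint : Fin 24 → Fin 4 → ℝ := ![![1, 0, 0, 0], ![0, 1, 0, 0], ![0, 0, 1, 0], ![0, 0, 0, 1],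
  ![1, 1, 0, 0], ![1, -1, 0, 0], ![1, 0, 1, 0], ![1, 0, -1, 0],
  ![1, 0, 0, 1], ![1, 0, 0, -1], ![0, 1, 1, 0], ![0, 1, -1, 0],
  ![0, 1, 0, 1], ![0, 1, 0, -1], ![0, 0, 1, 1], ![0, 0, 1, -1],
  ![1, 1, 1, 1], ![1, 1, 1, -1], ![1, 1, -1, 1], ![1, 1, -1, -1],
  ![1, -1, 1, 1], ![1, -1, 1, -1], ![1, -1, -1, 1], ![1, -1, -1, -1]]

/-- The weights of a cubature formula for homogeneous polynomials of degree six: the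
normalized points `cubPoint i / ‖cubPoint i‖` have equal weights. -/
def cubWeight : Fin 24 → ℝ := ![1 / 24, 1 / 24, 1 / 24, 1 / 24, 1 / 192, 1 / 192, 1 / 192, 1 / 192,
  1 / 192, 1 / 192, 1 / 192, 1 / 192, 1 / 192, 1 / 192, 1 / 192, 1 / 192,
  1 / 1536, 1 / 1536, 1 / 1536, 1 / 1536, 1 / 1536, 1 / 1536, 1 / 1536, 1 / 1536]

lemma cubWeight_pos (i : Fin 24) : 0 < cubWeight i := by
  fin_cases i <;> simp [cubWeight]

/-- The cubature formula gives the sixth moments of the uniform measure of the three-sphere. -/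
lemma cub_sixth (u : Fin 4 → ℝ) :
    ∑ i, cubWeight i * (∑ j, u j * cubPoint i j) ^ 6 = 5 / 64 * (∑ j, u j ^ 2) ^ 3 := by
  simp [Fin.sum_univ_succ, cubWeight, cubPoint]
  ring

lemma cub_fourth (u : Fin 4 → ℝ) :
    ∑ i, cubWeight i * ((∑ j, cubPoint i j ^ 2) * (∑ j, u j * cubPoint i j) ^ 4) =
      1 / 8 * (∑ j, u j ^ 2) ^ 2 := by
  simp [Fin.sum_univ_succ, cubWeight, cubPoint]
  ring

lemma cub_one : ∑ i, cubWeight i * (∑ j, cubPoint i j ^ 2) ^ 3 = 1 := by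
  simp [Fin.sum_univ_succ, cubWeight, cubPoint]
  norm_num

/-! ### Moments of the kernels -/

/-- The kernel of the eigenvalue `2j`, `j ≤ 6`, as a polynomial in `a = cos r cos θ` and
`b = cos² r`. -/
def levelPoly {A : Type*} [CommRing A] (j : Fin 7) (a b : A) : A :=
  ![1, 4 * a, 6 * (2 * a ^ 2 - b), 8 * (4 * a ^ 3 - 3 * a * b),
    10 * (8 * a ^ 4 - 8 * a ^ 2 * b + b ^ 2) + 3 * (2 * b - 1),
    12 * (16 * a ^ 5 - 20 * a ^ 3 * b + 5 * a * b ^ 2),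
    14 * (32 * a ^ 6 - 48 * a ^ 4 * b + 18 * a ^ 2 * b ^ 2 - b ^ 3)] j

/-- The part of the spectral decomposition that determines the embedding in the sphere: two kernels
`a`, `b` (for `cos r cos θ` and `cos² r`) whose polynomials `levelPoly j a b` are
mutually orthogonal projections for the mean `L`. -/
structure IsSpectralPair {M : Type*} [TopologicalSpace M] (L : (M →ᵇ ℝ) →ₗ[ℝ] ℝ)
    (a b : M → M →ᵇ ℝ) : Prop where
  mean : IsMean L
  symm_left : ∀ x y, a x y = a y x
  symm_right : ∀ x y, b x y = b y x
  self_left : ∀ x, a x x = 1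
  self_right : ∀ x, b x x = 1
  orth : ∀ (j l : Fin 7) (x y : M), L (levelPoly j (a x) (b x) * levelPoly l (a y) (b y)) =
    if j = l then levelPoly j (a x y) (b x y) else 0

section Moments

variable {M : Type*} [TopologicalSpace M] {L : (M →ᵇ ℝ) →ₗ[ℝ] ℝ} {a b : M → M →ᵇ ℝ}

namespace IsSpectralPair

lemma orth_ne (h : IsSpectralPair L a b) {j l : Fin 7} (hjl : j ≠ l) (x y : M) :
    L (levelPoly j (a x) (b x) * levelPoly l (a y) (b y)) = 0 := by
  rw [h.orth, if_neg hjl]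

lemma orth_same (h : IsSpectralPair L a b) (j : Fin 7) (x y : M) :
    L (levelPoly j (a x) (b x) * levelPoly j (a y) (b y)) = levelPoly j (a x y) (b x y) := by
  rw [h.orth, if_pos rfl]

lemma orth_self (h : IsSpectralPair L a b) (j : Fin 7) (x : M) :
    L (levelPoly j (a x) (b x) * levelPoly j (a x) (b x)) = levelPoly j (1 : ℝ) 1 := by
  rw [h.orth, if_pos rfl, h.self_left, h.self_right]

lemma comp_one_one (h : IsSpectralPair L a b) (x y : M) : L (a x * a y) = 1 / 4 * a x y := by
  have h1 := h.orth_same 1 x y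
  have e : a x * a y =
      (1 / 16 : ℝ) • (levelPoly 1 (a x) (b x) * levelPoly 1 (a y) (b y)) := by
    ext z
    simp [levelPoly]
    ring
  rw [e, map_smul, h1]
  simp [levelPoly]
  ring

/-- The power `a⁶` is a combination of products of two of the kernels `levelPoly j a b`, and the
means of these products are known from orthogonality. -/
lemma moment_six (h : IsSpectralPair L a b) (x : M) : L (a x ^ 6) = 5 / 64 := by
  let E : Fin 7 → M →ᵇ ℝ := fun j => levelPoly j (a x) (b x)
  have e : a x ^ 6 = (27 / 160 : ℝ) • (E 0 * E 0) + (33 / 320 : ℝ) • (E 0 * E 2)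
      + (9 / 160 : ℝ) • (E 0 * E 4) + (-15 / 224 : ℝ) • (E 0 * E 6)
      + (-27 / 640 : ℝ) • (E 1 * E 1) + (-9 / 256 : ℝ) • (E 1 * E 3)
      + (1 / 128 : ℝ) • (E 1 * E 5) + (1 / 64 : ℝ) • (E 2 * E 4)
      + (5 / 512 : ℝ) • (E 3 * E 3) := by
    ext z
    simp [E, levelPoly]
    ring
  rw [e]
  simp only [map_add, map_smul, E, h.orth_self, h.orth_ne (show (0 : Fin 7) ≠ 2 by decide),
    h.orth_ne (show (0 : Fin 7) ≠ 4 by decide), h.orth_ne (show (0 : Fin 7) ≠ 6 by decide),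
    h.orth_ne (show (1 : Fin 7) ≠ 3 by decide), h.orth_ne (show (1 : Fin 7) ≠ 5 by decide),
    h.orth_ne (show (2 : Fin 7) ≠ 4 by decide)]
  simp [levelPoly]
  norm_num

/-- As for `moment_six`, by expansion in products of the kernels `levelPoly j a b`. -/
lemma moment_sq_mul (h : IsSpectralPair L a b) (x : M) :
    L (a x ^ 2 * (2 * a x ^ 2 - b x)) = 1 / 12 := by
  let E : Fin 7 → M →ᵇ ℝ := fun j => levelPoly j (a x) (b x)
  have e : a x ^ 2 * (2 * a x ^ 2 - b x) = (-3 / 20 : ℝ) • (E 0 * E 0) +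
      (-1 / 20 : ℝ) • (E 0 * E 2) + (-1 / 20 : ℝ) • (E 0 * E 4)
      + (3 / 80 : ℝ) • (E 1 * E 1) + (1 / 32 : ℝ) • (E 1 * E 3) + (1 / 72 : ℝ) • (E 2 * E 2) := by
    ext z
    simp [E, levelPoly]
    ring
  rw [e]
  simp only [map_add, map_smul, E, h.orth_self, h.orth_ne (show (0 : Fin 7) ≠ 2 by decide),
    h.orth_ne (show (0 : Fin 7) ≠ 4 by decide), h.orth_ne (show (1 : Fin 7) ≠ 3 by decide)]
  simp [levelPoly]
  norm_num

end IsSpectralPair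

/-- If `∑ f_i(x) f_i = a x` is a factorization of a kernel of zonal functions with sixth moment
`5/64`, then the mean of a product of six of the `f_i` is given by the cubature formula.
The sum of the squares of the differences of both sides is `5/64 - 2 · 5/64 + 5/64 = 0`. -/
theorem mean_prod_six {f : Fin 4 → M →ᵇ ℝ} (hL : IsMean L) (hf : ∀ x, ∑ i, f i x ^ 2 = 1)
    (h6 : ∀ x, L ((∑ i, f i x • f i) ^ 6) = 5 / 64) (I : Fin 6 → Fin 4) :
    L (∏ k, f (I k)) = ∑ i, cubWeight i * ∏ k, cubPoint i (I k) := by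
  let T : (Fin 6 → Fin 4) → ℝ := fun I =>
    L (∏ k, f (I k)) - ∑ i, cubWeight i * ∏ k, cubPoint i (I k)
  have hpow : ∀ u v : Fin 4 → ℝ,
      (∑ j, u j * v j) ^ 6 = ∑ I : Fin 6 → Fin 4, (∏ k, u (I k)) * ∏ k, v (I k) := by
    intro u v
    simp only [Fintype.sum_pow, Finset.prod_mul_distrib]
  -- contraction of the tensor `T` with the sixth power of a vector
  have hT : ∀ u : Fin 4 → ℝ, ∑ I, T I * ∏ k, u (I k) =
      L ((∑ j, u j • f j) ^ 6) - 5 / 64 * (∑ j, u j ^ 2) ^ 3 := by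
    intro u
    have e : (∑ j, u j • f j) ^ 6 = ∑ I : Fin 6 → Fin 4, (∏ k, u (I k)) • ∏ k, f (I k) := by
      ext z
      have := hpow u (fun j => f j z)
      simpa using this
    rw [e, map_sum, ← cub_sixth]
    simp only [hpow, T, map_smul, smul_eq_mul, sub_mul, Finset.sum_sub_distrib, Finset.sum_mul,
      Finset.mul_sum]
    congr 1
    · exact Finset.sum_congr rfl fun I _ => mul_comm _ _
    · rw [Finset.sum_comm]
      exact Finset.sum_congr rfl fun i _ => Finset.sum_congr rfl fun I _ => by ring
  have hzero : ∑ I, T I ^ 2 = 0 := by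
    have e1 : ∑ I, T I ^ 2 = L (∑ I, T I • ∏ k, f (I k)) -
        ∑ i, cubWeight i * ∑ I, T I * ∏ k, cubPoint i (I k) := by
      rw [map_sum]
      simp only [Finset.mul_sum]
      rw [Finset.sum_comm, ← Finset.sum_sub_distrib]
      refine Finset.sum_congr rfl fun I _ => ?_
      simp only [map_smul, smul_eq_mul]
      have : ∑ i, cubWeight i * (T I * ∏ k, cubPoint i (I k)) =
          T I * ∑ i, cubWeight i * ∏ k, cubPoint i (I k) := by
        rw [Finset.mul_sum]
        exact Finset.sum_congr rfl fun i _ => by ring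
      rw [this, ← mul_sub, sq]
    have e2 : ∑ I, T I • ∏ k, f (I k) = 0 := by
      ext x
      have := hT fun j => f j x
      rw [h6, hf] at this
      simpa using this
    have e3 : ∑ i, cubWeight i * ∑ I, T I * ∏ k, cubPoint i (I k) =
        L (∑ i, cubWeight i • (∑ j, cubPoint i j • f j) ^ 6) - 5 / 64 := by
      simp only [hT, mul_sub, Finset.sum_sub_distrib, map_sum, map_smul, smul_eq_mul]
      congr 1
      calc _ = 5 / 64 * ∑ i, cubWeight i * (∑ j, cubPoint i j ^ 2) ^ 3 := by
            rw [Finset.mul_sum]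
            exact Finset.sum_congr rfl fun i _ => by ring
        _ = 5 / 64 := by rw [cub_one, mul_one]
    have e4 : ∑ i, cubWeight i • (∑ j, cubPoint i j • f j) ^ 6 = (5 / 64 : ℝ) • (1 : M →ᵇ ℝ) := by
      ext x
      have := cub_sixth fun j => f j x
      rw [hf] at this
      simpa [mul_comm] using this
    rw [e1, e2, e3, e4, hL.const, map_zero]
    ring
  have := (Finset.sum_eq_zero_iff_of_nonneg fun I _ => sq_nonneg (T I)).1 hzero I
    (Finset.mem_univ _)
  exact sub_eq_zero.1 (pow_eq_zero_iff (two_ne_zero) |>.1 this)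

/-- The cubature formula for sextic forms in the `f_i`. -/
lemma mean_sextic {f : Fin 4 → M →ᵇ ℝ} (hL : IsMean L) (hf : ∀ x, ∑ i, f i x ^ 2 = 1)
    (h6 : ∀ x, L ((∑ i, f i x • f i) ^ 6) = 5 / 64) {K : Type*} [Fintype K] (d : K → ℝ)
    (I : K → Fin 6 → Fin 4) :
    L (∑ k, d k • ∏ s, f (I k s)) =
      ∑ i, cubWeight i * ∑ k, d k * ∏ s, cubPoint i (I k s) := by
  simp only [map_sum, map_smul, mean_prod_six hL hf h6, smul_eq_mul, Finset.mul_sum]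
  rw [Finset.sum_comm]
  exact Finset.sum_congr rfl fun i _ => Finset.sum_congr rfl fun k _ => by ring

/-- The fourth moments of the `f_i` are those of the uniform measure of the three-sphere. -/
theorem mean_fourth {f : Fin 4 → M →ᵇ ℝ} (hL : IsMean L) (hf : ∀ x, ∑ i, f i x ^ 2 = 1)
    (h6 : ∀ x, L ((∑ i, f i x • f i) ^ 6) = 5 / 64) (u : Fin 4 → ℝ) :
    L ((∑ j, u j • f j) ^ 4) = 1 / 8 * (∑ j, u j ^ 2) ^ 2 := by
  let I : Fin 4 × (Fin 4 → Fin 4) → Fin 6 → Fin 4 := fun k => Fin.cons k.1 (Fin.cons k.1 k.2)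
  -- on the sphere the quartic form is equal to a sextic one
  have hpow : ∀ v : Fin 4 → ℝ, (∑ m, v m ^ 2) * (∑ j, u j * v j) ^ 4 =
      ∑ k, (∏ s, u (k.2 s)) * ∏ s, v (I k s) := by
    intro v
    rw [Fintype.sum_pow, Finset.sum_mul_sum, Fintype.sum_prod_type]
    refine Finset.sum_congr rfl fun m _ => Finset.sum_congr rfl fun J _ => ?_
    have hI : ∏ s, v (I (m, J) s) = v m * (v m * ∏ s, v (J s)) := by
      rw [Fin.prod_univ_succ, Fin.prod_univ_succ]
      simp [I]
    rw [hI, Finset.prod_mul_distrib]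
    ring
  have e : (∑ j, u j • f j) ^ 4 = ∑ k, (∏ s, u (k.2 s)) • ∏ s, f (I k s) := by
    ext x
    have := hpow fun j => f j x
    rw [hf, one_mul] at this
    simpa using this
  rw [e, mean_sextic hL hf h6, ← cub_fourth]
  exact Finset.sum_congr rfl fun i _ => by rw [hpow]

set_option maxRecDepth 4000 in
/-- A cubic form that vanishes at the points of the cubature formula is zero. -/
lemma cubic_eq_zero_of_cubPoint (c : Fin 4 → Fin 4 → Fin 4 → ℝ)
    (hw : ∀ s, ∑ i, ∑ j, ∑ k, c i j k * (cubPoint s i * cubPoint s j * cubPoint s k) = 0)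
    (u : Fin 4 → ℝ) : ∑ i, ∑ j, ∑ k, c i j k * (u i * u j * u k) = 0 := by
  simp only [Fin.sum_univ_four] at hw ⊢
  have h0 := hw 0
  have h1 := hw 1
  have h2 := hw 2
  have h3 := hw 3
  have h4 := hw 4
  have h5 := hw 5
  have h6 := hw 6
  have h7 := hw 7
  have h8 := hw 8
  have h9 := hw 9
  have h10 := hw 10
  have h11 := hw 11
  have h12 := hw 12
  have h13 := hw 13
  have h14 := hw 14
  have h15 := hw 15
  have h16 := hw 16
  have h17 := hw 17
  have h18 := hw 18
  have h19 := hw 19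
  have h20 := hw 20
  have h21 := hw 21
  have h22 := hw 22
  have h23 := hw 23
  simp only [cubPoint, Matrix.cons_val, mul_one, mul_zero, add_zero, zero_add, mul_neg,
    neg_neg, neg_zero]
    at h0 h1 h2 h3 h4 h5 h6 h7 h8 h9 h10 h11 h12 h13 h14 h15 h16 h17 h18 h19 h20 h21 h22 h23
  -- the coefficients of the monomials
  have m001 : c 0 0 1 + c 0 1 0 + c 1 0 0 = 0 := by
    linear_combination (h4 - h5) / 2 - h1
  have m011 : c 0 1 1 + c 1 0 1 + c 1 1 0 = 0 := by
    linear_combination (h4 + h5) / 2 - h0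
  have m002 : c 0 0 2 + c 0 2 0 + c 2 0 0 = 0 := by
    linear_combination (h6 - h7) / 2 - h2
  have m022 : c 0 2 2 + c 2 0 2 + c 2 2 0 = 0 := by
    linear_combination (h6 + h7) / 2 - h0
  have m003 : c 0 0 3 + c 0 3 0 + c 3 0 0 = 0 := by
    linear_combination (h8 - h9) / 2 - h3
  have m033 : c 0 3 3 + c 3 0 3 + c 3 3 0 = 0 := by
    linear_combination (h8 + h9) / 2 - h0
  have m112 : c 1 1 2 + c 1 2 1 + c 2 1 1 = 0 := by
    linear_combination (h10 - h11) / 2 - h2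
  have m122 : c 1 2 2 + c 2 1 2 + c 2 2 1 = 0 := by
    linear_combination (h10 + h11) / 2 - h1
  have m113 : c 1 1 3 + c 1 3 1 + c 3 1 1 = 0 := by
    linear_combination (h12 - h13) / 2 - h3
  have m133 : c 1 3 3 + c 3 1 3 + c 3 3 1 = 0 := by
    linear_combination (h12 + h13) / 2 - h1
  have m223 : c 2 2 3 + c 2 3 2 + c 3 2 2 = 0 := by
    linear_combination (h14 - h15) / 2 - h3
  have m233 : c 2 3 3 + c 3 2 3 + c 3 3 2 = 0 := by
    linear_combination (h14 + h15) / 2 - h2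
  have m012 : c 0 1 2 + c 0 2 1 + c 1 0 2 + c 1 2 0 + c 2 0 1 + c 2 1 0 = 0 := by
    linear_combination (h16 + h17 - h18 - h19 - h20 - h21 + h22 + h23) / 8
  have m013 : c 0 1 3 + c 0 3 1 + c 1 0 3 + c 1 3 0 + c 3 0 1 + c 3 1 0 = 0 := by
    linear_combination (h16 - h17 + h18 - h19 - h20 + h21 - h22 + h23) / 8
  have m023 : c 0 2 3 + c 0 3 2 + c 2 0 3 + c 2 3 0 + c 3 0 2 + c 3 2 0 = 0 := by
    linear_combination (h16 - h17 - h18 + h19 + h20 - h21 - h22 + h23) / 8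
  have m123 : c 1 2 3 + c 1 3 2 + c 2 1 3 + c 2 3 1 + c 3 1 2 + c 3 2 1 = 0 := by
    linear_combination (h16 - h17 - h18 + h19 - h20 + h21 + h22 - h23) / 8
  linear_combination u 0 ^ 3 * h0 + u 1 ^ 3 * h1 + u 2 ^ 3 * h2 + u 3 ^ 3 * h3 +
    u 0 ^ 2 * u 1 * m001 + u 0 * u 1 ^ 2 * m011 + u 0 ^ 2 * u 2 * m002 + u 0 * u 2 ^ 2 * m022 +
    u 0 ^ 2 * u 3 * m003 + u 0 * u 3 ^ 2 * m033 + u 1 ^ 2 * u 2 * m112 + u 1 * u 2 ^ 2 * m122 +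
    u 1 ^ 2 * u 3 * m113 + u 1 * u 3 ^ 2 * m133 + u 2 ^ 2 * u 3 * m223 + u 2 * u 3 ^ 2 * m233 +
    u 0 * u 1 * u 2 * m012 + u 0 * u 1 * u 3 * m013 + u 0 * u 2 * u 3 * m023 +
    u 1 * u 2 * u 3 * m123

lemma sum_pow_two {ι : Type*} [Fintype ι] (F : ι → ℝ) :
    (∑ t, F t) ^ 2 = ∑ t : ι × ι, F t.1 * F t.2 := by
  rw [sq, Finset.sum_mul_sum, Fintype.sum_prod_type]

/-- A cubic form that vanishes on the image of `f` is zero. -/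
theorem cubic_eq_zero {f : Fin 4 → M →ᵇ ℝ} (hL : IsMean L) (hf : ∀ x, ∑ i, f i x ^ 2 = 1)
    (h6 : ∀ x, L ((∑ i, f i x • f i) ^ 6) = 5 / 64) (c : Fin 4 → Fin 4 → Fin 4 → ℝ)
    (hc : ∀ x, ∑ i, ∑ j, ∑ k, c i j k * (f i x * f j x * f k x) = 0) (u : Fin 4 → ℝ) :
    ∑ i, ∑ j, ∑ k, c i j k * (u i * u j * u k) = 0 := by
  refine cubic_eq_zero_of_cubPoint c (fun s => ?_) u
  let I : (Fin 4 × Fin 4 × Fin 4) × (Fin 4 × Fin 4 × Fin 4) → Fin 6 → Fin 4 := fun t =>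
    ![t.1.1, t.1.2.1, t.1.2.2, t.2.1, t.2.2.1, t.2.2.2]
  let d : (Fin 4 × Fin 4 × Fin 4) × (Fin 4 × Fin 4 × Fin 4) → ℝ := fun t =>
    c t.1.1 t.1.2.1 t.1.2.2 * c t.2.1 t.2.2.1 t.2.2.2
  have hsq : ∀ v : Fin 4 → ℝ, (∑ i, ∑ j, ∑ k, c i j k * (v i * v j * v k)) ^ 2 =
      ∑ t, d t * ∏ s, v (I t s) := by
    intro v
    have e : ∑ i, ∑ j, ∑ k, c i j k * (v i * v j * v k) =
        ∑ t : Fin 4 × Fin 4 × Fin 4, c t.1 t.2.1 t.2.2 * (v t.1 * v t.2.1 * v t.2.2) := by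
      simp only [Fintype.sum_prod_type]
    rw [e, sum_pow_two]
    refine Finset.sum_congr rfl fun t _ => ?_
    rw [Fin.prod_univ_six]
    simp only [d, I, Matrix.cons_val]
    ring
  have e0 : ∑ t, d t • ∏ s, f (I t s) = 0 := by
    ext x
    have := hsq fun i => f i x
    rw [hc x] at this
    simpa using this.symm
  have h := mean_sextic hL hf h6 d I
  rw [e0, map_zero] at h
  simp only [← hsq] at h
  have h2 := (Finset.sum_eq_zero_iff_of_nonneg fun i _ =>
    mul_nonneg (cubWeight_pos i).le (sq_nonneg _)).1 h.symm s (Finset.mem_univ _)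
  exact pow_eq_zero_iff (two_ne_zero) |>.1 ((mul_eq_zero.1 h2).resolve_left (cubWeight_pos s).ne')

end Moments

/-! ### The kernel `cos 2r` as a sum of three products of quadratic forms -/

section QuadraticForms

variable {M : Type*} [TopologicalSpace M] {L : (M →ᵇ ℝ) →ₗ[ℝ] ℝ} {a b : M → M →ᵇ ℝ}

/-- The linear form with coefficients `u` in the functions `f_i`. -/
def linComb (f : Fin 4 → M →ᵇ ℝ) (u : Fin 4 → ℝ) : M →ᵇ ℝ := ∑ i, u i • f i

/-- The quadratic form with coefficients `S` in the functions `f_i`. -/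
def quadComb (f : Fin 4 → M →ᵇ ℝ) (S : Fin 4 → Fin 4 → ℝ) : M →ᵇ ℝ :=
  ∑ i, ∑ j, S i j • (f i * f j)

lemma linComb_apply (f : Fin 4 → M →ᵇ ℝ) (u : Fin 4 → ℝ) (x : M) :
    linComb f u x = ∑ i, u i * f i x := by
  simp [linComb]

lemma quadComb_apply (f : Fin 4 → M →ᵇ ℝ) (S : Fin 4 → Fin 4 → ℝ) (x : M) :
    quadComb f S x = ∑ i, ∑ j, S i j * (f i x * f j x) := by
  simp [quadComb]

lemma linComb_single (f : Fin 4 → M →ᵇ ℝ) (i : Fin 4) : linComb f (Pi.single i 1) = f i := by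
  ext x
  simp [linComb_apply, Pi.single_apply]

lemma mean_quadComb_mul (f : Fin 4 → M →ᵇ ℝ) (S : Fin 4 → Fin 4 → ℝ) (g : M →ᵇ ℝ) :
    L (quadComb f S * g) = ∑ i, ∑ j, S i j * L (f i * f j * g) := by
  simp only [quadComb, Finset.sum_mul, smul_mul_assoc, map_sum, map_smul, smul_eq_mul]

/-- The mean of the product of four linear forms, by polarization. -/
lemma mean_linComb {f : Fin 4 → M →ᵇ ℝ}
    (h4 : ∀ u : Fin 4 → ℝ, L (linComb f u ^ 4) = 1 / 8 * (u ⬝ᵥ u) ^ 2) (u u' v v' : Fin 4 → ℝ) :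
    L (linComb f u * linComb f u' * (linComb f v * linComb f v')) =
      ((u ⬝ᵥ u') * (v ⬝ᵥ v') + (u ⬝ᵥ v) * (u' ⬝ᵥ v') + (u ⬝ᵥ v') * (u' ⬝ᵥ v)) / 24 := by
  have hadd : ∀ u v : Fin 4 → ℝ, linComb f (u + v) = linComb f u + linComb f v := fun u v => by
    ext x; simp [linComb_apply, add_mul, Finset.sum_add_distrib]
  have hsub : ∀ u v : Fin 4 → ℝ, linComb f (u - v) = linComb f u - linComb f v := fun u v => by
    ext x; simp [linComb_apply, sub_mul, Finset.sum_sub_distrib]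
  have h22 : ∀ u v : Fin 4 → ℝ, L (linComb f u ^ 2 * linComb f v ^ 2) =
      ((u ⬝ᵥ u) * (v ⬝ᵥ v) + 2 * (u ⬝ᵥ v) ^ 2) / 24 := by
    intro u v
    have e : linComb f u ^ 2 * linComb f v ^ 2 = (1 / 12 : ℝ) • (linComb f (u + v) ^ 4 +
        linComb f (u - v) ^ 4 - (2 : ℝ) • linComb f u ^ 4 - (2 : ℝ) • linComb f v ^ 4) := by
      rw [hadd, hsub]
      ext x
      simp
      ring
    rw [e]
    simp only [map_smul, map_sub, map_add, h4, smul_eq_mul, add_dotProduct, dotProduct_add,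
      sub_dotProduct, dotProduct_sub, dotProduct_comm v u]
    ring
  have h112 : ∀ u u' v : Fin 4 → ℝ, L (linComb f u * linComb f u' * linComb f v ^ 2) =
      ((u ⬝ᵥ u') * (v ⬝ᵥ v) + 2 * (u ⬝ᵥ v) * (u' ⬝ᵥ v)) / 24 := by
    intro u u' v
    have e : linComb f u * linComb f u' * linComb f v ^ 2 = (1 / 4 : ℝ) •
        (linComb f (u + u') ^ 2 * linComb f v ^ 2 - linComb f (u - u') ^ 2 * linComb f v ^ 2) := by
      rw [hadd, hsub]
      ext x
      simp
      ring
    rw [e]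
    simp only [map_smul, map_sub, h22, smul_eq_mul, add_dotProduct, dotProduct_add,
      sub_dotProduct, dotProduct_sub, dotProduct_comm u' u]
    ring
  have e : linComb f u * linComb f u' * (linComb f v * linComb f v') = (1 / 4 : ℝ) •
      (linComb f u * linComb f u' * linComb f (v + v') ^ 2
        - linComb f u * linComb f u' * linComb f (v - v') ^ 2) := by
    rw [hadd, hsub]
    ext x
    simp
    ring
  rw [e]
  simp only [map_smul, map_sub, h112, smul_eq_mul, add_dotProduct, dotProduct_add,
    sub_dotProduct, dotProduct_sub, dotProduct_comm v' v]
  ring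

lemma mean_quadComb_mul_quadComb {f : Fin 4 → M →ᵇ ℝ}
    (h4 : ∀ u : Fin 4 → ℝ, L (linComb f u ^ 4) = 1 / 8 * (u ⬝ᵥ u) ^ 2)
    {S T : Fin 4 → Fin 4 → ℝ} (hT : ∀ i j, T i j = T j i) :
    L (quadComb f S * quadComb f T) =
      ((∑ i, S i i) * (∑ i, T i i) + 2 * ∑ i, ∑ j, S i j * T i j) / 24 := by
  have h : ∀ i j, L (f i * f j * quadComb f T) =
      ((if i = j then ∑ k, T k k else 0) + 2 * T i j) / 24 := by
    intro i j
    rw [mul_comm, mean_quadComb_mul]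
    have e : ∀ k l, L (f k * f l * (f i * f j)) =
        ((if k = l then 1 else 0) * (if i = j then 1 else 0) +
        (if k = i then 1 else 0) * (if l = j then 1 else 0) +
        (if k = j then 1 else 0) * (if l = i then 1 else 0)) / 24 := by
      intro k l
      have := mean_linComb h4 (Pi.single k 1) (Pi.single l 1) (Pi.single i 1) (Pi.single j 1)
      simp only [linComb_single, single_dotProduct, one_mul, Pi.single_apply] at this
      simpa using this
    simp only [e, mul_add, add_div, Finset.sum_add_distrib, mul_div_assoc']
    simp only [← Finset.sum_div]
    by_cases hij : i = j
    · subst hij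
      simp
      ring
    · simp [hij, hT j i]
      ring
  rw [mean_quadComb_mul]
  have h' : ∀ i, ∑ j, S i j * L (f i * f j * quadComb f T) =
      (S i i * ∑ k, T k k + 2 * ∑ j, S i j * T i j) / 24 := by
    intro i
    have e : ∀ j, S i j * L (f i * f j * quadComb f T) =
        (if i = j then S i j * (∑ k, T k k) / 24 else 0) + S i j * T i j * (2 / 24) := by
      intro j
      rw [h]
      split_ifs <;> ring
    simp only [e, Finset.sum_add_distrib, ← Finset.sum_mul, Finset.sum_ite_eq, Finset.mem_univ,
      if_true]
    ring
  simp only [h', ← Finset.sum_div, Finset.sum_add_distrib, ← Finset.sum_mul, ← Finset.mul_sum]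

/-- Orthonormal functions are linearly independent. -/
lemma coeff_eq_zero_of_orthonormal {m : ℕ} {h : Fin m → M →ᵇ ℝ}
    (ho : ∀ i j, L (h i * h j) = if i = j then 1 else 0) {c : Fin m → ℝ}
    (hc : ∀ x, ∑ i, h i x * c i = 0) (j : Fin m) : c j = 0 := by
  have e : ∑ i, c i • (h i * h j) = 0 := by
    ext x
    have := hc x
    simp only [BoundedContinuousFunction.coe_sum, Finset.sum_apply,
      BoundedContinuousFunction.coe_smul, BoundedContinuousFunction.coe_mul, Pi.mul_apply,
      smul_eq_mul, BoundedContinuousFunction.coe_zero, Pi.zero_apply]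
    calc ∑ i, c i * (h i x * h j x) = (∑ i, h i x * c i) * h j x := by
          rw [Finset.sum_mul]; exact Finset.sum_congr rfl fun i _ => by ring
      _ = 0 := by rw [this, zero_mul]
  have := congrArg L e
  simpa [ho] using this

namespace IsSpectralPair

lemma comp_self (h : IsSpectralPair L a b) (x : M) : L (a x ^ 2) = 1 / 4 := by
  rw [sq, h.comp_one_one, h.self_left, mul_one]

/-- The projection with kernel `4a` has rank `4`, its value on the diagonal.  The factor `1/2` in
the normalization of the `f_i` makes `∑ f_i(x) f_i(y) = a(x, y)`. -/
lemma exists_factor_left (h : IsSpectralPair L a b) :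
    ∃ f : Fin 4 → M →ᵇ ℝ, (∀ x, a x = linComb f fun i => f i x) ∧
      ∀ i j, L (f i * f j) = if i = j then 1 / 4 else 0 := by
  obtain ⟨f, h1, h2, -⟩ := exists_orthonormal_of_reproducing h.mean (fun x => (4 : ℝ) • a x) 4
    (fun x y => by
      simp only [smul_mul_smul_comm, map_smul, h.comp_one_one, smul_eq_mul,
        BoundedContinuousFunction.coe_smul]
      ring)
    (fun x => by simp [h.self_left])
  refine ⟨fun i => (1 / 2 : ℝ) • f i, fun x => ?_, fun i j => ?_⟩
  · have : a x = (1 / 4 : ℝ) • ((4 : ℝ) • a x) := by rw [smul_smul]; norm_num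
    rw [this, h1, linComb, Finset.smul_sum]
    refine Finset.sum_congr rfl fun i _ => ?_
    ext y
    simp
    ring
  · simp only [smul_mul_smul_comm, map_smul, h2, smul_eq_mul]
    split_ifs <;> norm_num

section Factor

variable {f : Fin 4 → M →ᵇ ℝ}

lemma sum_sq (h : IsSpectralPair L a b) (hf : ∀ x, a x = linComb f fun i => f i x) (x : M) :
    ∑ i, f i x ^ 2 = 1 := by
  have := h.self_left x
  rw [hf, linComb_apply] at this
  simpa only [sq] using this

lemma mean_sixth (h : IsSpectralPair L a b) (hf : ∀ x, a x = linComb f fun i => f i x) (x : M) :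
    L ((∑ i, f i x • f i) ^ 6) = 5 / 64 := by
  have := h.moment_six x
  rwa [hf, linComb] at this

lemma mean_linComb_pow (h : IsSpectralPair L a b) (hf : ∀ x, a x = linComb f fun i => f i x)
    (u : Fin 4 → ℝ) : L (linComb f u ^ 4) = 1 / 8 * (u ⬝ᵥ u) ^ 2 := by
  have := mean_fourth h.mean (h.sum_sq hf) (h.mean_sixth hf) u
  simpa only [linComb, dotProduct, sq] using this

lemma sq_eq_quadComb (hf : ∀ x, a x = linComb f fun i => f i x) (x : M) :
    a x ^ 2 = quadComb f fun i j => f i x * f j x := by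
  ext y
  rw [hf, BoundedContinuousFunction.coe_pow, Pi.pow_apply, linComb_apply, quadComb_apply, sq,
    Finset.sum_mul_sum]
  exact Finset.sum_congr rfl fun i _ => Finset.sum_congr rfl fun j _ => by ring

lemma mean_sq_mul (hf : ∀ x, a x = linComb f fun i => f i x) (g : M →ᵇ ℝ) (x : M) :
    L (a x ^ 2 * g) = quadComb f (fun i j => L (f i * f j * g)) x := by
  rw [sq_eq_quadComb hf, mean_quadComb_mul, quadComb_apply]
  exact Finset.sum_congr rfl fun i _ => Finset.sum_congr rfl fun j _ => by ring

lemma trace_moment (h : IsSpectralPair L a b) (hf : ∀ x, a x = linComb f fun i => f i x)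
    (g : M →ᵇ ℝ) : ∑ i, L (f i * f i * g) = L g := by
  rw [← map_sum]
  congr 1
  ext x
  have := h.sum_sq hf x
  simp only [BoundedContinuousFunction.coe_sum, Finset.sum_apply,
    BoundedContinuousFunction.coe_mul, Pi.mul_apply]
  rw [← Finset.sum_mul]
  simp only [sq] at this
  rw [this, one_mul]

lemma mean_sq_mul_sq (h : IsSpectralPair L a b) (hf : ∀ x, a x = linComb f fun i => f i x)
    (x y : M) : L (a x ^ 2 * a y ^ 2) = (1 + 2 * a x y ^ 2) / 24 := by
  have e : a x y = (fun i => f i x) ⬝ᵥ fun i => f i y := by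
    rw [hf, linComb_apply]; rfl
  have e1 : ∀ x, (fun i => f i x) ⬝ᵥ (fun i => f i x) = 1 := fun x => by
    rw [← h.sum_sq hf x]; simp only [dotProduct, sq]
  have := mean_linComb (h.mean_linComb_pow hf) (fun i => f i x) (fun i => f i x)
    (fun i => f i y) (fun i => f i y)
  rw [e1, e1, ← e, ← hf, ← hf] at this
  rw [sq, sq, this]
  ring

/-- The functions `2a² - b` are quadratic forms in the functions `f_i`: the rank of the projection
`6(2a² - b)` is `6`, which is the trace of its product with the projection on the
traceless quadratic forms. -/
lemma mean_sq_mul_levelPoly_two (h : IsSpectralPair L a b)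
    (hf : ∀ x, a x = linComb f fun i => f i x) (x y : M) :
    12 * L (a x ^ 2 * levelPoly 2 (a y) (b y)) = levelPoly 2 (a y) (b y) x := by
  obtain ⟨g, hg, ho, -⟩ := exists_orthonormal_of_reproducing h.mean
    (fun x => levelPoly 2 (a x) (b x)) 6
    (fun x y => by rw [h.orth_same]; simp [levelPoly])
    (fun x => by
      simp [levelPoly, h.self_left, h.self_right]
      norm_num)
  let T : Fin 6 → Fin 4 → Fin 4 → ℝ := fun α i j => L (f i * f j * g α)
  have hTs : ∀ α i j, T α i j = T α j i := fun α i j => by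
    simp only [T, mul_comm (f i) (f j)]
  have hg0 : ∀ α, L (g α) = 0 := by
    refine fun α => coeff_eq_zero_of_orthonormal ho (c := fun α => L (g α)) (fun x => ?_) α
    have := h.orth_ne (show (2 : Fin 7) ≠ 0 by decide) x x
    rw [show levelPoly 0 (a x) (b x) = 1 from rfl, mul_one, hg] at this
    simpa using this
  have hTt : ∀ α, ∑ i, T α i i = 0 := fun α => by rw [h.trace_moment hf, hg0]
  have hnorm : ∀ α, L ((g α - (12 : ℝ) • quadComb f (T α)) * (g α - (12 : ℝ) • quadComb f (T α)))
      = 1 - 12 * ∑ i, ∑ j, T α i j ^ 2 := by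
    intro α
    have e : (g α - (12 : ℝ) • quadComb f (T α)) * (g α - (12 : ℝ) • quadComb f (T α)) =
        g α * g α - (24 : ℝ) • (quadComb f (T α) * g α)
          + (144 : ℝ) • (quadComb f (T α) * quadComb f (T α)) := by
      ext x
      simp
      ring
    rw [e]
    simp only [map_add, map_sub, map_smul, ho, mean_quadComb_mul,
      mean_quadComb_mul_quadComb (h.mean_linComb_pow hf) (hTs α), hTt, smul_eq_mul, if_true]
    have e2 : ∀ i j, T α i j * L (f i * f j * g α) = T α i j ^ 2 := fun i j => by rw [sq]
    simp only [← mean_quadComb_mul, ← sq]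
    rw [mean_quadComb_mul]
    simp only [e2]
    ring
  have htotal : ∑ α, ∑ i, ∑ j, T α i j ^ 2 = 1 / 2 := by
    have e1 : ∀ x, ∑ α, g α x * quadComb f (T α) x = 1 / 2 := by
      intro x
      have h1 := h.moment_sq_mul x
      have h2 : a x ^ 2 * (2 * a x ^ 2 - b x) =
          (1 / 6 : ℝ) • (a x ^ 2 * levelPoly 2 (a x) (b x)) := by
        ext y
        simp [levelPoly]
        ring
      rw [h2, hg] at h1
      simp only [Finset.mul_sum, mul_smul_comm, map_smul, map_sum, mean_sq_mul hf,
        smul_eq_mul] at h1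
      simp only [T]
      rw [← Finset.mul_sum] at h1
      linarith
    have e2 : ∑ α, quadComb f (T α) * g α = (1 / 2 : ℝ) • 1 := by
      ext x
      have := e1 x
      simp only [mul_comm (g _ x)] at this
      simpa using this
    have e3 := congrArg L e2
    rw [h.mean.const, map_sum] at e3
    simp only [mean_quadComb_mul] at e3
    rw [← e3]
    simp only [T, sq]
  have hquad : ∀ α, g α = (12 : ℝ) • quadComb f (T α) := by
    intro α
    have hs : ∑ α, L ((g α - (12 : ℝ) • quadComb f (T α)) * (g α - (12 : ℝ) • quadComb f (T α)))
        = 0 := by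
      simp only [hnorm, Finset.sum_sub_distrib, ← Finset.mul_sum, htotal]
      norm_num
    exact sub_eq_zero.1 (h.mean.eq_zero_of_sq
      ((Finset.sum_eq_zero_iff_of_nonneg fun α _ => h.mean.sq_nonneg _).1 hs α (Finset.mem_univ _)))
  have hgx : ∀ α, 12 * L (a x ^ 2 * g α) = g α x := by
    intro α
    rw [mean_sq_mul hf]
    conv_rhs => rw [hquad α]
    simp [T]
  rw [hg y]
  simp only [Finset.mul_sum, mul_smul_comm, map_sum, map_smul, smul_eq_mul,
    BoundedContinuousFunction.coe_sum, Finset.sum_apply, BoundedContinuousFunction.coe_smul]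
  refine Finset.sum_congr rfl fun α _ => ?_
  rw [← hgx α]
  ring

end Factor

end IsSpectralPair

end QuadraticForms

section BaseKernel

variable {M : Type*} [TopologicalSpace M] {L : (M →ᵇ ℝ) →ₗ[ℝ] ℝ} {a b : M → M →ᵇ ℝ}

namespace IsSpectralPair

variable {f : Fin 4 → M →ᵇ ℝ}

/-- The kernel `3 cos 2r = 3(2b - 1)`. -/
def baseKernel (b : M → M →ᵇ ℝ) (x : M) : M →ᵇ ℝ := (3 : ℝ) • ((2 : ℝ) • b x - 1)

lemma baseKernel_eq (x : M) :
    baseKernel b x = (12 : ℝ) • a x ^ 2 - (3 : ℝ) • 1 - levelPoly 2 (a x) (b x) := by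
  ext y
  simp [baseKernel, levelPoly]
  ring

lemma mean_levelPoly (h : IsSpectralPair L a b) {j : Fin 7} (hj : j ≠ 0) (x : M) :
    L (levelPoly j (a x) (b x)) = 0 := by
  have := h.orth_ne hj x x
  rwa [show levelPoly 0 (a x) (b x) = 1 from rfl, mul_one] at this

lemma mean_baseKernel (h : IsSpectralPair L a b) (x : M) : L (baseKernel b x) = 0 := by
  rw [baseKernel_eq (a := a), map_sub, map_sub, h.mean.const, map_smul, h.comp_self,
    h.mean_levelPoly (by decide)]
  norm_num

/-- The kernel of the eigenvalue `4` is orthogonal to `3 cos 2r`: the former is the part of the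
traceless quadratic forms that is complementary to the latter. -/
lemma levelPoly_two_comp_baseKernel (h : IsSpectralPair L a b)
    (hf : ∀ x, a x = linComb f fun i => f i x) (x y : M) :
    L (levelPoly 2 (a x) (b x) * baseKernel b y) = 0 := by
  have e : levelPoly 2 (a x) (b x) * baseKernel b y =
      (12 : ℝ) • (a y ^ 2 * levelPoly 2 (a x) (b x)) - (3 : ℝ) • levelPoly 2 (a x) (b x)
        - levelPoly 2 (a x) (b x) * levelPoly 2 (a y) (b y) := by
    rw [baseKernel_eq (a := a)]
    ext z
    simp
    ring
  rw [e, map_sub, map_sub, map_smul, map_smul, h.mean_levelPoly (by decide), h.orth_same,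
    smul_eq_mul, h.mean_sq_mul_levelPoly_two hf]
  simp [levelPoly]

/-- The kernel `3 cos 2r` is a projection.  It is the difference of `12a² - 3`, the projection on
the traceless quadratic forms, and of the projection `levelPoly 2 a b`. -/
lemma baseKernel_comp_self (h : IsSpectralPair L a b)
    (hf : ∀ x, a x = linComb f fun i => f i x) (x y : M) :
    L (baseKernel b x * baseKernel b y) = baseKernel b x y := by
  have e : baseKernel b x * baseKernel b y = (144 : ℝ) • (a x ^ 2 * a y ^ 2)
      - (36 : ℝ) • a x ^ 2 - (3 : ℝ) • baseKernel b y
      - (12 : ℝ) • (a x ^ 2 * levelPoly 2 (a y) (b y))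
      - levelPoly 2 (a x) (b x) * baseKernel b y := by
    conv_lhs => rw [baseKernel_eq (a := a) x]
    rw [baseKernel_eq (a := a) y]
    ext z
    simp
    ring
  rw [e]
  simp only [map_sub, map_smul, h.mean_sq_mul_sq hf, h.comp_self, h.mean_baseKernel, smul_eq_mul,
    h.mean_sq_mul_levelPoly_two hf, h.levelPoly_two_comp_baseKernel hf]
  rw [baseKernel_eq (a := a)]
  have hb := h.symm_right x y
  have ha := h.symm_left x y
  simp [levelPoly, hb, ha]
  ring

/-- The kernels of a spectral pair are given by a map to the unit sphere of `ℝ⁴` and by three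
quadratic forms `H_s`.  The cubic identity for the forms expresses the orthogonality of the
projections for the first and the third eigenvalue; it holds on the image of the map, hence
everywhere. -/
theorem exists_quadratic_forms (h : IsSpectralPair L a b) :
    ∃ (f : Fin 4 → M →ᵇ ℝ) (H : Fin 3 → Fin 4 → Fin 4 → ℝ),
      (∀ x y, a x y = ∑ i, f i x * f i y) ∧
      (∀ x y, 3 * (2 * b x y - 1) = ∑ s, quadComb f (H s) x * quadComb f (H s) y) ∧
      (∀ s i j, H s i j = H s j i) ∧ (∀ s, ∑ i, H s i i = 0) ∧
      (∀ s t, ∑ i, ∑ j, H s i j * H t i j = if s = t then 12 else 0) ∧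
      ∀ (u : Fin 4 → ℝ) (i : Fin 4), ∑ s, (∑ j, ∑ k, H s j k * (u j * u k)) * ∑ l, H s i l * u l =
        3 * (∑ j, u j ^ 2) * u i := by
  obtain ⟨f, hf, hff⟩ := h.exists_factor_left
  obtain ⟨g, hg, ho, hrep⟩ := exists_orthonormal_of_reproducing h.mean (baseKernel b) 3
    (h.baseKernel_comp_self hf) (fun x => by simp [baseKernel, h.self_right]; norm_num)
  have hg0 : ∀ s, L (g s) = 0 := by
    refine fun s => coeff_eq_zero_of_orthonormal ho (c := fun s => L (g s)) (fun x => ?_) s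
    have := h.mean_baseKernel x
    rw [hg] at this
    simpa using this
  have hg2 : ∀ x s, L (levelPoly 2 (a x) (b x) * g s) = 0 := by
    refine fun x s => coeff_eq_zero_of_orthonormal ho
      (c := fun s => L (levelPoly 2 (a x) (b x) * g s)) (fun y => ?_) s
    have := h.levelPoly_two_comp_baseKernel hf x y
    rw [hg] at this
    simpa [Finset.mul_sum, mul_smul_comm] using this
  let H : Fin 3 → Fin 4 → Fin 4 → ℝ := fun s i j => 12 * L (f i * f j * g s)
  have hHs : ∀ s i j, H s i j = H s j i := fun s i j => by
    simp only [H, mul_comm (f i) (f j)]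
  have hHt : ∀ s, ∑ i, H s i i = 0 := fun s => by
    simp only [H, ← Finset.mul_sum]
    rw [h.trace_moment hf, hg0, mul_zero]
  have hquad : ∀ s, g s = quadComb f (H s) := by
    intro s
    ext x
    have e : baseKernel b x * g s = (12 : ℝ) • (a x ^ 2 * g s) - (3 : ℝ) • g s
        - levelPoly 2 (a x) (b x) * g s := by
      rw [baseKernel_eq (a := a)]
      ext z
      simp
      ring
    rw [← hrep s x, e]
    simp only [map_sub, map_smul, hg0, hg2, mean_sq_mul hf, quadComb_apply, smul_eq_mul, H,
      Finset.mul_sum]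
    simp [mul_assoc]
  refine ⟨f, H, fun x y => ?_, fun x y => ?_, hHs, hHt, fun s t => ?_, fun u i => ?_⟩
  · rw [hf, linComb_apply]
  · have : baseKernel b x y = ∑ s, g s x * g s y := by rw [hg]; simp
    simp only [← hquad]
    rw [← this]
    simp [baseKernel]
  · have := ho s t
    rw [hquad s, hquad t, mean_quadComb_mul_quadComb (h.mean_linComb_pow hf) (hHs t), hHt,
      hHt] at this
    split_ifs at this ⊢ <;> linarith
  · -- orthogonality of the first and the third projection
    have h13 : ∀ y i, L (f i * (4 * a y ^ 3 - 3 * a y * b y)) = 0 := by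
      intro y
      have ho' : ∀ i j, L (((2 : ℝ) • f i) * ((2 : ℝ) • f j)) = if i = j then 1 else 0 := by
        intro i j
        simp only [smul_mul_smul_comm, map_smul, hff, smul_eq_mul]
        split_ifs <;> norm_num
      refine fun i => coeff_eq_zero_of_orthonormal ho'
        (c := fun i => L (f i * (4 * a y ^ 3 - 3 * a y * b y))) (fun x => ?_) i
      have := h.orth_ne (show (1 : Fin 7) ≠ 3 by decide) x y
      have e : levelPoly 1 (a x) (b x) * levelPoly 3 (a y) (b y) =
          ∑ i, (32 * f i x) • (f i * (4 * a y ^ 3 - 3 * a y * b y)) := by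
        have e1 : levelPoly 1 (a x) (b x) = ∑ i, (4 * f i x) • f i := by
          ext z
          simp [levelPoly, hf x, linComb_apply, Finset.mul_sum, mul_assoc]
        rw [e1, Finset.sum_mul]
        refine Finset.sum_congr rfl fun i _ => ?_
        ext z
        simp [levelPoly]
        ring
      rw [e] at this
      simp only [map_sum, map_smul, smul_eq_mul] at this
      calc _ = (1 / 16) * ∑ i, 32 * f i x * L (f i * (4 * a y ^ 3 - 3 * a y * b y)) := by
            rw [Finset.mul_sum]
            refine Finset.sum_congr rfl fun i _ => ?_
            simp only [BoundedContinuousFunction.coe_smul, smul_eq_mul]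
            ring
        _ = 0 := by rw [this, mul_zero]
    have hcub : ∀ y i, ∑ s, quadComb f (H s) y * ∑ l, H s i l * f l y = 3 * f i y := by
      intro y i
      have e : f i * (4 * a y ^ 3 - 3 * a y * b y) = (4 : ℝ) • (f i * a y * (a y * a y))
          - (3 / 2 : ℝ) • (f i * a y) - (1 / 2 : ℝ) • (f i * a y * baseKernel b y) := by
        ext z
        simp [baseKernel]
        ring
      have m1 : L (f i * a y * (a y * a y)) = f i y / 8 := by
        have e1 := mean_linComb (h.mean_linComb_pow hf) (Pi.single i 1) (fun i => f i y)
          (fun i => f i y) (fun i => f i y)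
        have e2 : (fun i => f i y) ⬝ᵥ (fun i => f i y) = 1 := by
          rw [← h.sum_sq hf y]; simp only [dotProduct, sq]
        rw [linComb_single, ← hf, e2, single_dotProduct] at e1
        rw [e1]
        ring
      have m2 : ∀ g' : M →ᵇ ℝ, L (f i * a y * g') = ∑ l, f l y * L (f i * f l * g') := by
        intro g'
        rw [hf, linComb, Finset.mul_sum, Finset.sum_mul, map_sum]
        refine Finset.sum_congr rfl fun l _ => ?_
        rw [mul_smul_comm, smul_mul_assoc, map_smul, smul_eq_mul]
      have m3 : L (f i * a y) = f i y / 4 := by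
        have := m2 1
        simp only [mul_one, hff] at this
        rw [this]
        simp
        ring
      have m4 : L (f i * a y * baseKernel b y) =
          1 / 12 * ∑ s, quadComb f (H s) y * ∑ l, H s i l * f l y := by
        rw [hg]
        simp only [Finset.mul_sum, mul_smul_comm, map_sum, map_smul, smul_eq_mul, m2, ← hquad, H]
        refine Finset.sum_congr rfl fun s _ => Finset.sum_congr rfl fun l _ => ?_
        ring
      have := h13 y i
      rw [e, map_sub, map_sub, map_smul, map_smul, map_smul, m1, m3, m4] at this
      simp only [smul_eq_mul] at this
      linarith
    have hpoly : ∀ v : Fin 4 → ℝ, ∑ j, ∑ k, ∑ l,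
        (∑ s, H s j k * H s i l - if j = k ∧ i = l then 3 else 0) * (v j * v k * v l) =
        ∑ s, (∑ j, ∑ k, H s j k * (v j * v k)) * (∑ l, H s i l * v l) -
          3 * (∑ j, v j ^ 2) * v i := by
      intro v
      simp only [sub_mul, Finset.sum_sub_distrib]
      congr 1
      · simp only [Finset.sum_mul, Finset.mul_sum]
        calc _ = ∑ j, ∑ k, ∑ s, ∑ l, H s j k * H s i l * (v j * v k * v l) :=
              Finset.sum_congr rfl fun j _ => Finset.sum_congr rfl fun k _ => Finset.sum_comm
          _ = ∑ j, ∑ s, ∑ k, ∑ l, H s j k * H s i l * (v j * v k * v l) :=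
              Finset.sum_congr rfl fun j _ => Finset.sum_comm
          _ = ∑ s, ∑ j, ∑ k, ∑ l, H s j k * H s i l * (v j * v k * v l) := Finset.sum_comm
          _ = ∑ s, ∑ j, ∑ l, ∑ k, H s j k * H s i l * (v j * v k * v l) :=
              Finset.sum_congr rfl fun s _ => Finset.sum_congr rfl fun j _ => Finset.sum_comm
          _ = ∑ s, ∑ l, ∑ j, ∑ k, H s j k * H s i l * (v j * v k * v l) :=
              Finset.sum_congr rfl fun s _ => Finset.sum_comm
          _ = _ := by
              refine Finset.sum_congr rfl fun s _ => Finset.sum_congr rfl fun l _ =>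
                Finset.sum_congr rfl fun j _ => Finset.sum_congr rfl fun k _ => ?_
              ring
      · simp only [ite_and, ite_mul, zero_mul]
        have : ∀ j, ∑ k, ∑ l, (if j = k then if i = l then 3 * (v j * v k * v l) else 0 else 0) =
            3 * v j ^ 2 * v i := by
          intro j
          rw [Finset.sum_eq_single j (by intro k _ hk; simp [Ne.symm hk]) (by simp)]
          simp
          ring
        simp only [this, Finset.mul_sum, Finset.sum_mul]
    have := cubic_eq_zero h.mean (h.sum_sq hf) (h.mean_sixth hf)
      (fun j k l => ∑ s, H s j k * H s i l - if j = k ∧ i = l then 3 else 0) (fun y => by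
        rw [hpoly fun i => f i y]
        have := hcub y i
        simp only [quadComb_apply] at this
        rw [this, h.sum_sq hf]
        ring) u
    rw [hpoly] at this
    exact sub_eq_zero.1 this

end IsSpectralPair

end BaseKernel

/-! ### The normal form of the quadratic map: Clifford relations -/

section Clifford

/-- Unit combinations of the matrices have numerical radius at most `1`, by the Cauchy-Schwarz
inequality. -/
lemma mulVec_combination_sq_le {K : Fin 3 → Matrix (Fin 4) (Fin 4) ℝ}
    (hn : ∀ u : Fin 4 → ℝ, ∑ s, (u ⬝ᵥ (K s).mulVec u) ^ 2 = (u ⬝ᵥ u) ^ 2) {c : Fin 3 → ℝ}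
    (hc : ∑ s, c s ^ 2 = 1) (u : Fin 4 → ℝ) :
    |u ⬝ᵥ (∑ s, c s • K s).mulVec u| ≤ u ⬝ᵥ u := by
  have h0 : 0 ≤ u ⬝ᵥ u := by
    rw [dotProduct]; exact Finset.sum_nonneg fun i _ => mul_self_nonneg _
  have e : u ⬝ᵥ (∑ s, c s • K s).mulVec u = ∑ s, c s * (u ⬝ᵥ (K s).mulVec u) := by
    rw [Matrix.sum_mulVec, dotProduct_sum]
    simp [Matrix.smul_mulVec]
  rw [e]
  refine abs_le_of_sq_le_sq ?_ h0
  calc _ ≤ (∑ s, c s ^ 2) * ∑ s, (u ⬝ᵥ (K s).mulVec u) ^ 2 :=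
        Finset.sum_mul_sq_le_sq_mul_sq _ _ _
    _ = _ := by rw [hc, hn, one_mul]

/-- A symmetric `4 × 4` matrix with numerical radius at most `1` and Hilbert-Schmidt norm `2` is an
involution. -/
lemma mul_self_eq_one_of_numerical_radius {A : Matrix (Fin 4) (Fin 4) ℝ} (hA : A.IsSymm)
    (h1 : ∀ u : Fin 4 → ℝ, |u ⬝ᵥ A.mulVec u| ≤ u ⬝ᵥ u) (h2 : (A * A).trace = 4) : A * A = 1 := by
  have hA' : A.IsHermitian := by
    rw [Matrix.IsHermitian, Matrix.conjTranspose_eq_transpose_of_trivial]; exact hA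
  have hp : (1 + A).PosSemidef := by
    refine Matrix.PosSemidef.of_dotProduct_mulVec_nonneg (Matrix.isHermitian_one.add hA')
      fun u => ?_
    have := (abs_le.1 (h1 u)).1
    rw [star_trivial, Matrix.add_mulVec, Matrix.one_mulVec, dotProduct_add]
    linarith
  have hm : (1 - A).PosSemidef := by
    refine Matrix.PosSemidef.of_dotProduct_mulVec_nonneg (Matrix.isHermitian_one.sub hA')
      fun u => ?_
    have := (abs_le.1 (h1 u)).2
    rw [star_trivial, Matrix.sub_mulVec, Matrix.one_mulVec, dotProduct_sub]
    linarith
  have h3 : ((1 - A) * (1 + A) * (1 - A)).PosSemidef := by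
    have := hp.conjTranspose_mul_mul_same (1 - A)
    rwa [hm.1.eq] at this
  have h4 : ((1 + A) * (1 - A) * (1 + A)).PosSemidef := by
    have := hm.conjTranspose_mul_mul_same (1 + A)
    rwa [hp.1.eq] at this
  have h5 : (1 - A) * (1 + A) * (1 - A) + (1 + A) * (1 - A) * (1 + A) = (2 : ℝ) • (1 - A * A) := by
    rw [two_smul]
    noncomm_ring
  have h6 := h3.add h4
  have h7 : ((1 - A) * (1 + A) * (1 - A) + (1 + A) * (1 - A) * (1 + A)).trace = 0 := by
    rw [h5, Matrix.trace_smul, Matrix.trace_sub, h2, Matrix.trace_one]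
    simp
  rw [h6.trace_eq_zero_iff, h5] at h7
  exact (sub_eq_zero.1 ((smul_eq_zero.1 h7).resolve_left two_ne_zero)).symm

/-- Three anticommuting symmetric involutions of a four-dimensional space have the same normal form
as the quadratic forms of the Hopf map: the basis is `e, QRe, Qe, Re` for a unit vector
`e` fixed by `P`. -/
lemma exists_basis_of_clifford {E : Type*} [NormedAddCommGroup E] [InnerProductSpace ℝ E]
    [FiniteDimensional ℝ E] (hE : Module.finrank ℝ E = 4) {P Q R : E →ₗ[ℝ] E}
    (hP : P.IsSymmetric) (hQ : Q.IsSymmetric) (hR : R.IsSymmetric)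
    (hQQ : ∀ v, Q (Q v) = v) (hRR : ∀ v, R (R v) = v)
    (hPQ : ∀ v, P (Q v) = -Q (P v)) (hPR : ∀ v, P (R v) = -R (P v))
    (hQR : ∀ v, Q (R v) = -R (Q v)) {e : E} (he : ‖e‖ = 1) (hPe : P e = e) :
    ∃ ε : OrthonormalBasis (Fin 4) ℝ E, ∀ u,
      inner ℝ u (P u) = ε.repr u 0 ^ 2 + ε.repr u 1 ^ 2 - ε.repr u 2 ^ 2 - ε.repr u 3 ^ 2 ∧
      inner ℝ u (Q u) = 2 * (ε.repr u 0 * ε.repr u 2 + ε.repr u 1 * ε.repr u 3) ∧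
      inner ℝ u (R u) = 2 * (ε.repr u 0 * ε.repr u 3 - ε.repr u 1 * ε.repr u 2) := by
  have hee : inner ℝ e e = (1 : ℝ) := by rw [real_inner_self_eq_norm_sq, he]; norm_num
  have eQ : inner ℝ e (Q e) = (0 : ℝ) := by
    have h1 : inner ℝ e (Q e) = inner ℝ e (P (Q e)) := by rw [← hP, hPe]
    rw [hPQ, hPe, inner_neg_right] at h1
    linarith
  have eR : inner ℝ e (R e) = (0 : ℝ) := by
    have h1 : inner ℝ e (R e) = inner ℝ e (P (R e)) := by rw [← hP, hPe]
    rw [hPR, hPe, inner_neg_right] at h1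
    linarith
  have QeRe : inner ℝ (Q e) (R e) = (0 : ℝ) := by
    have h1 : inner ℝ (Q e) (R e) = inner ℝ e (Q (R e)) := hQ _ _
    have h2 : inner ℝ (R e) (Q e) = inner ℝ e (R (Q e)) := hR _ _
    rw [hQR, inner_neg_right] at h1
    rw [real_inner_comm] at h2
    linarith
  have QeQe : inner ℝ (Q e) (Q e) = (1 : ℝ) := by rw [hQ, hQQ, hee]
  have ReRe : inner ℝ (R e) (R e) = (1 : ℝ) := by rw [hR, hRR, hee]
  have eQR : inner ℝ e (Q (R e)) = (0 : ℝ) := by rw [← hQ, QeRe]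
  have QRQR : inner ℝ (Q (R e)) (Q (R e)) = (1 : ℝ) := by rw [hQ, hQQ, ReRe]
  have QRQ : inner ℝ (Q (R e)) (Q e) = (0 : ℝ) := by rw [hQ, hQQ, real_inner_comm, eR]
  have QRR : inner ℝ (Q (R e)) (R e) = (0 : ℝ) := by
    rw [hQR, inner_neg_left, hR, hRR, real_inner_comm, eQ, neg_zero]
  let w : Fin 4 → E := ![e, Q (R e), Q e, R e]
  have hw : Orthonormal ℝ w := by
    rw [orthonormal_iff_ite]
    intro i j
    have h1 : inner ℝ (Q e) e = (0 : ℝ) := by rw [real_inner_comm, eQ]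
    have h2 : inner ℝ (R e) e = (0 : ℝ) := by rw [real_inner_comm, eR]
    have h3 : inner ℝ (R e) (Q e) = (0 : ℝ) := by rw [real_inner_comm, QeRe]
    have h4 : inner ℝ (Q (R e)) e = (0 : ℝ) := by rw [real_inner_comm, eQR]
    have h5 : inner ℝ (Q e) (Q (R e)) = (0 : ℝ) := by rw [real_inner_comm, QRQ]
    have h6 : inner ℝ (R e) (Q (R e)) = (0 : ℝ) := by rw [real_inner_comm, QRR]
    fin_cases i <;> fin_cases j <;>
      simp [-inner_self_eq_norm_sq_to_K, w, hee, eQ, eR, QeRe, QeQe, ReRe, eQR, QRQR, QRQ, QRR, h1,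
        h2, h3, h4, h5, h6]
  let B : OrthonormalBasis (Fin 4) ℝ E := OrthonormalBasis.mk hw (by
    have hc : Fintype.card (Fin 4) = Module.finrank ℝ E := by simp [hE]
    rw [hw.linearIndependent.span_eq_top_of_card_eq_finrank' hc])
  have hB : ∀ i, B i = w i := fun i => by simp [B]
  refine ⟨B, fun u => ?_⟩
  have key : ∀ T : E →ₗ[ℝ] E, T.IsSymmetric → inner ℝ u (T u) =
      ∑ i, B.repr u i * inner ℝ (T (w i)) u := by
    intro T hT
    rw [← B.sum_inner_mul_inner u (T u)]
    refine Finset.sum_congr rfl fun i _ => ?_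
    rw [B.repr_apply_apply, real_inner_comm, hB, hT]
  have r0 : inner ℝ e u = B.repr u 0 := by rw [B.repr_apply_apply, hB]; rfl
  have r1 : inner ℝ (Q (R e)) u = B.repr u 1 := by rw [B.repr_apply_apply, hB]; rfl
  have r2 : inner ℝ (Q e) u = B.repr u 2 := by rw [B.repr_apply_apply, hB]; rfl
  have r3 : inner ℝ (R e) u = B.repr u 3 := by rw [B.repr_apply_apply, hB]; rfl
  have w0 : w 0 = e := rfl
  have w1 : w 1 = Q (R e) := rfl
  have w2 : w 2 = Q e := rfl
  have w3 : w 3 = R e := rfl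
  refine ⟨?_, ?_, ?_⟩
  · have h1 : P (Q e) = -Q e := by rw [hPQ, hPe]
    have h2 : P (R e) = -R e := by rw [hPR, hPe]
    have h3 : P (Q (R e)) = Q (R e) := by rw [hPQ, h2, map_neg, neg_neg]
    rw [key P hP, Fin.sum_univ_four, w0, w1, w2, w3, hPe, h1, h2, h3, inner_neg_left,
      inner_neg_left, r0, r1, r2, r3]
    ring
  · rw [key Q hQ, Fin.sum_univ_four, w0, w1, w2, w3, hQQ, hQQ, r0, r1, r2, r3]
    ring
  · have h1 : R (Q (R e)) = -Q e := by rw [hQR, map_neg, hRR]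
    have h2 : R (Q e) = -Q (R e) := by rw [hQR, neg_neg]
    rw [key R hR, Fin.sum_univ_four, w0, w1, w2, w3, hRR, h1, h2, inner_neg_left, inner_neg_left,
      r0, r1, r2, r3]
    ring

/-- The quadratic map with components `K_s` maps unit vectors to unit vectors and the `K_s` are
orthogonal, so that every unit combination of them is an involution.  This is the Clifford relation.
-/
lemma anticommute_of_quadratic_identity {K : Fin 3 → Matrix (Fin 4) (Fin 4) ℝ}
    (hs : ∀ s, (K s).IsSymm) (ht : ∀ s t, (K s * K t).trace = if s = t then 4 else 0)
    (hn : ∀ u : Fin 4 → ℝ, ∑ s, (u ⬝ᵥ (K s).mulVec u) ^ 2 = (u ⬝ᵥ u) ^ 2) :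
    (∀ s, K s * K s = 1) ∧ ∀ s t, s ≠ t → K s * K t = -(K t * K s) := by
  have key : ∀ c : Fin 3 → ℝ, ∑ s, c s ^ 2 = 1 →
      (∑ s, c s • K s) * (∑ s, c s • K s) = 1 := by
    intro c hc
    refine mul_self_eq_one_of_numerical_radius ?_ (mulVec_combination_sq_le hn hc) ?_
    · rw [Matrix.IsSymm, Matrix.transpose_sum]
      exact Finset.sum_congr rfl fun s _ => by rw [Matrix.transpose_smul, (hs s).eq]
    · rw [Finset.sum_mul_sum, Matrix.trace_sum]
      simp only [Matrix.trace_sum, Matrix.smul_mul, Matrix.mul_smul, Matrix.trace_smul, ht,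
        smul_eq_mul, mul_ite, mul_zero, Finset.sum_ite_eq, Finset.mem_univ, if_true]
      rw [Finset.sum_congr rfl fun s _ => show c s * (c s * 4) = c s ^ 2 * 4 by ring,
        ← Finset.sum_mul, hc, one_mul]
  have h1 : ∀ s, K s * K s = 1 := by
    intro s
    have := key (Pi.single s 1) (by simp [Pi.single_apply])
    simpa [Pi.single_apply] using this
  refine ⟨h1, fun s t hst => ?_⟩
  -- a rational point of the unit circle in the plane of `s` and `t`
  have h2 := key (Pi.single s (3 / 5) + Pi.single t (4 / 5)) (by
    simp only [Pi.add_apply, add_sq, Finset.sum_add_distrib, Pi.single_apply, ite_pow]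
    simp [hst.symm]
    norm_num)
  have h3 : ∑ k, (Pi.single s (3 / 5) + Pi.single t (4 / 5) : Fin 3 → ℝ) k • K k =
      (3 / 5 : ℝ) • K s + (4 / 5 : ℝ) • K t := by
    simp [add_smul, Finset.sum_add_distrib, Pi.single_apply]
  rw [h3, add_mul, mul_add, mul_add] at h2
  simp only [Matrix.smul_mul, Matrix.mul_smul, h1] at h2
  have h4 : (12 / 25 : ℝ) • (K s * K t + K t * K s) = 0 := by
    rw [← sub_eq_zero.2 h2]
    module
  exact eq_neg_of_add_eq_zero_left ((smul_eq_zero.1 h4).resolve_left (by norm_num))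

/-- In suitable orthonormal coordinates the three quadratic forms are the components of the Hopf
map, up to the sign of the third one.  The factor `√3` comes from `∑_s H_s(u)² = 3‖u‖⁴`, which is
the contraction of the cubic identity with `u`. -/
lemma exists_hopf_normal_form {H : Fin 3 → Fin 4 → Fin 4 → ℝ} (hs : ∀ s i j, H s i j = H s j i)
    (h0 : ∀ s, ∑ i, H s i i = 0)
    (ht : ∀ s t, ∑ i, ∑ j, H s i j * H t i j = if s = t then 12 else 0)
    (hc : ∀ u : Fin 4 → ℝ, ∀ i,
      ∑ s, (∑ j, ∑ k, H s j k * (u j * u k)) * ∑ l, H s i l * u l = 3 * (∑ j, u j ^ 2) * u i) :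
    ∃ ε : OrthonormalBasis (Fin 4) ℝ (EuclideanSpace ℝ (Fin 4)), ∀ u : EuclideanSpace ℝ (Fin 4),
      ∑ i, ∑ j, H 0 i j * (u i * u j) = √3 *
        (ε.repr u 0 ^ 2 + ε.repr u 1 ^ 2 - ε.repr u 2 ^ 2 - ε.repr u 3 ^ 2) ∧
      ∑ i, ∑ j, H 1 i j * (u i * u j) =
        √3 * (2 * (ε.repr u 0 * ε.repr u 2 + ε.repr u 1 * ε.repr u 3)) ∧
      ∑ i, ∑ j, H 2 i j * (u i * u j) =
        √3 * (2 * (ε.repr u 0 * ε.repr u 3 - ε.repr u 1 * ε.repr u 2)) := by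
  have h3 : √3 * √3 = 3 := Real.mul_self_sqrt (by norm_num)
  have h3' : √3 ≠ 0 := by positivity
  have h3i : (√3)⁻¹ * (√3)⁻¹ = 3⁻¹ := by rw [← mul_inv, h3]
  let K : Fin 3 → Matrix (Fin 4) (Fin 4) ℝ := fun s => (√3)⁻¹ • Matrix.of (H s)
  have hK : ∀ s i j, K s i j = (√3)⁻¹ * H s i j := fun _ _ _ => rfl
  have hKs : ∀ s, (K s).IsSymm := fun s => by ext i j; rw [Matrix.transpose_apply, hK, hK, hs]
  have hform : ∀ s (u : Fin 4 → ℝ),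
      u ⬝ᵥ (K s).mulVec u = (√3)⁻¹ * ∑ j, ∑ k, H s j k * (u j * u k) := by
    intro s u
    simp only [dotProduct, Matrix.mulVec, hK, Finset.mul_sum]
    exact Finset.sum_congr rfl fun i _ => Finset.sum_congr rfl fun j _ => by ring
  have hn : ∀ u : Fin 4 → ℝ, ∑ s, (u ⬝ᵥ (K s).mulVec u) ^ 2 = (u ⬝ᵥ u) ^ 2 := by
    intro u
    have e1 : ∑ i, u i * (∑ s, (∑ j, ∑ k, H s j k * (u j * u k)) * ∑ l, H s i l * u l) =
        3 * (u ⬝ᵥ u) ^ 2 := by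
      have : ∀ i, u i * (∑ s, (∑ j, ∑ k, H s j k * (u j * u k)) * ∑ l, H s i l * u l) =
        3 * (u ⬝ᵥ u) * (u i * u i) := by
        intro i
        rw [hc]
        simp only [dotProduct, pow_two]
        ring
      rw [Finset.sum_congr rfl fun i _ => this i, ← Finset.mul_sum, pow_two, ← mul_assoc]
      rfl
    have e2 : ∑ i, u i * (∑ s, (∑ j, ∑ k, H s j k * (u j * u k)) * ∑ l, H s i l * u l) =
        ∑ s, (∑ j, ∑ k, H s j k * (u j * u k)) ^ 2 := by
      simp_rw [Finset.mul_sum (s := (Finset.univ : Finset (Fin 3)))]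
      rw [Finset.sum_comm]
      refine Finset.sum_congr rfl fun s _ => ?_
      rw [pow_two, Finset.mul_sum (a := ∑ j, ∑ k, H s j k * (u j * u k))]
      refine Finset.sum_congr rfl fun i _ => ?_
      rw [mul_left_comm, Finset.mul_sum (a := u i)]
      congr 1
      exact Finset.sum_congr rfl fun j _ => by ring
    have e3 : ∑ s, (u ⬝ᵥ (K s).mulVec u) ^ 2 =
        3⁻¹ * ∑ s, (∑ j, ∑ k, H s j k * (u j * u k)) ^ 2 := by
      rw [Finset.mul_sum]
      exact Finset.sum_congr rfl fun s _ => by rw [hform, mul_pow, pow_two (√3)⁻¹, h3i]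
    rw [e3, ← e2, e1]
    ring
  have htr : ∀ s t, (K s * K t).trace = if s = t then 4 else 0 := by
    intro s t
    have : (K s * K t).trace = 3⁻¹ * ∑ i, ∑ j, H s i j * H t i j := by
      simp only [Matrix.trace, Matrix.diag, Matrix.mul_apply, hK, Finset.mul_sum]
      refine Finset.sum_congr rfl fun i _ => Finset.sum_congr rfl fun j _ => ?_
      rw [hs t j i, ← h3i]
      ring
    rw [this, ht]
    split_ifs <;> norm_num
  obtain ⟨hsq, hanti⟩ := anticommute_of_quadratic_identity hKs htr hn
  let T : Fin 3 → EuclideanSpace ℝ (Fin 4) →ₗ[ℝ] EuclideanSpace ℝ (Fin 4) :=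
    fun s => Matrix.toEuclideanLin (K s)
  have hT : ∀ s v, T s v = WithLp.toLp 2 ((K s).mulVec v.ofLp) := fun s v => rfl
  have hTs : ∀ s, (T s).IsSymmetric := fun s => by
    rw [Matrix.isSymmetric_toEuclideanLin_iff, Matrix.IsHermitian,
      Matrix.conjTranspose_eq_transpose_of_trivial]
    exact hKs s
  have hTT : ∀ s v, T s (T s v) = v := fun s v => by
    rw [hT, hT, Matrix.mulVec_mulVec, hsq, Matrix.one_mulVec]
  have hTa : ∀ s t, s ≠ t → ∀ v, T s (T t v) = -T t (T s v) := fun s t hst v => by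
    rw [hT, hT, hT, hT, Matrix.mulVec_mulVec, Matrix.mulVec_mulVec, hanti s t hst,
      Matrix.neg_mulVec]
    rfl
  have hne : ∃ v, v + T 0 v ≠ 0 := by
    by_contra! h
    have e : K 0 = -1 := by
      refine Matrix.ext_of_mulVec_single fun i => ?_
      have := congrArg WithLp.ofLp (h (WithLp.toLp 2 (Pi.single i 1)))
      rw [hT] at this
      have h2 : Pi.single i 1 + (K 0).mulVec (Pi.single i 1) = 0 := this
      rw [Matrix.neg_mulVec, Matrix.one_mulVec]
      exact eq_neg_of_add_eq_zero_right h2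
    have h2 : (K 0).trace = 0 := by
      simp only [Matrix.trace, Matrix.diag, hK, ← Finset.mul_sum, h0, mul_zero]
    rw [e, Matrix.trace_neg, Matrix.trace_one] at h2
    norm_num at h2
  obtain ⟨v, hv⟩ := hne
  have hfix : T 0 (v + T 0 v) = v + T 0 v := by rw [map_add, hTT, add_comm]
  obtain ⟨ε, hε⟩ := exists_basis_of_clifford (by simp) (hTs 0) (hTs 1) (hTs 2) (hTT 1) (hTT 2)
    (hTa 0 1 (by decide)) (hTa 0 2 (by decide)) (hTa 1 2 (by decide))
    (e := ‖v + T 0 v‖⁻¹ • (v + T 0 v)) (norm_smul_inv_norm hv) (by rw [map_smul, hfix])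
  have hq : ∀ s (u : EuclideanSpace ℝ (Fin 4)),
      ∑ i, ∑ j, H s i j * (u i * u j) = √3 * inner ℝ u (T s u) := by
    intro s u
    have : inner ℝ u (T s u) = u.ofLp ⬝ᵥ (K s).mulVec u.ofLp := by
      rw [hT, EuclideanSpace.inner_eq_star_dotProduct, star_trivial, dotProduct_comm]
    rw [this, hform, mul_inv_cancel_left₀ h3']
  exact ⟨ε, fun u => ⟨by rw [hq, (hε u).1], by rw [hq, (hε u).2.1], by rw [hq, (hε u).2.2]⟩⟩

end Clifford

section HopfCoordinates

variable {M : Type*} [TopologicalSpace M]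

lemma hopf_inner (u v : Sph 3) : inner ℝ (hopf u : EuclideanSpace ℝ (Fin 3)) (hopf v) =
    (u.1 0 ^ 2 + u.1 1 ^ 2 - u.1 2 ^ 2 - u.1 3 ^ 2) *
      (v.1 0 ^ 2 + v.1 1 ^ 2 - v.1 2 ^ 2 - v.1 3 ^ 2) +
    2 * (u.1 0 * u.1 2 + u.1 1 * u.1 3) * (2 * (v.1 0 * v.1 2 + v.1 1 * v.1 3)) +
    2 * (u.1 1 * u.1 2 - u.1 0 * u.1 3) * (2 * (v.1 1 * v.1 2 - v.1 0 * v.1 3)) := by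
  rw [PiLp.inner_apply, Fin.sum_univ_three]
  simp [hopf]
  ring

/-- A spectral pair is the pull-back of the standard one by a map to the three-sphere. -/
theorem IsSpectralPair.exists_map_sphere {L : (M →ᵇ ℝ) →ₗ[ℝ] ℝ} {a b : M → M →ᵇ ℝ}
    (h : IsSpectralPair L a b) : ∃ F : M → Sph 3, Continuous F ∧
      (∀ x y, inner ℝ (F x : EuclideanSpace ℝ (Fin 4)) (F y) = a x y) ∧
      ∀ x y, inner ℝ (hopf (F x) : EuclideanSpace ℝ (Fin 3)) (hopf (F y)) = 2 * b x y - 1 := by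
  obtain ⟨f, H, ha, hb, hs, h0, ht, hc⟩ := h.exists_quadratic_forms
  obtain ⟨ε, hε⟩ := exists_hopf_normal_form hs h0 ht hc
  let g : M → EuclideanSpace ℝ (Fin 4) := fun x => WithLp.toLp 2 fun i => f i x
  have hg : ∀ x y, inner ℝ (ε.repr (g x)) (ε.repr (g y)) = a x y := by
    intro x y
    rw [LinearIsometryEquiv.inner_map_map, ha, PiLp.inner_apply]
    exact Finset.sum_congr rfl fun i _ => by simp [g, mul_comm]
  have hn : ∀ x, ε.repr (g x) ∈ Metric.sphere (0 : EuclideanSpace ℝ (Fin 4)) 1 := by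
    intro x
    rw [mem_sphere_zero_iff_norm, ← sq_eq_sq₀ (norm_nonneg _) zero_le_one,
      ← real_inner_self_eq_norm_sq, hg, h.self_left, one_pow]
  have hgc : Continuous g := by
    refine (PiLp.continuous_toLp 2 _).comp (continuous_pi fun i => (f i).continuous)
  refine ⟨fun x => ⟨ε.repr (g x), hn x⟩, (ε.repr.continuous.comp hgc).subtype_mk _, hg,
    fun x y => ?_⟩
  have e := hb x y
  rw [Fin.sum_univ_three] at e
  simp only [quadComb_apply] at e
  have hx : ∀ s, ∑ i, ∑ j, H s i j * (f i x * f j x) =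
      ∑ i, ∑ j, H s i j * (g x i * g x j) := fun s => rfl
  have hy : ∀ s, ∑ i, ∑ j, H s i j * (f i y * f j y) =
      ∑ i, ∑ j, H s i j * (g y i * g y j) := fun s => rfl
  rw [hx, hx, hx, hy, hy, hy, (hε (g x)).1, (hε (g x)).2.1, (hε (g x)).2.2, (hε (g y)).1,
    (hε (g y)).2.1, (hε (g y)).2.2] at e
  rw [hopf_inner]
  dsimp only
  generalize ε.repr (g x) = u at e ⊢
  generalize ε.repr (g y) = v at e ⊢
  have h3 : √3 ^ 2 = 3 := Real.sq_sqrt (by norm_num)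
  ring_nf at e ⊢
  rw [h3] at e
  linarith

end HopfCoordinates

/-! ### The map to the three-sphere -/

section MapToSphere

lemma eigenKernel_eq_levelPoly (j : Fin 7) (r θ : ℝ) :
    eigenKernel j r θ = levelPoly j (Real.cos r * Real.cos θ) (Real.cos r ^ 2) := by
  fin_cases j
  · exact eigenKernel_zero r θ
  · exact eigenKernel_one r θ
  · exact eigenKernel_two r θ
  · exact eigenKernel_three r θ
  · exact eigenKernel_four r θ
  · exact eigenKernel_five r θ
  · exact eigenKernel_six r θ

lemma levelPoly_coe_apply {M : Type*} [TopologicalSpace M] (j : Fin 7) (a b : M →ᵇ ℝ) (x : M) :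
    levelPoly j a b x = levelPoly j (a x) (b x) := by
  fin_cases j <;> simp [levelPoly]

/-- Integration of bounded continuous functions. -/
def integralMap {M : Type*} [TopologicalSpace M] [MeasurableSpace M] [OpensMeasurableSpace M]
    (μ : Measure M) [IsFiniteMeasure μ] : (M →ᵇ ℝ) →ₗ[ℝ] ℝ where
  toFun f := ∫ x, f x ∂μ
  map_add' f g := integral_add (f.integrable μ) (g.integrable μ)
  map_smul' c _ := integral_const_mul c _

lemma isMean_integralMap {M : Type*} [TopologicalSpace M] [MeasurableSpace M]
    [OpensMeasurableSpace M] (μ : Measure M) [IsProbabilityMeasure μ] [μ.IsOpenPosMeasure] :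
    IsMean (integralMap μ) where
  nonneg _ hf := integral_nonneg hf
  eq_zero f hf h := by
    have h1 := (integral_eq_zero_iff_of_nonneg hf (f.integrable μ)).1 h
    have h2 := Continuous.ae_eq_iff_eq μ f.continuous (continuous_const (y := (0 : ℝ)))
    ext x
    exact congrFun (h2.1 h1) x
  one := by simp [integralMap]

variable {M : Type*} [TopologicalSpace M] [MeasurableSpace M] [BorelSpace M] {μ : Measure M}
  [SigmaFinite μ] [μ.IsOpenPosMeasure] {r θ : M → M → ℝ} {p : ℝ → M → M → ℝ}

/-- The hypotheses on the heat kernel provide a map to the sphere that represents `cos r cos θ`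
by the inner product, and `cos 2r` by the inner product of the Hopf images. -/
theorem exists_map_sphere [Nonempty M] (hrθ : IsAdmissiblePair r θ)
    (htop : IsCompatibleTopology r θ) (hp : IsHeatKernel μ p)
    (hform : ∀ t > 0, ∀ x y, (p t x y : ℂ) = su2Kernel t (r x y) (θ x y)) :
    ∃ F : M → Sph 3, Continuous F ∧
      (∀ x y, inner ℝ (F x : EuclideanSpace ℝ (Fin 4)) (F y) =
        Real.cos (r x y) * Real.cos (θ x y)) ∧
      ∀ x y, inner ℝ (hopf (F x) : EuclideanSpace ℝ (Fin 3)) (hopf (F y)) =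
        2 * Real.cos (r x y) ^ 2 - 1 := by
  obtain ⟨hμ, horth⟩ := eigenKernel_orthogonal hrθ htop hp hform
  have hr := hrθ.pseudoMetric
  have hca := continuous_cos_pow_mul_cos hrθ htop 1
  simp only [pow_one, Nat.cast_one, one_mul] at hca
  have hcb := (Real.continuous_cos.comp (continuous_r hrθ htop)).pow 2
  let a : M → M →ᵇ ℝ := fun x => BoundedContinuousFunction.ofNormedAddCommGroup
    (fun y => Real.cos (r x y) * Real.cos (θ x y)) (hca.comp (Continuous.prodMk_right x)) 1
    fun y => by
      rw [norm_mul]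
      exact mul_le_one₀ (Real.abs_cos_le_one _) (norm_nonneg _) (Real.abs_cos_le_one _)
  let b : M → M →ᵇ ℝ := fun x => BoundedContinuousFunction.ofNormedAddCommGroup
    (fun y => Real.cos (r x y) ^ 2) (hcb.comp (Continuous.prodMk_right x)) 1
    fun y => by
      rw [norm_pow]
      exact pow_le_one₀ (norm_nonneg _) (Real.abs_cos_le_one _)
  have h : IsSpectralPair (integralMap μ) a b :=
    { mean := isMean_integralMap μ
      symm_left := fun x y => by simp [a, hr.symm x y, hrθ.angle_symm x y]
      symm_right := fun x y => by simp [b, hr.symm x y]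
      self_left := fun x => by simp [a, hr.self, hrθ.angle_self]
      self_right := fun x => by simp [b, hr.self]
      orth := fun j l x y => by
        have h1 := horth j l x y
        simp only [eigenKernel_eq_levelPoly, Fin.val_inj] at h1
        refine Eq.trans (integral_congr_ae (ae_of_all _ fun w => ?_)) h1
        simp only [BoundedContinuousFunction.coe_mul, Pi.mul_apply, levelPoly_coe_apply]
        rw [hr.symm w y, hrθ.angle_symm w y]
        rfl }
  obtain ⟨F, hF, hFa, hFb⟩ := h.exists_map_sphere
  exact ⟨F, hF, hFa, hFb⟩

end MapToSphere

/-! ### Matrix coefficients of the representations of `SU(2)` -/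

section MatrixCoefficients

open Polynomial ComplexConjugate

lemma coeff_linear_pow {R : Type*} [CommRing R] (a b : R) {N k : ℕ} (hk : k ≤ N) :
    ((C a + C b * X) ^ N).coeff k = N.choose k * a ^ (N - k) * b ^ k := by
  have e : ∀ m, (C b * X) ^ m * C a ^ (N - m) * (N.choose m : R[X]) =
      C (N.choose m * a ^ (N - m) * b ^ m) * X ^ m := fun m => by
    simp only [map_mul, map_pow, map_natCast]
    ring
  rw [add_comm, add_pow, finsetSum_coeff, Finset.sum_eq_single k]
  · rw [e, coeff_C_mul_X_pow, if_pos rfl]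
  · intro m _ hm
    rw [e, coeff_C_mul_X_pow, if_neg hm.symm]
  · intro h
    exact absurd (Finset.mem_range.2 (by omega)) h

/-- The matrix coefficients (up to normalization) of the `N`-th symmetric power of the standard
representation of `SU(2)`, as functions of the first column `(z, w)` of the group element: the
coefficient of `s^k` in the polynomial `(z - s w̄)^l (w + s z̄)^(N-l)`. -/
def matrixCoeff (N k l : ℕ) (z w : ℂ) : ℂ :=
  ((C z + C (-conj w) * X) ^ l * (C w + C (conj z) * X) ^ (N - l)).coeff k

lemma conj_matrixCoeff (N k l : ℕ) (z w : ℂ) : conj (matrixCoeff N k l z w) =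
    ((C (conj z) + C (-w) * X) ^ l * (C (conj w) + C z * X) ^ (N - l)).coeff k := by
  rw [matrixCoeff, ← coeff_map]
  simp

/-- The addition formula. -/
lemma sum_matrixCoeff_mul_conj (n k : ℕ) (z w z' w' : ℂ) :
    ∑ l ∈ Finset.range (2 * k + n + 1), ((2 * k + n).choose l : ℂ) *
      (matrixCoeff (2 * k + n) k l z w * conj (matrixCoeff (2 * k + n) k l z' w')) =
    ((2 * k + n).choose k : ℂ) * ((z * conj z' + w * conj w') ^ n *
      ∑ s ∈ Finset.range (k + 1), (k.choose s : ℂ) * ((n + k).choose s : ℂ) *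
        (-((w * z' - z * w') * conj (w * z' - z * w'))) ^ s *
        ((z * conj z' + w * conj w') * conj (z * conj z' + w * conj w')) ^ (k - s)) := by
  set h := z * conj z' + w * conj w' with hh
  set g := w * z' - z * w' with hg
  have key : ∑ l ∈ Finset.range (2 * k + n + 1), ((2 * k + n).choose l : ℂ[X]) *
      ((C z + C (-conj w) * X) ^ l * (C w + C (conj z) * X) ^ (2 * k + n - l) *
        C (conj (matrixCoeff (2 * k + n) k l z' w'))) =
      ((2 * k + n).choose k : ℂ[X]) * (C h + C (-conj g) * X) ^ (n + k) *
        (C g + C (conj h) * X) ^ k := by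
    have h1 := add_pow
      (C (C z + C (-conj w) * X : ℂ[X]) * (C (C (conj z')) + C (C (-w')) * X))
      (C (C w + C (conj z) * X : ℂ[X]) * (C (C (conj w')) + C (C z') * X)) (2 * k + n)
    have h2 : (C (C z + C (-conj w) * X : ℂ[X]) * (C (C (conj z')) + C (C (-w')) * X)) +
      (C (C w + C (conj z) * X : ℂ[X]) * (C (C (conj w')) + C (C z') * X)) =
      C (C h + C (-conj g) * X) + C (C g + C (conj h) * X) * X := by
      simp only [hh, hg, map_add, map_sub, map_mul, map_neg, Complex.conj_conj]
      ring
    rw [h2] at h1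
    have h3 := congrArg (fun q => q.coeff k) h1
    rw [coeff_linear_pow _ _ (by omega), finsetSum_coeff,
      show 2 * k + n - k = n + k by omega] at h3
    rw [h3]
    refine Finset.sum_congr rfl fun l _ => ?_
    rw [conj_matrixCoeff, mul_pow, mul_pow, ← C_pow, ← C_pow, ← C_eq_natCast (R := ℂ[X]),
      coeff_mul_C, mul_mul_mul_comm, ← C_mul, coeff_C_mul, mul_comm]
    congr 2
    rw [← coeff_map]
    simp only [Polynomial.map_mul, Polynomial.map_pow, Polynomial.map_add, map_C, map_X]
  have h4 := congrArg (fun q => q.coeff k) key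
  simp only [finsetSum_coeff] at h4
  have h5 : ∀ l, (((2 * k + n).choose l : ℂ[X]) *
      ((C z + C (-conj w) * X) ^ l * (C w + C (conj z) * X) ^ (2 * k + n - l) *
        C (conj (matrixCoeff (2 * k + n) k l z' w')))).coeff k = ((2 * k + n).choose l : ℂ) *
      (matrixCoeff (2 * k + n) k l z w * conj (matrixCoeff (2 * k + n) k l z' w')) := by
    intro l
    rw [← C_eq_natCast, coeff_C_mul, coeff_mul_C, ← matrixCoeff]
  rw [Finset.sum_congr rfl fun l _ => h5 l] at h4
  rw [h4, mul_assoc, ← C_eq_natCast, coeff_C_mul, coeff_mul,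
    Finset.Nat.sum_antidiagonal_eq_sum_range_succ_mk]
  congr 1
  rw [Finset.mul_sum]
  refine Finset.sum_congr rfl fun s hs => ?_
  have hs' : s ≤ k := Nat.lt_succ_iff.1 (Finset.mem_range.1 hs)
  rw [coeff_linear_pow _ _ (by omega), coeff_linear_pow _ _ (by omega), Nat.sub_sub_self hs',
    Nat.choose_symm hs', show n + k - s = n + (k - s) by omega, pow_add, mul_pow, neg_pow (conj g),
    neg_pow (g * conj g), mul_pow]
  ring

/-- The first coordinate in the identification of `ℝ⁴` with `ℂ²`. -/
def fstC (u : EuclideanSpace ℝ (Fin 4)) : ℂ := ⟨u 0, u 1⟩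

/-- The second coordinate in the identification of `ℝ⁴` with `ℂ²`. -/
def sndC (u : EuclideanSpace ℝ (Fin 4)) : ℂ := ⟨u 2, u 3⟩

/-- The Hermitian inner product of `ℂ²`. -/
def herm (u v : EuclideanSpace ℝ (Fin 4)) : ℂ := fstC u * conj (fstC v) + sndC u * conj (sndC v)

lemma herm_re (u v : EuclideanSpace ℝ (Fin 4)) : (herm u v).re = inner ℝ u v := by
  rw [PiLp.inner_apply, Fin.sum_univ_four]
  simp [herm, fstC, sndC]
  ring

lemma sum_sq_sphere (u : Sph 3) : u.1 0 ^ 2 + u.1 1 ^ 2 + u.1 2 ^ 2 + u.1 3 ^ 2 = 1 := by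
  have h : ‖u.1‖ ^ 2 = 1 := by rw [mem_sphere_zero_iff_norm.1 u.2]; norm_num
  rw [EuclideanSpace.norm_sq_eq, Fin.sum_univ_four] at h
  simpa using h

/-- The inner product of the Hopf images is determined by the modulus of the Hermitian product. -/
lemma normSq_herm (u v : Sph 3) : Complex.normSq (herm u v) =
    (1 + inner ℝ (hopf u : EuclideanSpace ℝ (Fin 3)) (hopf v)) / 2 := by
  rw [hopf_inner]
  have h1 := sum_sq_sphere u
  have h2 := sum_sq_sphere v
  have h3 : (u.1 0 ^ 2 + u.1 1 ^ 2 + u.1 2 ^ 2 + u.1 3 ^ 2) *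
    (v.1 0 ^ 2 + v.1 1 ^ 2 + v.1 2 ^ 2 + v.1 3 ^ 2) = 1 := by rw [h1, h2, one_mul]
  simp only [Complex.normSq_apply, herm, fstC, sndC, Complex.add_re, Complex.add_im, Complex.mul_re,
    Complex.mul_im, Complex.conj_re, Complex.conj_im]
  linear_combination (1 / 2 : ℝ) * h3

/-- The addition formula on the sphere: the sum is a zonal function of the Hermitian product. -/
lemma sum_matrixCoeff_sphere (n k : ℕ) (u v : Sph 3) :
    ∑ l ∈ Finset.range (2 * k + n + 1), ((2 * k + n).choose l : ℂ) *
      (matrixCoeff (2 * k + n) k l (fstC u) (sndC u) *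
        conj (matrixCoeff (2 * k + n) k l (fstC v) (sndC v))) =
    ((2 * k + n).choose k : ℂ) *
      (herm u v ^ n * (jacobiSum k n (Complex.normSq (herm u v)) : ℝ)) := by
  rw [sum_matrixCoeff_mul_conj]
  congr 2
  have h1 := sum_sq_sphere u
  have h2 := sum_sq_sphere v
  have h3 : Complex.normSq (herm u v) - 1 =
      -Complex.normSq (sndC u * fstC v - fstC u * sndC v) := by
    have h3 : (u.1 0 ^ 2 + u.1 1 ^ 2 + u.1 2 ^ 2 + u.1 3 ^ 2) *
      (v.1 0 ^ 2 + v.1 1 ^ 2 + v.1 2 ^ 2 + v.1 3 ^ 2) = 1 := by rw [h1, h2, one_mul]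
    simp only [Complex.normSq_apply, herm, fstC, sndC, Complex.add_re, Complex.add_im,
      Complex.mul_re, Complex.mul_im, Complex.conj_re, Complex.conj_im, Complex.sub_re,
      Complex.sub_im]
    linear_combination h3
  rw [jacobiSum, Complex.ofReal_sum]
  refine Finset.sum_congr rfl fun s _ => ?_
  rw [h3, Complex.mul_conj, ← herm, Complex.mul_conj]
  push_cast
  ring

/-- If `h` has modulus `|ρ|` and real part `ρ cos θ`, then `h = ρ e^{±iθ}`, so that the real part of
`h^n` is the factor that occurs in `cylTerm`. -/
lemma re_herm_pow {h : ℂ} {ρ θ : ℝ} (h1 : h.re = ρ * Real.cos θ) (h2 : Complex.normSq h = ρ ^ 2)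
    (n : ℕ) : (h ^ n).re = ρ ^ n * Real.cos (n * θ) := by
  induction n using Nat.twoStepInduction with
  | zero => simp
  | one => simpa using h1
  | more n ih1 ih2 =>
    have e : h ^ (n + 2) = (2 * h.re : ℝ) * h ^ (n + 1) - (Complex.normSq h : ℝ) * h ^ n := by
      have : h ^ 2 = (2 * h.re : ℝ) * h - (Complex.normSq h : ℝ) := by
        rw [← Complex.mul_conj, ← Complex.add_conj]
        ring
      rw [pow_add, this]
      ring
    rw [e, Complex.sub_re, Complex.re_ofReal_mul, Complex.re_ofReal_mul, ih1, ih2, h1, h2]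
    have := cos_add_two_mul n θ
    push_cast at this ⊢
    rw [this]
    ring

end MatrixCoefficients

/-! ### Surjectivity of the map to the sphere -/

section Surjectivity

open Polynomial ComplexConjugate

lemma continuous_coeff_mul {T : Type*} [TopologicalSpace T] {p q : T → ℂ[X]}
    (hp : ∀ k, Continuous fun t => (p t).coeff k) (hq : ∀ k, Continuous fun t => (q t).coeff k)
    (k : ℕ) : Continuous fun t => (p t * q t).coeff k := by
  simp only [coeff_mul]
  exact continuous_finsetSum _ fun i _ => (hp _).mul (hq _)

lemma continuous_coeff_pow {T : Type*} [TopologicalSpace T] {p : T → ℂ[X]}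
    (hp : ∀ k, Continuous fun t => (p t).coeff k) (n : ℕ) :
    ∀ k, Continuous fun t => (p t ^ n).coeff k := by
  induction n with
  | zero => intro k; simpa using continuous_const
  | succ n ih => intro k; simpa only [pow_succ] using continuous_coeff_mul ih hp k

lemma continuous_coeff_linear {T : Type*} [TopologicalSpace T] {a b : T → ℂ} (ha : Continuous a)
    (hb : Continuous b) (k : ℕ) : Continuous fun t => (C (a t) + C (b t) * X).coeff k := by
  match k with
  | 0 => simpa using ha
  | 1 => simpa [coeff_C] using hb
  | k + 2 => simpa [coeff_C, coeff_X] using continuous_const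

lemma continuous_fstC : Continuous fstC :=
  Complex.equivRealProdCLM.symm.continuous.comp
    ((by fun_prop : Continuous fun u : EuclideanSpace ℝ (Fin 4) => (u 0, u 1)))

lemma continuous_sndC : Continuous sndC :=
  Complex.equivRealProdCLM.symm.continuous.comp
    ((by fun_prop : Continuous fun u : EuclideanSpace ℝ (Fin 4) => (u 2, u 3)))

lemma continuous_herm (u : EuclideanSpace ℝ (Fin 4)) : Continuous (herm u) := by
  have := continuous_fstC
  have := continuous_sndC
  unfold herm
  fun_prop

lemma continuous_matrixCoeff (N k l : ℕ) :
    Continuous fun v : EuclideanSpace ℝ (Fin 4) => matrixCoeff N k l (fstC v) (sndC v) := by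
  have h1 := continuous_fstC
  have h2 := continuous_sndC
  exact continuous_coeff_mul
    (continuous_coeff_pow (continuous_coeff_linear h1 (by fun_prop)) _)
    (continuous_coeff_pow (continuous_coeff_linear h2 (by fun_prop)) _) k

/-- The leading coefficient of the Jacobi polynomial is not zero, so that the powers of `b` can be
recovered from the Jacobi polynomials by recursion. -/
lemma jacobiSum_eq_sum_pow (k n : ℕ) : ∃ q : ℕ → ℝ, q k ≠ 0 ∧
    ∀ b, jacobiSum k n b = ∑ i ∈ Finset.range (k + 1), q i * b ^ i := by
  let J : ℝ[X] := ∑ s ∈ Finset.range (k + 1),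
    C ((k.choose s : ℝ) * ((n + k).choose s)) * ((X - C 1) ^ s * X ^ (k - s))
  have hm : ∀ s, ((X - C 1) ^ s * X ^ (k - s) : ℝ[X]).Monic := fun s =>
    ((monic_X_sub_C 1).pow s).mul (monic_X_pow _)
  have hd : ∀ s ≤ k, ((X - C 1) ^ s * X ^ (k - s) : ℝ[X]).natDegree = k := fun s hs => by
    rw [((monic_X_sub_C (1 : ℝ)).pow s).natDegree_mul (monic_X_pow _), natDegree_pow,
      natDegree_X_sub_C, natDegree_X_pow]
    omega
  have hJd : J.natDegree < k + 1 := by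
    refine Nat.lt_succ_of_le (natDegree_sum_le_of_forall_le _ _ fun s hs => ?_)
    exact (natDegree_C_mul_le _ _).trans (hd s (Nat.lt_succ_iff.1 (Finset.mem_range.1 hs))).le
  refine ⟨J.coeff, ?_, fun b => ?_⟩
  · have : J.coeff k = ∑ s ∈ Finset.range (k + 1), (k.choose s : ℝ) * ((n + k).choose s) := by
      simp only [J, finsetSum_coeff]
      refine Finset.sum_congr rfl fun s hs => ?_
      rw [coeff_C_mul]
      have h1 := (hm s).coeff_natDegree
      rw [hd s (Nat.lt_succ_iff.1 (Finset.mem_range.1 hs))] at h1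
      rw [h1, mul_one]
    rw [this]
    refine (Finset.sum_pos' (fun s _ => by positivity) ⟨0, by simp, by simp⟩).ne'
  · rw [← eval_eq_sum_range' hJd]
    simp only [J, eval_finsetSum, jacobiSum]
    refine Finset.sum_congr rfl fun s _ => ?_
    simp
    ring

variable {M : Type*} [TopologicalSpace M] [MeasurableSpace M] [BorelSpace M] {μ : Measure M}
  [IsProbabilityMeasure μ] {F : M → Sph 3}

lemma integrable_comp_sphere (hF : Continuous F) {g : EuclideanSpace ℝ (Fin 4) → ℂ}
    (hg : Continuous g) : Integrable (fun y => g (F y)) μ := by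
  obtain ⟨K, hK⟩ := (isCompact_sphere (0 : EuclideanSpace ℝ (Fin 4)) 1).exists_bound_of_continuousOn
    hg.continuousOn
  exact Integrable.of_bound (hg.comp (continuous_subtype_val.comp hF)).aestronglyMeasurable K
    (ae_of_all _ fun y => hK _ (F y).2)

lemma continuous_herm_pow_mul (hn : ℕ) {g : ℝ → ℝ} (hg : Continuous g)
    (u : EuclideanSpace ℝ (Fin 4)) :
    Continuous fun v => herm u v ^ hn * ((g (Complex.normSq (herm u v)) : ℝ) : ℂ) :=
  ((continuous_herm u).pow _).mul (Complex.continuous_ofReal.comp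
    (hg.comp (Complex.continuous_normSq.comp (continuous_herm u))))

lemma continuous_jacobiSum (k n : ℕ) : Continuous (jacobiSum k n) := by
  unfold jacobiSum
  fun_prop

/-- The mean of the kernel of a spherical component, as a function of its first variable. -/
lemma choose_mul_integral_herm_pow (hF : Continuous F) (n k : ℕ) (u : Sph 3) :
    ((2 * k + n).choose k : ℂ) *
      ∫ y, herm u (F y) ^ n * (jacobiSum k n (Complex.normSq (herm u (F y))) : ℝ) ∂μ =
    ∑ l ∈ Finset.range (2 * k + n + 1), ((2 * k + n).choose l : ℂ) *
      (matrixCoeff (2 * k + n) k l (fstC u) (sndC u) *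
        conj (∫ y, matrixCoeff (2 * k + n) k l (fstC (F y)) (sndC (F y)) ∂μ)) := by
  rw [← integral_const_mul]
  simp only [← sum_matrixCoeff_sphere]
  rw [integral_finsetSum]
  · refine Finset.sum_congr rfl fun l _ => ?_
    rw [integral_const_mul, integral_const_mul, integral_conj]
  · intro l _
    have h1 : Integrable (fun y => matrixCoeff (2 * k + n) k l (fstC (F y)) (sndC (F y))) μ :=
      integrable_comp_sphere hF (continuous_matrixCoeff _ _ _)
    exact ((Complex.conjCLE.integrable_comp_iff.2 h1).const_mul _).const_mul _

/-- The double mean of the kernel of a spherical component is a sum of squares of moduli of means of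
matrix coefficients. -/
lemma choose_mul_double_integral (hF : Continuous F) (n k : ℕ) :
    ((2 * k + n).choose k : ℝ) * ∫ x, (∫ y, herm (F x) (F y) ^ n *
      (jacobiSum k n (Complex.normSq (herm (F x) (F y))) : ℝ) ∂μ).re ∂μ =
    ∑ l ∈ Finset.range (2 * k + n + 1), ((2 * k + n).choose l : ℝ) *
      Complex.normSq (∫ y, matrixCoeff (2 * k + n) k l (fstC (F y)) (sndC (F y)) ∂μ) := by
  have h1 : ∀ l, Integrable (fun y => matrixCoeff (2 * k + n) k l (fstC (F y)) (sndC (F y))) μ :=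
    fun l => integrable_comp_sphere hF (continuous_matrixCoeff _ _ _)
  rw [← integral_const_mul]
  have h2 : ∀ x, ((2 * k + n).choose k : ℝ) * (∫ y, herm (F x) (F y) ^ n *
      (jacobiSum k n (Complex.normSq (herm (F x) (F y))) : ℝ) ∂μ).re =
      (∑ l ∈ Finset.range (2 * k + n + 1), ((2 * k + n).choose l : ℂ) *
      (matrixCoeff (2 * k + n) k l (fstC (F x)) (sndC (F x)) *
        conj (∫ y, matrixCoeff (2 * k + n) k l (fstC (F y)) (sndC (F y)) ∂μ))).re := by
    intro x
    rw [← choose_mul_integral_herm_pow hF, ← Complex.ofReal_natCast, Complex.re_ofReal_mul]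
  simp only [h2]
  have h3 : Integrable (fun x => ∑ l ∈ Finset.range (2 * k + n + 1), ((2 * k + n).choose l : ℂ) *
      (matrixCoeff (2 * k + n) k l (fstC (F x)) (sndC (F x)) *
        conj (∫ y, matrixCoeff (2 * k + n) k l (fstC (F y)) (sndC (F y)) ∂μ))) μ :=
    integrable_finsetSum _ fun l _ => ((h1 l).mul_const _).const_mul _
  have h4 := integral_re h3
  simp only [RCLike.re_to_complex] at h4
  rw [h4, integral_finsetSum _ fun l _ => ((h1 l).mul_const _).const_mul _, Complex.re_sum]
  refine Finset.sum_congr rfl fun l _ => ?_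
  rw [integral_const_mul, integral_mul_const, Complex.mul_conj, ← Complex.ofReal_natCast,
    ← Complex.ofReal_mul, Complex.ofReal_re]

/-- If all double means of the kernels `eigenKernel j`, `j ≠ 0`, vanish, then the means of all the
non-trivial matrix coefficients vanish, by positivity. -/
lemma integral_herm_pow_mul_jacobiSum_eq_zero {r θ : M → M → ℝ} (hF : Continuous F)
    (ha : ∀ x y, inner ℝ (F x : EuclideanSpace ℝ (Fin 4)) (F y) =
      Real.cos (r x y) * Real.cos (θ x y))
    (hb : ∀ x y, inner ℝ (hopf (F x) : EuclideanSpace ℝ (Fin 3)) (hopf (F y)) =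
      2 * Real.cos (r x y) ^ 2 - 1)
    (h0 : ∀ j ≠ 0, ∀ x, ∫ y, eigenKernel j (r x y) (θ x y) ∂μ = 0) {n k : ℕ}
    (hnk : ¬(n = 0 ∧ k = 0)) (u : Sph 3) :
    ∫ y, herm u (F y) ^ n * (jacobiSum k n (Complex.normSq (herm u (F y))) : ℝ) ∂μ = 0 := by
  let S : ℕ → ℕ → ℝ := fun n k => ∫ x, (∫ y, herm (F x) (F y) ^ n *
      (jacobiSum k n (Complex.normSq (herm (F x) (F y))) : ℝ) ∂μ).re ∂μ
  have hpos : ∀ n k, (0 : ℝ) < (2 * k + n).choose k := fun n k =>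
    Nat.cast_pos.2 (Nat.choose_pos (by omega))
  have hS : ∀ n k, 0 ≤ S n k := by
    intro n k
    have h := choose_mul_double_integral (μ := μ) hF n k
    refine nonneg_of_mul_nonneg_right (a := ((2 * k + n).choose k : ℝ)) ?_ (hpos n k)
    rw [h]
    exact Finset.sum_nonneg fun l _ => mul_nonneg (Nat.cast_nonneg _) (Complex.normSq_nonneg _)
  have hcyl : ∀ n k x y, cylTerm n k (r x y) (θ x y) = (herm (F x) (F y) ^ n *
      (jacobiSum k n (Complex.normSq (herm (F x) (F y))) : ℝ)).re := by
    intro n k x y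
    have hn : Complex.normSq (herm (F x) (F y)) = Real.cos (r x y) ^ 2 := by
      rw [normSq_herm, hb]
      ring
    rw [mul_comm, Complex.re_ofReal_mul,
      re_herm_pow (ρ := Real.cos (r x y)) (θ := θ x y) (by rw [herm_re, ha]) hn, hn, cylTerm]
    ring
  have hint : ∀ n k x, Integrable (fun y => herm (F x) (F y) ^ n *
      ((jacobiSum k n (Complex.normSq (herm (F x) (F y))) : ℝ) : ℂ)) μ := fun n k x =>
    integrable_comp_sphere hF (continuous_herm_pow_mul n (continuous_jacobiSum k n) _)
  have hcylint : ∀ n k x, ∫ y, cylTerm n k (r x y) (θ x y) ∂μ = (∫ y, herm (F x) (F y) ^ n *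
      (jacobiSum k n (Complex.normSq (herm (F x) (F y))) : ℝ) ∂μ).re := by
    intro n k x
    simp only [hcyl]
    exact integral_re (hint n k x)
  have hSint : ∀ n k, Integrable (fun x => (∫ y, herm (F x) (F y) ^ n *
      (jacobiSum k n (Complex.normSq (herm (F x) (F y))) : ℝ) ∂μ).re) μ := by
    intro n k
    have e : ∀ x, ∫ y, herm (F x) (F y) ^ n *
      (jacobiSum k n (Complex.normSq (herm (F x) (F y))) : ℝ) ∂μ =
      ((2 * k + n).choose k : ℂ)⁻¹ *
      ∑ l ∈ Finset.range (2 * k + n + 1), ((2 * k + n).choose l : ℂ) *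
      (matrixCoeff (2 * k + n) k l (fstC (F x)) (sndC (F x)) *
        conj (∫ y, matrixCoeff (2 * k + n) k l (fstC (F y)) (sndC (F y)) ∂μ)) := by
      intro x
      rw [← choose_mul_integral_herm_pow hF, inv_mul_cancel_left₀]
      exact_mod_cast (hpos n k).ne'
    simp only [e]
    have h1 : ∀ l, Integrable
        (fun y => matrixCoeff (2 * k + n) k l (fstC (F y)) (sndC (F y))) μ := fun l =>
      integrable_comp_sphere hF (continuous_matrixCoeff _ _ _)
    have h2 : Integrable (fun x => ∑ l ∈ Finset.range (2 * k + n + 1),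
        ((2 * k + n).choose l : ℂ) * (matrixCoeff (2 * k + n) k l (fstC (F x)) (sndC (F x)) *
          conj (∫ y, matrixCoeff (2 * k + n) k l (fstC (F y)) (sndC (F y)) ∂μ))) μ :=
      integrable_finsetSum _ fun l _ => ((h1 l).mul_const _).const_mul _
    exact (h2.const_mul _).re
  have hS0 : S n k = 0 := by
    have hj : level ((n : ℤ), k) ≠ 0 := by
      simp only [level, Int.natAbs_natCast]
      intro h
      refine hnk ⟨by omega, ?_⟩
      rcases Nat.eq_zero_or_pos k with h' | h'
      · exact h'
      · have : 0 < 2 * k * (k + n + 1) := by positivity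
        omega
    have h1 : ∑ i ∈ levelSet (level ((n : ℤ), k)), mult i * S i.1.natAbs i.2 = 0 := by
      have h2 : ∀ x, ∑ i ∈ levelSet (level ((n : ℤ), k)), mult i *
          (∫ y, herm (F x) (F y) ^ i.1.natAbs * (jacobiSum i.2 i.1.natAbs
            (Complex.normSq (herm (F x) (F y))) : ℝ) ∂μ).re = 0 := by
        intro x
        rw [← h0 _ hj x]
        simp only [eigenKernel]
        rw [integral_finsetSum]
        · exact Finset.sum_congr rfl fun i _ => by rw [integral_const_mul, hcylint]
        · intro i _
          simp only [hcyl]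
          exact (hint _ _ _).re.const_mul _
      have h3 : ∫ x, ∑ i ∈ levelSet (level ((n : ℤ), k)), mult i *
          (∫ y, herm (F x) (F y) ^ i.1.natAbs * (jacobiSum i.2 i.1.natAbs
            (Complex.normSq (herm (F x) (F y))) : ℝ) ∂μ).re ∂μ = 0 := by
          simp only [h2, integral_zero]
      rw [integral_finsetSum _ fun i _ => (hSint _ _).const_mul _] at h3
      simpa only [integral_const_mul] using h3
    rw [Finset.sum_eq_zero_iff_of_nonneg fun i _ => mul_nonneg (mult_pos i).le (hS _ _)] at h1
    have h2 := h1 ((n : ℤ), k) (mem_levelSet.2 rfl)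
    exact (mul_eq_zero.1 h2).resolve_left (mult_pos _).ne'
  have h1 := choose_mul_double_integral (μ := μ) hF n k
  rw [show (∫ x, (∫ y, herm (F x) (F y) ^ n *
      (jacobiSum k n (Complex.normSq (herm (F x) (F y))) : ℝ) ∂μ).re ∂μ) = S n k from rfl, hS0,
    mul_zero, eq_comm, Finset.sum_eq_zero_iff_of_nonneg fun l _ =>
      mul_nonneg (Nat.cast_nonneg _) (Complex.normSq_nonneg _)] at h1
  have h2 := choose_mul_integral_herm_pow (μ := μ) hF n k u
  rw [Finset.sum_eq_zero] at h2
  · exact (mul_eq_zero.1 h2).resolve_left (by exact_mod_cast (hpos n k).ne')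
  · intro l hl
    have h3 := (mul_eq_zero.1 (h1 l hl)).resolve_left (Nat.cast_ne_zero.2
      (Nat.choose_pos (Nat.lt_succ_iff.1 (Finset.mem_range.1 hl))).ne')
    rw [Complex.normSq_eq_zero.1 h3]
    simp

end Surjectivity

section Surjectivity

open Polynomial ComplexConjugate

variable {M : Type*} [TopologicalSpace M] [MeasurableSpace M] [BorelSpace M] {μ : Measure M}
  [IsProbabilityMeasure μ] {F : M → Sph 3}

/-- By induction on `k`: up to a non-zero factor, the mean of `h^n |h|^{2k}` is the mean of
`h^n P_k^{0,n}`, which does not depend on `u`, plus a combination of means of lower degree. -/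
lemma integral_herm_pow_mul_normSq_pow_eq (hF : Continuous F)
    (h0 : ∀ n k : ℕ, ¬(n = 0 ∧ k = 0) → ∀ u : Sph 3,
      ∫ y, herm u (F y) ^ n * (jacobiSum k n (Complex.normSq (herm u (F y))) : ℝ) ∂μ = 0)
    (n k : ℕ) (u v : Sph 3) :
    ∫ y, herm u (F y) ^ n * (Complex.normSq (herm u (F y)) ^ k : ℝ) ∂μ =
      ∫ y, herm v (F y) ^ n * (Complex.normSq (herm v (F y)) ^ k : ℝ) ∂μ := by
  induction k using Nat.strong_induction_on with
  | _ k ih =>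
    have h1 : ∫ y, herm u (F y) ^ n * (jacobiSum k n (Complex.normSq (herm u (F y))) : ℝ) ∂μ =
        ∫ y, herm v (F y) ^ n * (jacobiSum k n (Complex.normSq (herm v (F y))) : ℝ) ∂μ := by
      by_cases h : n = 0 ∧ k = 0
      · obtain ⟨rfl, rfl⟩ := h
        simp [jacobiSum]
      · rw [h0 n k h, h0 n k h]
    obtain ⟨q, hq, hJ⟩ := jacobiSum_eq_sum_pow k n
    have h2 : ∀ w : Sph 3,
        ∫ y, herm w (F y) ^ n * (jacobiSum k n (Complex.normSq (herm w (F y))) : ℝ) ∂μ =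
        ∑ i ∈ Finset.range k, (q i : ℂ) *
          ∫ y, herm w (F y) ^ n * (Complex.normSq (herm w (F y)) ^ i : ℝ) ∂μ +
        q k * ∫ y, herm w (F y) ^ n * (Complex.normSq (herm w (F y)) ^ k : ℝ) ∂μ := by
      intro w
      rw [← Finset.sum_range_succ fun i => (q i : ℂ) *
          ∫ y, herm w (F y) ^ n * (Complex.normSq (herm w (F y)) ^ i : ℝ) ∂μ]
      simp only [← integral_const_mul]
      rw [← integral_finsetSum]
      · refine integral_congr_ae (ae_of_all _ fun y => ?_)
        simp only [hJ, Complex.ofReal_sum, Finset.mul_sum]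
        refine Finset.sum_congr rfl fun i _ => ?_
        push_cast
        ring
      · intro i _
        exact (integrable_comp_sphere hF
          (continuous_herm_pow_mul n (continuous_pow i) w)).const_mul _
    rw [h2, h2, Finset.sum_congr rfl fun i hi => by rw [ih i (Finset.mem_range.1 hi)]] at h1
    exact mul_left_cancel₀ (Complex.ofReal_ne_zero.2 hq) (add_left_cancel h1)

lemma integral_herm_pow_mul_conj_pow_eq (hF : Continuous F)
    (h0 : ∀ n k : ℕ, ¬(n = 0 ∧ k = 0) → ∀ u : Sph 3,
      ∫ y, herm u (F y) ^ n * (jacobiSum k n (Complex.normSq (herm u (F y))) : ℝ) ∂μ = 0)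
    (a c : ℕ) (u v : Sph 3) :
    ∫ y, herm u (F y) ^ a * conj (herm u (F y)) ^ c ∂μ =
      ∫ y, herm v (F y) ^ a * conj (herm v (F y)) ^ c ∂μ := by
  rcases le_total c a with h | h
  · have e : ∀ z : ℂ, z ^ a * conj z ^ c = z ^ (a - c) * (Complex.normSq z ^ c : ℝ) := by
      intro z
      rw [Complex.ofReal_pow, ← Complex.mul_conj, mul_pow, ← mul_assoc, ← pow_add,
        Nat.sub_add_cancel h]
    simp only [e]
    exact integral_herm_pow_mul_normSq_pow_eq hF h0 _ _ u v
  · have e : ∀ z : ℂ, z ^ a * conj z ^ c =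
        conj (z ^ (c - a) * (Complex.normSq z ^ a : ℝ)) := by
      intro z
      rw [Complex.ofReal_pow, ← Complex.mul_conj]
      simp only [map_mul, map_pow, Complex.conj_conj]
      rw [mul_pow, mul_comm (conj z ^ a), mul_left_comm, ← pow_add, Nat.sub_add_cancel h]
    simp only [e, integral_conj]
    rw [integral_herm_pow_mul_normSq_pow_eq hF h0 _ _ u v]

lemma integrable_real_comp_sphere (hF : Continuous F) {g : ℝ → ℝ} (hg : Continuous g) (u : Sph 3) :
    Integrable (fun y => g (inner ℝ (u : EuclideanSpace ℝ (Fin 4)) (F y))) μ := by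
  have h : Continuous fun v : EuclideanSpace ℝ (Fin 4) =>
      ((g (inner ℝ (u : EuclideanSpace ℝ (Fin 4)) v) : ℝ) : ℂ) := by fun_prop
  exact (integrable_comp_sphere hF h).re

/-- The moments of the image measure in all directions coincide. -/
lemma integral_inner_pow_eq (hF : Continuous F)
    (h0 : ∀ n k : ℕ, ¬(n = 0 ∧ k = 0) → ∀ u : Sph 3,
      ∫ y, herm u (F y) ^ n * (jacobiSum k n (Complex.normSq (herm u (F y))) : ℝ) ∂μ = 0)
    (m : ℕ) (u v : Sph 3) :
    ∫ y, inner ℝ (u : EuclideanSpace ℝ (Fin 4)) (F y) ^ m ∂μ =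
      ∫ y, inner ℝ (v : EuclideanSpace ℝ (Fin 4)) (F y) ^ m ∂μ := by
  have h1 : ∀ w : Sph 3, ((∫ y, inner ℝ (w : EuclideanSpace ℝ (Fin 4)) (F y) ^ m ∂μ : ℝ) : ℂ) =
      ∑ j ∈ Finset.range (m + 1), ((2 : ℂ)⁻¹ ^ m * (m.choose j)) *
        ∫ y, herm w (F y) ^ j * conj (herm w (F y)) ^ (m - j) ∂μ := by
    intro w
    simp only [← integral_const_mul]
    rw [← integral_finsetSum, ← integral_complex_ofReal]
    · refine integral_congr_ae (ae_of_all _ fun y => ?_)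
      have h2 : ((inner ℝ (w : EuclideanSpace ℝ (Fin 4)) (F y) : ℝ) : ℂ) =
          2⁻¹ * (herm w (F y) + conj (herm w (F y))) := by
        rw [← herm_re, Complex.add_conj]
        push_cast
        ring
      simp only [Complex.ofReal_pow]
      rw [h2, mul_pow, add_pow, Finset.mul_sum]
      exact Finset.sum_congr rfl fun j _ => by ring
    · intro j _
      refine Integrable.const_mul ?_ _
      have h3 := continuous_herm (w : EuclideanSpace ℝ (Fin 4))
      exact integrable_comp_sphere hF (g := fun v => herm w v ^ j * conj (herm w v) ^ (m - j))
        (by fun_prop)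
  have h2 := h1 u
  rw [Finset.sum_congr rfl fun j _ => by
    rw [integral_herm_pow_mul_conj_pow_eq hF h0 j (m - j) u v], ← h1 v] at h2
  exact_mod_cast h2

/-- By the Weierstrass approximation theorem, the equality of the moments in all directions extends
to continuous functions. -/
lemma integral_comp_inner_eq (hF : Continuous F)
    (h0 : ∀ m (u v : Sph 3), ∫ y, inner ℝ (u : EuclideanSpace ℝ (Fin 4)) (F y) ^ m ∂μ =
      ∫ y, inner ℝ (v : EuclideanSpace ℝ (Fin 4)) (F y) ^ m ∂μ)
    {g : ℝ → ℝ} (hg : Continuous g) (u v : Sph 3) :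
    ∫ y, g (inner ℝ (u : EuclideanSpace ℝ (Fin 4)) (F y)) ∂μ =
      ∫ y, g (inner ℝ (v : EuclideanSpace ℝ (Fin 4)) (F y)) ∂μ := by
  have hp : ∀ q : ℝ[X], ∫ y, q.eval (inner ℝ (u : EuclideanSpace ℝ (Fin 4)) (F y)) ∂μ =
      ∫ y, q.eval (inner ℝ (v : EuclideanSpace ℝ (Fin 4)) (F y)) ∂μ := by
    intro q
    have : ∀ w : Sph 3, ∫ y, q.eval (inner ℝ (w : EuclideanSpace ℝ (Fin 4)) (F y)) ∂μ =
        ∑ i ∈ Finset.range (q.natDegree + 1), q.coeff i *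
          ∫ y, inner ℝ (w : EuclideanSpace ℝ (Fin 4)) (F y) ^ i ∂μ := by
      intro w
      simp only [eval_eq_sum_range, ← integral_const_mul]
      exact integral_finsetSum _ fun i _ =>
        (integrable_real_comp_sphere hF (continuous_pow i) w).const_mul _
    rw [this, this]
    exact Finset.sum_congr rfl fun i _ => by rw [h0 i u v]
  have hmem : ∀ (w : Sph 3) y, inner ℝ (w : EuclideanSpace ℝ (Fin 4)) (F y) ∈
      Set.Icc (-1 : ℝ) 1 := by
    intro w y
    have := abs_real_inner_le_norm (w : EuclideanSpace ℝ (Fin 4)) (F y)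
    rw [mem_sphere_zero_iff_norm.1 w.2, mem_sphere_zero_iff_norm.1 (F y).2, one_mul] at this
    exact abs_le.1 this
  refine eq_of_forall_dist_le fun ε hε => ?_
  obtain ⟨q, hq⟩ := exists_polynomial_near_of_continuousOn (-1) 1 g hg.continuousOn (ε / 2)
    (half_pos hε)
  have hd : ∀ w : Sph 3, |∫ y, g (inner ℝ (w : EuclideanSpace ℝ (Fin 4)) (F y)) ∂μ -
      ∫ y, q.eval (inner ℝ (w : EuclideanSpace ℝ (Fin 4)) (F y)) ∂μ| ≤ ε / 2 := by
    intro w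
    rw [← integral_sub (integrable_real_comp_sphere hF hg w)
      (integrable_real_comp_sphere hF q.continuous w), ← Real.norm_eq_abs]
    refine (norm_integral_le_of_norm_le_const (C := ε / 2) (ae_of_all _ fun y => ?_)).trans
      (by simp)
    rw [Real.norm_eq_abs, abs_sub_comm]
    exact (hq _ (hmem w y)).le
  have h1 := abs_le.1 (hd u)
  have h2 := abs_le.1 (hd v)
  rw [hp] at h1
  rw [Real.dist_eq, abs_le]
  constructor <;> linarith

/-- The range is complete, hence closed: if `F x` and `F y` are close, then `cos r cos θ` is close
to `1`, so both `r x y` and `θ x y` are small.  In particular Cauchy sequences in the range come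
from sequences that are Cauchy for `r` and `θ`. -/
lemma isClosed_range_of_complete {M : Type*} {F : M → Sph 3} {r θ : M → M → ℝ}
    (hrθ : IsAdmissiblePair r θ)
    (ha : ∀ x y, inner ℝ (F x : EuclideanSpace ℝ (Fin 4)) (F y) =
      Real.cos (r x y) * Real.cos (θ x y)) : IsClosed (Set.range F) := by
  have hdist : ∀ u v : Sph 3, dist u v ^ 2 =
      2 - 2 * inner ℝ (u : EuclideanSpace ℝ (Fin 4)) v := by
    intro u v
    rw [Subtype.dist_eq, dist_eq_norm, norm_sub_sq_real, mem_sphere_zero_iff_norm.1 u.2,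
      mem_sphere_zero_iff_norm.1 v.2]
    ring
  refine isClosed_of_closure_subset fun v hv => ?_
  obtain ⟨s, hs, hsv⟩ := mem_closure_iff_seq_limit.1 hv
  choose x hx using hs
  have hc : CauchySeq s := hsv.cauchySeq
  have hr := hrθ.pseudoMetric
  have key : ∀ ε > 0, ∃ η > 0, ∀ x y, dist (F x) (F y) < η → r x y < ε ∧ θ x y < ε := by
    intro ε hε
    set e := min ε (Real.pi / 2) with he
    have he0 : 0 < e := lt_min hε (by positivity)
    have he1 : e ≤ Real.pi / 2 := min_le_right _ _
    have hcos : Real.cos e < 1 := by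
      have := Real.cos_lt_cos_of_nonneg_of_le_pi le_rfl (by linarith [Real.pi_pos]) he0
      rwa [Real.cos_zero] at this
    have hcos0 : 0 ≤ Real.cos e := Real.cos_nonneg_of_mem_Icc ⟨by linarith, he1⟩
    refine ⟨√(2 - 2 * Real.cos e), Real.sqrt_pos.2 (by linarith), fun x y hxy => ?_⟩
    have h1 := Real.lt_sqrt (dist_nonneg (x := F x) (y := F y)) |>.1 hxy
    rw [hdist, ha] at h1
    have h2 : Real.cos e < Real.cos (r x y) * Real.cos (θ x y) := by linarith
    have hr0 := hr.nonneg x y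
    have hr1 := hrθ.le_half_pi x y
    have ht0 := hrθ.angle_nonneg x y
    have ht1 := hrθ.angle_le_pi x y
    have hcr : 0 ≤ Real.cos (r x y) := Real.cos_nonneg_of_mem_Icc ⟨by linarith, hr1⟩
    have hct : 0 < Real.cos (θ x y) := by
      by_contra! h
      have := mul_nonpos_of_nonneg_of_nonpos hcr h
      linarith
    have h3 : Real.cos e < Real.cos (r x y) :=
      h2.trans_le (mul_le_of_le_one_right hcr (Real.cos_le_one _))
    have h4 : Real.cos e < Real.cos (θ x y) :=
      h2.trans_le (mul_le_of_le_one_left hct.le (Real.cos_le_one _))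
    have hpi := Real.pi_pos
    have hel : e ≤ ε := min_le_left _ _
    constructor
    · refine lt_of_lt_of_le ?_ hel
      exact (Real.strictAntiOn_cos.lt_iff_gt ⟨he0.le, by linarith⟩ ⟨hr0, by linarith⟩).1 h3
    · refine lt_of_lt_of_le ?_ hel
      exact (Real.strictAntiOn_cos.lt_iff_gt ⟨he0.le, by linarith⟩ ⟨ht0, ht1⟩).1 h4
  obtain ⟨z, hz1, hz2⟩ := hrθ.complete x fun ε hε => by
    obtain ⟨η, hη, h⟩ := key ε hε
    obtain ⟨N, hN⟩ := Metric.cauchySeq_iff.1 hc η hη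
    exact ⟨N, fun m hm n hn => h _ _ (by rw [hx, hx]; exact hN m hm n hn)⟩
  refine ⟨z, ?_⟩
  have h1 : Tendsto (fun n => dist (s n) (F z) ^ 2) atTop
      (𝓝 (2 - 2 * (Real.cos 0 * Real.cos 0))) := by
    simp only [← hx, hdist, ha]
    exact ((((Real.continuous_cos.tendsto _).comp hz1).mul
      ((Real.continuous_cos.tendsto _).comp hz2)).const_mul 2).const_sub 2
  have h2 : Tendsto (fun n => dist (s n) (F z) ^ 2) atTop (𝓝 (dist v (F z) ^ 2)) :=
    ((continuous_id.dist continuous_const).tendsto v |>.comp hsv).pow 2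
  have h3 := tendsto_nhds_unique h2 h1
  rw [Real.cos_zero] at h3
  have h4 : dist v (F z) = 0 := by
    have : dist v (F z) ^ 2 = 0 := by rw [h3]; norm_num
    exact pow_eq_zero_iff two_ne_zero |>.1 this
  exact (dist_eq_zero.1 h4).symm

/-- A zonal bump function around a point outside the closed range has mean zero.  The same bump
function around a point of the range has positive mean, since `μ` is positive on open sets. -/
lemma surjective_of_integral_comp_inner_eq [Nonempty M] [μ.IsOpenPosMeasure] (hF : Continuous F)
    (hcl : IsClosed (Set.range F))
    (h0 : ∀ g : ℝ → ℝ, Continuous g → ∀ u v : Sph 3,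
      ∫ y, g (inner ℝ (u : EuclideanSpace ℝ (Fin 4)) (F y)) ∂μ =
        ∫ y, g (inner ℝ (v : EuclideanSpace ℝ (Fin 4)) (F y)) ∂μ) : Function.Surjective F := by
  intro v
  by_contra hv
  obtain ⟨ε, hε, hball⟩ := Metric.isOpen_iff.1 hcl.isOpen_compl v hv
  let y₀ : M := Classical.arbitrary M
  -- a function vanishing on the values of `⟨v, ·⟩` on the image, but not at `1`
  let g : ℝ → ℝ := fun t => max 0 (t - (1 - ε ^ 2 / 2))
  have hg : Continuous g := by fun_prop
  have h1 : ∀ y, g (inner ℝ (v : EuclideanSpace ℝ (Fin 4)) (F y)) = 0 := by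
    intro y
    have h2 : ε ≤ dist (F y) v := by
      by_contra! h
      exact hball h ⟨y, rfl⟩
    have h3 : ε ^ 2 ≤ dist (F y) v ^ 2 := pow_le_pow_left₀ hε.le h2 2
    rw [Subtype.dist_eq, dist_comm, dist_eq_norm, norm_sub_sq_real,
      mem_sphere_zero_iff_norm.1 v.2, mem_sphere_zero_iff_norm.1 (F y).2] at h3
    exact max_eq_left (by linarith)
  have h2 := h0 g hg (F y₀) v
  simp only [h1, integral_zero] at h2
  have hgc : Continuous fun y => g (inner ℝ (F y₀ : EuclideanSpace ℝ (Fin 4)) (F y)) := by fun_prop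
  have hg0 : ∀ t, 0 ≤ g t := fun t => le_max_left _ _
  have h3 := (Continuous.ae_eq_iff_eq μ hgc (continuous_const (y := (0 : ℝ)))).1
    ((integral_eq_zero_iff_of_nonneg (fun y => hg0 _) (integrable_real_comp_sphere hF hg _)).1 h2)
  have h4 := congrFun h3 y₀
  simp only [g, real_inner_self_eq_norm_sq, mem_sphere_zero_iff_norm.1 (F y₀).2] at h4
  have h5 := le_max_right 0 ((1 : ℝ) ^ 2 - (1 - ε ^ 2 / 2))
  rw [h4] at h5
  have : 0 < ε ^ 2 := by positivity
  linarith

end Surjectivity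

section Bijectivity

variable {M : Type*} [TopologicalSpace M] [MeasurableSpace M] [BorelSpace M] {μ : Measure M}
  [SigmaFinite μ] [μ.IsOpenPosMeasure] {r θ : M → M → ℝ} {p : ℝ → M → M → ℝ}

/-- The map to the sphere is bijective. -/
theorem exists_equiv_sphere [Nonempty M] (hrθ : IsAdmissiblePair r θ)
    (htop : IsCompatibleTopology r θ) (hp : IsHeatKernel μ p)
    (hform : ∀ t > 0, ∀ x y, (p t x y : ℂ) = su2Kernel t (r x y) (θ x y)) :
    ∃ f : M ≃ Sph 3,
      (∀ x y, inner ℝ (f x : EuclideanSpace ℝ (Fin 4)) (f y) =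
        Real.cos (r x y) * Real.cos (θ x y)) ∧
      ∀ x y, inner ℝ (hopf (f x) : EuclideanSpace ℝ (Fin 3)) (hopf (f y)) =
        2 * Real.cos (r x y) ^ 2 - 1 := by
  obtain ⟨F, hF, ha, hb⟩ := exists_map_sphere hrθ htop hp hform
  obtain ⟨hμ, horth⟩ := eigenKernel_orthogonal hrθ htop hp hform
  have hr := hrθ.pseudoMetric
  have h0 : ∀ j ≠ 0, ∀ x, ∫ y, eigenKernel j (r x y) (θ x y) ∂μ = 0 := by
    intro j hj x
    simpa [eigenKernel_zero, hj] using horth j 0 x x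
  have h1 := fun (n k : ℕ) (hnk : ¬(n = 0 ∧ k = 0)) (u : Sph 3) =>
    integral_herm_pow_mul_jacobiSum_eq_zero hF ha hb h0 hnk u
  have hsurj : Function.Surjective F :=
    surjective_of_integral_comp_inner_eq hF (isClosed_range_of_complete hrθ ha) fun g hg =>
      integral_comp_inner_eq hF (integral_inner_pow_eq hF h1) hg
  have hinj : Function.Injective F := by
    intro x y hxy
    have hr0 := hr.nonneg x y
    have hr1 := hrθ.le_half_pi x y
    have hpi := Real.pi_pos
    have e1 : Real.cos (r x y) * Real.cos (θ x y) = 1 := by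
      rw [← ha, hxy, real_inner_self_eq_norm_sq, mem_sphere_zero_iff_norm.1 (F y).2, one_pow]
    have hc : 0 ≤ Real.cos (r x y) := Real.cos_nonneg_of_mem_Icc ⟨by linarith, hr1⟩
    have e2 : Real.cos (r x y) = 1 := by
      refine le_antisymm (Real.cos_le_one _) ?_
      rw [← e1]
      exact mul_le_of_le_one_right hc (Real.cos_le_one _)
    rw [e2, one_mul] at e1
    refine hrθ.separates x y ?_ ?_
    · exact Real.injOn_cos ⟨hr0, by linarith⟩ ⟨le_rfl, hpi.le⟩ (by rw [e2, Real.cos_zero])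
    · exact Real.injOn_cos ⟨hrθ.angle_nonneg x y, hrθ.angle_le_pi x y⟩ ⟨le_rfl, hpi.le⟩
        (by rw [e1, Real.cos_zero])
  exact ⟨Equiv.ofBijective F ⟨hinj, hsurj⟩, ha, hb⟩

end Bijectivity

/-! ### The Hopf map as a Riemannian submersion -/

section HopfGeometry

/-- What the geometry of the Hopf map `P` depends on: it is the restriction of a smooth map `Q` of
the ambient spaces whose differential at `u` multiplies lengths by `2` on the orthogonal complement
of a unit tangent vector `J u`, and whose fiber through `u` is contained in the plane spanned by `u`
and `J u`. -/
structure IsHopfLike (P : Sph 3 → Sph 2)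
    (Q : EuclideanSpace ℝ (Fin 4) → EuclideanSpace ℝ (Fin 3))
    (J : EuclideanSpace ℝ (Fin 4) →ₗ[ℝ] EuclideanSpace ℝ (Fin 4)) : Prop where
  smooth : ContDiff ℝ ∞ Q
  coe_eq : ∀ u : Sph 3, (P u : EuclideanSpace ℝ (Fin 3)) = Q u
  surjective : Function.Surjective P
  norm_J : ∀ u, ‖J u‖ = ‖u‖
  inner_J : ∀ u, inner ℝ (J u) u = 0
  inner_fderiv : ∀ (u : Sph 3) (v w : EuclideanSpace ℝ (Fin 4)),
    inner ℝ (fderiv ℝ Q u v) (fderiv ℝ Q u w) =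
      4 * (inner ℝ v w - inner ℝ (J u) v * inner ℝ (J u) w)
  fiber : ∀ u v : Sph 3, P u = P v → (v : EuclideanSpace ℝ (Fin 4)) =
    inner ℝ (u : EuclideanSpace ℝ (Fin 4)) v • (u : EuclideanSpace ℝ (Fin 4)) +
      inner ℝ (J u) v • J u

lemma fact_finrank_euclidean (n : ℕ) :
    Fact (Module.finrank ℝ (EuclideanSpace ℝ (Fin (n + 1))) = n + 1) :=
  ⟨finrank_euclideanSpace_fin⟩

attribute [local instance] fact_finrank_euclidean

lemma tangentIncl_injective {n : ℕ} (u : Sph n) : Function.Injective (tangentIncl u) :=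
  injective_mvfderiv_subtypeVal_sphere u

lemma exists_tangentIncl_eq {n : ℕ} (u : Sph n) {v : EuclideanSpace ℝ (Fin (n + 1))}
    (h : inner ℝ v u = 0) : ∃ w, tangentIncl u w = v := by
  have h1 : v ∈ (Submodule.span ℝ {(u : EuclideanSpace ℝ (Fin (n + 1)))})ᗮ :=
    Submodule.mem_orthogonal_singleton_iff_inner_left.2 h
  rw [← range_mvfderiv_subtypeVal (n := n) u] at h1
  exact h1

lemma inner_tangentIncl {n : ℕ} (u : Sph n) (w : TangentSpace (𝓡 n) u) :
    inner ℝ (tangentIncl u w) (u : EuclideanSpace ℝ (Fin (n + 1))) = 0 := by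
  rw [← Submodule.mem_orthogonal_singleton_iff_inner_left, ← range_mvfderiv_subtypeVal (n := n) u]
  exact ⟨w, rfl⟩

namespace IsHopfLike

variable {P : Sph 3 → Sph 2} {Q : EuclideanSpace ℝ (Fin 4) → EuclideanSpace ℝ (Fin 3)}
  {J : EuclideanSpace ℝ (Fin 4) →ₗ[ℝ] EuclideanSpace ℝ (Fin 4)}

lemma contMDiff (h : IsHopfLike P Q J) : ContMDiff (𝓡 3) (𝓡 2) ∞ P := by
  have h1 : ContMDiff (𝓡 3) 𝓘(ℝ, EuclideanSpace ℝ (Fin 3)) ∞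
      fun u : Sph 3 => (P u : EuclideanSpace ℝ (Fin 3)) := by
    simp only [h.coe_eq]
    exact h.smooth.contMDiff.comp contMDiff_coe_sphere
  exact h1.codRestrict_sphere fun u => (P u).2

/-- In the ambient space, the differential of `P` is the restriction of the differential of `Q`. -/
lemma tangentIncl_mfderiv (h : IsHopfLike P Q J) (u : Sph 3) (w : TangentSpace (𝓡 3) u) :
    tangentIncl (P u) (mfderiv (𝓡 3) (𝓡 2) P u w) = fderiv ℝ Q u (tangentIncl u w) := by
  have hP : MDifferentiableAt (𝓡 3) (𝓡 2) P u := (h.contMDiff u).mdifferentiableAt (by simp)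
  have hi : ∀ (n : ℕ) (v : Sph n), MDifferentiableAt (𝓡 n) 𝓘(ℝ, EuclideanSpace ℝ (Fin (n + 1)))
      (Subtype.val : Sph n → EuclideanSpace ℝ (Fin (n + 1))) v := fun n v =>
    (contMDiff_coe_sphere (m := ∞) v).mdifferentiableAt (by simp)
  have hQ : MDifferentiableAt 𝓘(ℝ, EuclideanSpace ℝ (Fin 4)) 𝓘(ℝ, EuclideanSpace ℝ (Fin 3)) Q
      (u : EuclideanSpace ℝ (Fin 4)) :=
    (h.smooth.contDiffAt.differentiableAt (by simp)).mdifferentiableAt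
  have e1 := mfderiv_comp u (hi 2 (P u)) hP
  have e2 := mfderiv_comp u hQ (hi 3 u)
  have e3 : (Subtype.val : Sph 2 → EuclideanSpace ℝ (Fin 3)) ∘ P =
      Q ∘ (Subtype.val : Sph 3 → EuclideanSpace ℝ (Fin 4)) := funext h.coe_eq
  rw [e3, e2, mfderiv_eq_fderiv] at e1
  exact (DFunLike.congr_fun e1 w).symm

lemma norm_J_sphere (h : IsHopfLike P Q J) (u : Sph 3) : ‖J u‖ = 1 := by
  rw [h.norm_J, mem_sphere_zero_iff_norm.1 u.2]

lemma inner_J_self (h : IsHopfLike P Q J) (u : Sph 3) : inner ℝ (J u) (J u) = (1 : ℝ) := by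
  rw [real_inner_self_eq_norm_sq, h.norm_J_sphere, one_pow]

/-- The vertical vectors are the multiples of `J u`. -/
lemma mfderiv_eq_zero_iff (h : IsHopfLike P Q J) (u : Sph 3) (w : TangentSpace (𝓡 3) u) :
    mfderiv (𝓡 3) (𝓡 2) P u w = 0 ↔
      tangentIncl u w = inner ℝ (J u) (tangentIncl u w) • J u := by
  rw [← (tangentIncl_injective (P u)).eq_iff, map_zero, h.tangentIncl_mfderiv,
    ← inner_self_eq_zero (𝕜 := ℝ), h.inner_fderiv, ← sub_eq_zero (a := tangentIncl u w),
    ← inner_self_eq_zero (𝕜 := ℝ) (x := tangentIncl u w - inner ℝ (J u) (tangentIncl u w) • J u)]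
  have e : inner ℝ (tangentIncl u w - inner ℝ (J u) (tangentIncl u w) • J u)
      (tangentIncl u w - inner ℝ (J u) (tangentIncl u w) • J u) =
      inner ℝ (tangentIncl u w) (tangentIncl u w) -
        inner ℝ (J u) (tangentIncl u w) * inner ℝ (J u) (tangentIncl u w) := by
    simp only [inner_sub_left, inner_sub_right, real_inner_smul_left, real_inner_smul_right,
      h.inner_J_self, real_inner_comm (J u)]
    ring
  rw [e]
  simp

/-- The vertical unit vector. -/
lemma exists_vertical (h : IsHopfLike P Q J) (u : Sph 3) :
    ∃ w : TangentSpace (𝓡 3) u, tangentIncl u w = J u ∧ mfderiv (𝓡 3) (𝓡 2) P u w = 0 := by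
  obtain ⟨w, hw⟩ := exists_tangentIncl_eq u (h.inner_J u)
  refine ⟨w, hw, (h.mfderiv_eq_zero_iff u w).2 ?_⟩
  rw [hw, h.inner_J_self, one_smul]

lemma hasFiberDim (h : IsHopfLike P Q J) : HasFiberDim P 1 := by
  intro u
  obtain ⟨w, hw, hw0⟩ := h.exists_vertical u
  refine finrank_eq_one (⟨w, hw0⟩ : LinearMap.ker (mfderiv (𝓡 3) (𝓡 2) P u).toLinearMap) ?_ ?_
  · intro h0
    have h1 : w = 0 := congrArg Subtype.val h0
    have h2 := h.norm_J_sphere u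
    rw [← hw, h1, map_zero, norm_zero] at h2
    exact zero_ne_one h2
  · intro v
    have hv := (h.mfderiv_eq_zero_iff u v.1).1 v.2
    refine ⟨inner ℝ (J u) (tangentIncl u v.1), Subtype.ext (tangentIncl_injective u ?_)⟩
    rw [Submodule.coe_smul, map_smul, hw]
    exact hv.symm

lemma mfderiv_surjective (h : IsHopfLike P Q J) (u : Sph 3) :
    Function.Surjective (mfderiv (𝓡 3) (𝓡 2) P u) := by
  have f3 : FiniteDimensional ℝ (TangentSpace (𝓡 3) u) :=
    inferInstanceAs (FiniteDimensional ℝ (EuclideanSpace ℝ (Fin 3)))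
  have f2 : FiniteDimensional ℝ (TangentSpace (𝓡 2) (P u)) :=
    inferInstanceAs (FiniteDimensional ℝ (EuclideanSpace ℝ (Fin 2)))
  have h1 := LinearMap.finrank_range_add_finrank_ker (mfderiv (𝓡 3) (𝓡 2) P u).toLinearMap
  have h2 : Module.finrank ℝ (TangentSpace (𝓡 3) u) = 3 := finrank_euclideanSpace_fin
  have h3 : Module.finrank ℝ (TangentSpace (𝓡 2) (P u)) = 2 := finrank_euclideanSpace_fin
  rw [h.hasFiberDim u, h2] at h1
  have h4 : (mfderiv (𝓡 3) (𝓡 2) P u).toLinearMap.range = ⊤ := by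
    refine Submodule.eq_top_of_finrank_eq ?_
    rw [h3]
    omega
  exact LinearMap.range_eq_top.1 h4

lemma isRiemannianSubmersion (h : IsHopfLike P Q J) : IsRiemannianSubmersion (1 / 2) P where
  smooth := h.contMDiff
  surjective := h.surjective
  submersion := h.mfderiv_surjective
  isometry u v w hv _ := by
    obtain ⟨x, hx, hx0⟩ := h.exists_vertical u
    have h1 := hv x hx0
    simp only [sphereMetric, hx, one_pow, one_mul] at h1 ⊢
    rw [real_inner_comm] at h1
    rw [h.tangentIncl_mfderiv, h.tangentIncl_mfderiv, h.inner_fderiv, h1]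
    ring

/-- The fibers are contained in planes through the origin, so that the acceleration of a curve in a
fiber has no component orthogonal to the plane; the vertical component vanishes by assumption. -/
lemma hasTotallyGeodesicFibers (h : IsHopfLike P Q J) : HasTotallyGeodesicFibers P := by
  rintro γ a b ⟨hs, hf, hg⟩
  refine ⟨hs, fun t ht w => ?_⟩
  obtain ⟨x, hx, hx0⟩ := h.exists_vertical (γ t)
  have h1 := hg t ht x hx0
  rw [hx] at h1
  set w' := tangentIncl (γ t) w - inner ℝ (J (γ t)) (tangentIncl (γ t) w) • J (γ t) with hw'
  have hw1 : inner ℝ w' (J (γ t)) = (0 : ℝ) := by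
    rw [hw', inner_sub_left, real_inner_smul_left, h.inner_J_self, real_inner_comm]
    ring
  have hw2 : inner ℝ w' (γ t : EuclideanSpace ℝ (Fin 4)) = (0 : ℝ) := by
    rw [hw', inner_sub_left, real_inner_smul_left, inner_tangentIncl, h.inner_J]
    ring
  -- the curve stays in the plane of `γ t` and `J (γ t)`, to which `w'` is orthogonal
  have h2 : inner ℝ w' (acceleration γ t) = (0 : ℝ) := by
    have hc : ContDiffAt ℝ 2 (fun s => (γ s : EuclideanSpace ℝ (Fin 4))) t :=
      (hs.contDiffAt (Ioo_mem_nhds ht.1 ht.2)).of_le (WithTop.coe_le_coe.2 (le_top : (2 : ℕ∞) ≤ ⊤))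
    have e1 := (innerSL ℝ w').iteratedFDeriv_comp_left hc (i := 2) le_rfl
    have e2 : inner ℝ w' (acceleration γ t) =
        iteratedDeriv 2 ((innerSL ℝ w') ∘ fun s => (γ s : EuclideanSpace ℝ (Fin 4))) t := by
      rw [iteratedDeriv_eq_iteratedFDeriv, e1]
      rfl
    have e3 : ((innerSL ℝ w') ∘ fun s => (γ s : EuclideanSpace ℝ (Fin 4))) =ᶠ[𝓝 t]
        fun _ => (0 : ℝ) := by
      filter_upwards [Ioo_mem_nhds ht.1 ht.2] with s hs'
      have e4 := h.fiber (γ t) (γ s) (hf t ht s hs')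
      simp only [Function.comp_apply, innerSL_apply_apply]
      rw [e4, inner_add_right, real_inner_smul_right, real_inner_smul_right, hw1, hw2]
      ring
    rw [e2, e3.iteratedDeriv_eq]
    simp
  have h3 : tangentIncl (γ t) w = w' + inner ℝ (J (γ t)) (tangentIncl (γ t) w) • J (γ t) := by
    rw [hw']
    abel
  rw [h3, inner_add_right, real_inner_smul_right, h1, real_inner_comm, h2]
  ring

end IsHopfLike

/-- The Hopf map on `ℝ⁴`. -/
def hopfAmbient (u : EuclideanSpace ℝ (Fin 4)) : EuclideanSpace ℝ (Fin 3) :=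
  !₂[u 0 ^ 2 + u 1 ^ 2 - u 2 ^ 2 - u 3 ^ 2, 2 * (u 0 * u 2 + u 1 * u 3),
    2 * (u 1 * u 2 - u 0 * u 3)]

/-- The differential of `hopfAmbient` at `u` in the direction `v`. -/
def hopfPolar (u v : EuclideanSpace ℝ (Fin 4)) : EuclideanSpace ℝ (Fin 3) :=
  !₂[2 * (u 0 * v 0 + u 1 * v 1 - u 2 * v 2 - u 3 * v 3),
    2 * (u 0 * v 2 + u 2 * v 0 + u 1 * v 3 + u 3 * v 1),
    2 * (u 1 * v 2 + u 2 * v 1 - u 0 * v 3 - u 3 * v 0)]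

/-- Multiplication by the imaginary unit on `ℝ⁴ = ℂ²`. -/
def complexStructure : EuclideanSpace ℝ (Fin 4) →ₗ[ℝ] EuclideanSpace ℝ (Fin 4) where
  toFun u := !₂[-u 1, u 0, -u 3, u 2]
  map_add' u v := by
    ext i
    fin_cases i <;> simp <;> ring
  map_smul' c u := by
    ext i
    fin_cases i <;> simp

lemma inner_four (u v : EuclideanSpace ℝ (Fin 4)) :
    inner ℝ u v = u 0 * v 0 + u 1 * v 1 + u 2 * v 2 + u 3 * v 3 := by
  rw [PiLp.inner_apply, Fin.sum_univ_four]
  simp [mul_comm]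

lemma inner_complexStructure (u v : EuclideanSpace ℝ (Fin 4)) :
    inner ℝ (complexStructure u) v = -u 1 * v 0 + u 0 * v 1 - u 3 * v 2 + u 2 * v 3 := by
  rw [inner_four]
  simp [complexStructure]
  ring

/-- Since the Hopf map is quadratic, its differential is the coefficient of `t` on lines. -/
lemma hopfAmbient_line (u v : EuclideanSpace ℝ (Fin 4)) (t : ℝ) :
    hopfAmbient (u + t • v) = hopfAmbient u + t • hopfPolar u v + t ^ 2 • hopfAmbient v := by
  ext i
  fin_cases i <;> simp [hopfAmbient, hopfPolar] <;> ring

lemma inner_hopfPolar (u v w : EuclideanSpace ℝ (Fin 4)) :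
    inner ℝ (hopfPolar u v) (hopfPolar u w) = 4 * (‖u‖ ^ 2 * inner ℝ v w -
      inner ℝ (complexStructure u) v * inner ℝ (complexStructure u) w) := by
  rw [inner_complexStructure, inner_complexStructure, ← real_inner_self_eq_norm_sq, inner_four,
    inner_four, PiLp.inner_apply, Fin.sum_univ_three]
  simp [hopfPolar]
  ring

lemma contDiff_hopfAmbient : ContDiff ℝ ∞ hopfAmbient := by
  rw [contDiff_euclidean]
  intro i
  fin_cases i <;> simp [hopfAmbient] <;> fun_prop

lemma normSq_herm_eq (u v : EuclideanSpace ℝ (Fin 4)) : Complex.normSq (herm u v) =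
    inner ℝ u v ^ 2 + inner ℝ (complexStructure u) v ^ 2 := by
  rw [inner_complexStructure, inner_four]
  simp only [Complex.normSq_apply, herm, fstC, sndC, Complex.add_re, Complex.add_im, Complex.mul_re,
    Complex.mul_im, Complex.conj_re, Complex.conj_im]
  ring

/-- Points with the same Hopf image have Hermitian product of modulus `1`, hence are multiples of
one another over `ℂ`. -/
lemma eq_of_hopf_eq {u v : Sph 3} (h : hopf u = hopf v) : (v : EuclideanSpace ℝ (Fin 4)) =
    inner ℝ (u : EuclideanSpace ℝ (Fin 4)) v • (u : EuclideanSpace ℝ (Fin 4)) +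
      inner ℝ (complexStructure u) v • complexStructure u := by
  have h1 : inner ℝ (u : EuclideanSpace ℝ (Fin 4)) v ^ 2 +
      inner ℝ (complexStructure u) (v : EuclideanSpace ℝ (Fin 4)) ^ 2 = 1 := by
    rw [← normSq_herm_eq, normSq_herm, h, real_inner_self_eq_norm_sq,
      mem_sphere_zero_iff_norm.1 (hopf v).2]
    norm_num
  have h2 : inner ℝ (complexStructure u) (u : EuclideanSpace ℝ (Fin 4)) = 0 := by
    rw [inner_complexStructure]
    ring
  have h3 : inner ℝ (complexStructure u) (complexStructure u) = (1 : ℝ) := by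
    have := sum_sq_sphere u
    rw [inner_complexStructure]
    simp [complexStructure]
    linarith
  have hu : inner ℝ (u : EuclideanSpace ℝ (Fin 4)) u = (1 : ℝ) := by
    rw [real_inner_self_eq_norm_sq, mem_sphere_zero_iff_norm.1 u.2, one_pow]
  have hv : inner ℝ (v : EuclideanSpace ℝ (Fin 4)) v = (1 : ℝ) := by
    rw [real_inner_self_eq_norm_sq, mem_sphere_zero_iff_norm.1 v.2, one_pow]
  rw [← sub_eq_zero, ← inner_self_eq_zero (𝕜 := ℝ)]
  simp only [inner_sub_left, inner_sub_right, inner_add_left, inner_add_right, real_inner_smul_left,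
    real_inner_smul_right, real_inner_comm (complexStructure u),
    real_inner_comm (u : EuclideanSpace ℝ (Fin 4)) (v : EuclideanSpace ℝ (Fin 4)), h2, h3, hu, hv]
  linear_combination -h1

lemma hopf_surjective : Function.Surjective hopf := by
  intro v
  have hv : (v : EuclideanSpace ℝ (Fin 3)) 0 ^ 2 + v.1 1 ^ 2 + v.1 2 ^ 2 = 1 := by
    have h : ‖v.1‖ ^ 2 = 1 := by rw [mem_sphere_zero_iff_norm.1 v.2]; norm_num
    rw [EuclideanSpace.norm_sq_eq, Fin.sum_univ_three] at h
    simpa using h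
  have hsph : ∀ a b c d : ℝ, a ^ 2 + b ^ 2 + c ^ 2 + d ^ 2 = 1 →
      !₂[a, b, c, d] ∈ Metric.sphere (0 : EuclideanSpace ℝ (Fin 4)) 1 := by
    intro a b c d h
    rw [mem_sphere_zero_iff_norm, ← sq_eq_sq₀ (norm_nonneg _) zero_le_one,
      EuclideanSpace.norm_sq_eq, Fin.sum_univ_four]
    simpa using h
  have hle : -1 ≤ v.1 0 := by nlinarith
  rcases hle.eq_or_lt with h | h
  · have h1 : v.1 1 = 0 := by
      rw [← h] at hv
      nlinarith [sq_nonneg (v.1 1), sq_nonneg (v.1 2)]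
    have h2 : v.1 2 = 0 := by
      rw [← h] at hv
      nlinarith [sq_nonneg (v.1 1), sq_nonneg (v.1 2)]
    refine ⟨⟨_, hsph 0 0 1 0 (by norm_num)⟩, Subtype.ext ?_⟩
    ext i
    fin_cases i <;> simp [hopf, h1, h2, ← h]
  · -- the point of the fiber with positive first coordinate and second coordinate `0`
    set s := √((1 + v.1 0) / 2) with hs
    have hs0 : 0 < s := Real.sqrt_pos.2 (by linarith)
    have hs2 : s ^ 2 = (1 + v.1 0) / 2 := Real.sq_sqrt (by linarith)
    have hs2' : 1 + v.1 0 = 2 * s ^ 2 := by rw [hs2]; ring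
    have e : (v.1 1 / (2 * s)) ^ 2 + (-(v.1 2 / (2 * s))) ^ 2 = (1 - v.1 0) / 2 := by
      have : v.1 1 ^ 2 + v.1 2 ^ 2 = (1 - v.1 0) * (2 * s ^ 2) := by rw [← hs2']; linarith
      field_simp
      linarith
    refine ⟨⟨_, hsph s 0 (v.1 1 / (2 * s)) (-(v.1 2 / (2 * s))) (by linarith)⟩, Subtype.ext ?_⟩
    ext i
    fin_cases i
    · simp [hopf]
      linarith
    · simp [hopf]
      field_simp
    · simp [hopf]
      field_simp

/-- A map that agrees with the Hopf map up to isometries of the ambient spaces. -/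
lemma exists_isHopfLike {P : Sph 3 → Sph 2}
    (A : EuclideanSpace ℝ (Fin 4) ≃ₗᵢ[ℝ] EuclideanSpace ℝ (Fin 4))
    (C : EuclideanSpace ℝ (Fin 3) ≃ₗᵢ[ℝ] EuclideanSpace ℝ (Fin 3))
    (h : ∀ u v : Sph 3, (v : EuclideanSpace ℝ (Fin 4)) = A u →
      C (P u) = (hopf v : EuclideanSpace ℝ (Fin 3))) :
    ∃ Q J, IsHopfLike P Q J := by
  have hA : ∀ u : Sph 3, A u ∈ Metric.sphere (0 : EuclideanSpace ℝ (Fin 4)) 1 := fun u => by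
    rw [mem_sphere_zero_iff_norm, A.norm_map, mem_sphere_zero_iff_norm.1 u.2]
  have hA' : ∀ u : Sph 3, A.symm u ∈ Metric.sphere (0 : EuclideanSpace ℝ (Fin 4)) 1 := fun u => by
    rw [mem_sphere_zero_iff_norm, A.symm.norm_map, mem_sphere_zero_iff_norm.1 u.2]
  have hC : ∀ u : Sph 2, C u ∈ Metric.sphere (0 : EuclideanSpace ℝ (Fin 3)) 1 := fun u => by
    rw [mem_sphere_zero_iff_norm, C.norm_map, mem_sphere_zero_iff_norm.1 u.2]
  have hP : ∀ u : Sph 3, C (P u) = (hopf ⟨A u, hA u⟩ : EuclideanSpace ℝ (Fin 3)) :=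
    fun u => h u _ rfl
  let Q : EuclideanSpace ℝ (Fin 4) → EuclideanSpace ℝ (Fin 3) :=
    fun u => C.symm (hopfAmbient (A u))
  have hQ : ContDiff ℝ ∞ Q :=
    C.symm.contDiff.comp (contDiff_hopfAmbient.comp A.contDiff)
  have hfd : ∀ u v, fderiv ℝ Q u v = C.symm (hopfPolar (A u) (A v)) := by
    intro u v
    have h1 : HasLineDerivAt ℝ Q (C.symm (hopfPolar (A u) (A v))) u v := by
      have e : (fun t : ℝ => Q (u + t • v)) = fun t => Q u +
          t • C.symm (hopfPolar (A u) (A v)) + t ^ 2 • Q v := by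
        funext t
        simp only [Q, map_add, map_smul, hopfAmbient_line]
      rw [HasLineDerivAt, e]
      have h2 := (((hasDerivAt_id (0 : ℝ)).smul_const (C.symm (hopfPolar (A u) (A v)))).const_add
        (Q u)).add (((hasDerivAt_id (0 : ℝ)).pow 2).smul_const (Q v))
      simp only [id_eq, one_smul, Nat.cast_ofNat, Nat.add_one_sub_one, pow_one, mul_zero, mul_one,
        zero_smul, add_zero] at h2
      exact h2
    rw [← ((hQ.differentiable (by simp)) u).lineDeriv_eq_fderiv, h1.lineDeriv]
  let J : EuclideanSpace ℝ (Fin 4) →ₗ[ℝ] EuclideanSpace ℝ (Fin 4) :=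
    A.symm.toLinearEquiv.toLinearMap ∘ₗ complexStructure ∘ₗ A.toLinearEquiv.toLinearMap
  have hJ : ∀ u, J u = A.symm (complexStructure (A u)) := fun u => rfl
  have hJi : ∀ u v, inner ℝ (J u) v = inner ℝ (complexStructure (A u)) (A v) := fun u v => by
    rw [hJ, ← A.inner_map_map, A.apply_symm_apply]
  refine ⟨Q, J, hQ, fun u => ?_, fun b => ?_, fun u => ?_, fun u => ?_, fun u v w => ?_,
    fun u v huv => ?_⟩
  · rw [← C.symm_apply_apply (P u : EuclideanSpace ℝ (Fin 3)), hP]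
    rfl
  · obtain ⟨v, hv⟩ := hopf_surjective ⟨C b, hC b⟩
    refine ⟨⟨A.symm v, hA' v⟩, Subtype.ext (C.injective ?_)⟩
    rw [h _ v (by simp), hv]
  · rw [hJ, A.symm.norm_map, ← A.norm_map u, ← sq_eq_sq₀ (norm_nonneg _) (norm_nonneg _),
      ← real_inner_self_eq_norm_sq, ← real_inner_self_eq_norm_sq, inner_four, inner_four]
    simp [complexStructure]
    ring
  · rw [hJi, inner_complexStructure]
    ring
  · rw [hfd, hfd, C.symm.inner_map_map, inner_hopfPolar, A.norm_map, A.inner_map_map,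
      mem_sphere_zero_iff_norm.1 u.2, hJi, hJi]
    ring
  · have h1 : hopf ⟨A u, hA u⟩ = hopf ⟨A v, hA v⟩ := Subtype.ext (by rw [← hP, ← hP, huv])
    have h2 := congrArg A.symm (eq_of_hopf_eq h1)
    simp only [map_add, map_smul, A.symm_apply_apply, A.inner_map_map] at h2
    rw [hJi, hJ]
    exact h2

end HopfGeometry

/-! ### Bundle isometries -/

section BundleIsometry

lemma Sph.inner_self {n : ℕ} (u : Sph n) : inner ℝ (u : EuclideanSpace ℝ (Fin (n + 1))) u = 1 := by
  rw [real_inner_self_eq_norm_sq, mem_sphere_zero_iff_norm.1 u.2, one_pow]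

lemma Sph.eq_of_inner_eq_one {n : ℕ} {u v : Sph n}
    (h : inner ℝ (u : EuclideanSpace ℝ (Fin (n + 1))) v = 1) : u = v :=
  Subtype.ext ((inner_eq_one_iff_of_norm_eq_one (mem_sphere_zero_iff_norm.1 u.2)
    (mem_sphere_zero_iff_norm.1 v.2)).1 h)

lemma Sph.inner_mem_Icc {n : ℕ} (u v : Sph n) :
    inner ℝ (u : EuclideanSpace ℝ (Fin (n + 1))) v ∈ Set.Icc (-1 : ℝ) 1 := by
  have := abs_real_inner_le_norm (u : EuclideanSpace ℝ (Fin (n + 1))) v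
  rw [mem_sphere_zero_iff_norm.1 u.2, mem_sphere_zero_iff_norm.1 v.2, one_mul] at this
  exact abs_le.1 this

lemma sphereDist_eq_arccos {n : ℕ} (u v : Sph n) :
    sphereDist u v = Real.arccos (inner ℝ (u : EuclideanSpace ℝ (Fin (n + 1))) v) := by
  have hm := Sph.inner_mem_Icc u v
  set c := inner ℝ (u : EuclideanSpace ℝ (Fin (n + 1))) v with hc
  have h0 := Real.arccos_nonneg c
  have h1 := Real.arccos_le_pi c
  have hpi := Real.pi_pos
  have hs : 0 ≤ Real.sin (Real.arccos c / 2) :=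
    Real.sin_nonneg_of_nonneg_of_le_pi (by linarith) (by linarith)
  have e : ‖(u : EuclideanSpace ℝ (Fin (n + 1))) - v‖ = 2 * Real.sin (Real.arccos c / 2) := by
    rw [← sq_eq_sq₀ (norm_nonneg _) (by positivity), norm_sub_sq_real,
      mem_sphere_zero_iff_norm.1 u.2, mem_sphere_zero_iff_norm.1 v.2, mul_pow,
      Real.sin_sq_eq_half_sub, mul_div_cancel₀ _ two_ne_zero, Real.cos_arccos hm.1 hm.2, ← hc]
    ring
  rw [sphereDist, e, mul_div_cancel_left₀ _ two_ne_zero,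
    Real.arcsin_sin (by linarith) (by linarith)]
  ring

lemma inner_complexStructure_self (u : Sph 3) :
    inner ℝ (complexStructure u) (u : EuclideanSpace ℝ (Fin 4)) = 0 := by
  rw [inner_complexStructure]
  ring

lemma inner_complexStructure_complexStructure (u : Sph 3) :
    inner ℝ (complexStructure u) (complexStructure u) = (1 : ℝ) := by
  have := sum_sq_sphere u
  rw [inner_complexStructure]
  simp [complexStructure]
  linarith

/-- Unit vectors in the same complex line have the same Hopf image. -/
lemma hopf_eq_of_mem_span {u v : Sph 3} {a b : ℝ} (h : (v : EuclideanSpace ℝ (Fin 4)) =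
    a • (u : EuclideanSpace ℝ (Fin 4)) + b • complexStructure u) : hopf v = hopf u := by
  have h1 : a ^ 2 + b ^ 2 = 1 := by
    have h2 := Sph.inner_self v
    rw [h] at h2
    simp only [inner_add_left, inner_add_right, real_inner_smul_left, real_inner_smul_right,
      real_inner_comm (complexStructure u), inner_complexStructure_self,
      inner_complexStructure_complexStructure, Sph.inner_self] at h2
    rw [inner_complexStructure_self] at h2
    linarith
  have h2 : hopfAmbient v = (a ^ 2 + b ^ 2) • hopfAmbient u := by
    rw [h]
    ext i
    fin_cases i <;> simp [hopfAmbient, complexStructure] <;> ring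
  rw [h1, one_smul] at h2
  exact Subtype.ext h2

variable {M : Type*} {r θ : M → M → ℝ}

/-- If `M` is identified with the three-sphere so that `cos r cos θ` is the inner product and
`cos 2r` is the inner product of the Hopf images, then `M → B` has the metric properties of the
Hopf fibration. -/
lemma isMetricSubmersion_of_equiv (hrθ : IsAdmissiblePair r θ) (f : M ≃ Sph 3)
    (ha : ∀ x y, inner ℝ (f x : EuclideanSpace ℝ (Fin 4)) (f y) =
      Real.cos (r x y) * Real.cos (θ x y))
    (hb : ∀ x y, inner ℝ (hopf (f x) : EuclideanSpace ℝ (Fin 3)) (hopf (f y)) =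
      2 * Real.cos (r x y) ^ 2 - 1) : IsMetricSubmersion hrθ.pseudoMetric θ := by
  have hr := hrθ.pseudoMetric
  have hpi := Real.pi_pos
  have hcr : ∀ x y, 0 ≤ Real.cos (r x y) := fun x y =>
    Real.cos_nonneg_of_mem_Icc ⟨by linarith [hr.nonneg x y], hrθ.le_half_pi x y⟩
  have hacos : ∀ x y, Real.arccos (Real.cos (r x y)) = r x y := fun x y =>
    Real.arccos_cos (hr.nonneg x y) (by linarith [hrθ.le_half_pi x y])
  have hproj : ∀ x y, hopf (f x) = hopf (f y) → proj hr x = proj hr y := by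
    intro x y h
    refine Quotient.sound (s := zeroSetoid hr) (?_ : r x y = 0)
    have h1 := hb x y
    rw [h, Sph.inner_self] at h1
    have h2 : Real.cos (r x y) = 1 := by nlinarith [hcr x y]
    rw [← hacos, h2, Real.arccos_one]
  have hdelta : ∀ x y, Real.cos (delta r θ x y) =
      inner ℝ (f x : EuclideanSpace ℝ (Fin 4)) (f y) := by
    intro x y
    have := Sph.inner_mem_Icc (f x) (f y)
    rw [delta, ← ha, Real.cos_arccos this.1 this.2]
  refine ⟨fun x y => ?_, fun x b => ?_, fun x y z hxy hlt hadd => ?_⟩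
  · change r x y ≤ _
    rw [← hacos x y]
    exact Real.arccos_le_arccos (mul_le_of_le_one_right (hcr x y) (Real.cos_le_one _))
  · obtain ⟨x', rfl⟩ := Quotient.exists_rep b
    change ∃ y, proj hr y = proj hr x' ∧ delta r θ x y = r x x'
    have hρ : inner ℝ (f x' : EuclideanSpace ℝ (Fin 4)) (f x) ^ 2 +
        inner ℝ (complexStructure (f x')) (f x : EuclideanSpace ℝ (Fin 4)) ^ 2 =
        Real.cos (r x x') ^ 2 := by
      rw [← normSq_herm_eq, normSq_herm, hb, hr.symm]
      ring
    rcases (hcr x x').eq_or_lt with h0 | h0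
    · refine ⟨x', rfl, ?_⟩
      rw [delta, ← h0, zero_mul, ← hacos, ← h0]
    · set ρ := Real.cos (r x x') with hρdef
      set a := inner ℝ (f x' : EuclideanSpace ℝ (Fin 4)) (f x) with hadef
      set b := inner ℝ (complexStructure (f x')) (f x : EuclideanSpace ℝ (Fin 4)) with hbdef
      -- the point of the fiber nearest to `f x`
      let v : EuclideanSpace ℝ (Fin 4) := (a / ρ) • (f x' : EuclideanSpace ℝ (Fin 4)) +
        (b / ρ) • complexStructure (f x')
      have hv : v ∈ Metric.sphere (0 : EuclideanSpace ℝ (Fin 4)) 1 := by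
        rw [mem_sphere_zero_iff_norm, ← sq_eq_sq₀ (norm_nonneg _) zero_le_one,
          ← real_inner_self_eq_norm_sq]
        simp only [v, inner_add_left, inner_add_right, real_inner_smul_left, real_inner_smul_right,
          real_inner_comm (complexStructure (f x')), inner_complexStructure_self,
          inner_complexStructure_complexStructure, Sph.inner_self]
        field_simp
        linarith
      refine ⟨f.symm ⟨v, hv⟩, hproj _ _ ?_, ?_⟩
      · rw [f.apply_symm_apply]
        exact hopf_eq_of_mem_span rfl
      · have h1 : inner ℝ (f x : EuclideanSpace ℝ (Fin 4)) v = ρ := by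
          rw [real_inner_comm]
          simp only [v, inner_add_left, real_inner_smul_left, ← hadef, ← hbdef]
          field_simp
          linarith
        rw [delta, ← ha, f.apply_symm_apply, h1, hacos]
  · refine hproj z x ?_
    have hxy' : hopf (f x) = hopf (f y) := by
      have h0 : r x y = 0 := Quotient.exact (s := zeroSetoid hr) hxy
      refine Sph.eq_of_inner_eq_one ?_
      rw [hb, h0, Real.cos_zero]
      norm_num
    have hp0 : 0 ≤ delta r θ x z := Real.arccos_nonneg _
    have hq0 : 0 ≤ delta r θ z y := Real.arccos_nonneg _
    have e1 := hdelta x z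
    have e2 := hdelta z y
    have e3 := hdelta x y
    rw [← hadd] at e3 hlt
    generalize delta r θ x z = p at *
    generalize delta r θ z y = q at *
    rcases (add_nonneg hp0 hq0).eq_or_lt with h0 | h0
    · have hp : p = 0 := by linarith
      rw [hp, Real.cos_zero] at e1
      rw [Sph.eq_of_inner_eq_one e1.symm]
    · have hS : 0 < Real.sin (p + q) := Real.sin_pos_of_pos_of_lt_pi h0 hlt
      have key : Real.sin (p + q) • (f z : EuclideanSpace ℝ (Fin 4)) =
          Real.sin q • (f x : EuclideanSpace ℝ (Fin 4)) + Real.sin p • (f y).1 := by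
        rw [← sub_eq_zero, ← inner_self_eq_zero (𝕜 := ℝ)]
        simp only [inner_sub_left, inner_sub_right, inner_add_left, inner_add_right,
          real_inner_smul_left, real_inner_smul_right, Sph.inner_self,
          real_inner_comm (f x : EuclideanSpace ℝ (Fin 4)) (f z),
          real_inner_comm (f x : EuclideanSpace ℝ (Fin 4)) (f y),
          real_inner_comm (f z : EuclideanSpace ℝ (Fin 4)) (f y), ← e1, ← e2, ← e3]
        have h1 := Real.sin_sq_add_cos_sq p
        have h2 := Real.sin_sq_add_cos_sq q
        rw [Real.sin_add, Real.cos_add]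
        have h3 : Real.cos p ^ 2 = 1 - Real.sin p ^ 2 := by linarith
        have h4 : Real.cos q ^ 2 = 1 - Real.sin q ^ 2 := by linarith
        ring_nf
        rw [h3, h4]
        ring
      have h5 : (f z : EuclideanSpace ℝ (Fin 4)) =
          (Real.sin (p + q))⁻¹ • (Real.sin q • (f x : EuclideanSpace ℝ (Fin 4)) +
            Real.sin p • (f y).1) := by
        rw [← key, inv_smul_smul₀ hS.ne']
      rw [eq_of_hopf_eq hxy'] at h5
      refine hopf_eq_of_mem_span (a := (Real.sin (p + q))⁻¹ *
        (Real.sin q + Real.sin p * inner ℝ (f x : EuclideanSpace ℝ (Fin 4)) (f y)))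
        (b := (Real.sin (p + q))⁻¹ * (Real.sin p *
          inner ℝ (complexStructure (f x)) (f y : EuclideanSpace ℝ (Fin 4)))) (h5.trans ?_)
      module

/-- Maps that represent `cos r cos θ` and `cos 2r` by the inner products of the spheres are
isometries for `δ` and `r`, since the distances of the spheres are the arc cosines of the inner
products. -/
lemma isBundleIsometry_of_inner (hrθ : IsAdmissiblePair r θ)
    (hsub : IsMetricSubmersion hrθ.pseudoMetric θ) (Φ : M ≃ Sph 3)
    (Ψ : Base hrθ.pseudoMetric ≃ Sph 2) {P : Sph 3 → Sph 2}
    {Q : EuclideanSpace ℝ (Fin 4) → EuclideanSpace ℝ (Fin 3)}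
    {J : EuclideanSpace ℝ (Fin 4) →ₗ[ℝ] EuclideanSpace ℝ (Fin 4)} (hP : IsHopfLike P Q J)
    (ha : ∀ x y, inner ℝ (Φ x : EuclideanSpace ℝ (Fin 4)) (Φ y) = totalCos r θ x y)
    (hb : ∀ b c, inner ℝ (Ψ b : EuclideanSpace ℝ (Fin 3)) (Ψ c) = baseCos hrθ.pseudoMetric b c)
    (hc : ∀ x, P (Φ x) = Ψ (proj hrθ.pseudoMetric x)) :
    IsBundleIsometry hrθ.pseudoMetric θ Φ Ψ P where
  isometry_total x y := by rw [sphereDist_eq_arccos, ha]; rfl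
  isometry_base b c := by
    rw [sphereDist_eq_arccos, hb, baseCos]
    obtain ⟨x, rfl⟩ := Quotient.exists_rep b
    obtain ⟨y, rfl⟩ := Quotient.exists_rep c
    change 1 / 2 * Real.arccos (Real.cos (2 * r x y)) = r x y
    rw [Real.arccos_cos (by linarith [hrθ.pseudoMetric.nonneg x y])
      (by linarith [hrθ.le_half_pi x y])]
    ring
  comm := hc
  submersion_source := hsub
  submersion_target := hP.isRiemannianSubmersion
  totallyGeodesic_target := hP.hasTotallyGeodesicFibers

/-- The identification of the base with the two-sphere that is induced by an identification of the
total space with the three-sphere. -/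
lemma exists_base_equiv (hrθ : IsAdmissiblePair r θ) (f : M ≃ Sph 3)
    (hb : ∀ x y, inner ℝ (hopf (f x) : EuclideanSpace ℝ (Fin 3)) (hopf (f y)) =
      2 * Real.cos (r x y) ^ 2 - 1) :
    ∃ g : Base hrθ.pseudoMetric ≃ Sph 2, (∀ x, hopf (f x) = g (proj hrθ.pseudoMetric x)) ∧
      ∀ b c, inner ℝ (g b : EuclideanSpace ℝ (Fin 3)) (g c) = baseCos hrθ.pseudoMetric b c := by
  have hr := hrθ.pseudoMetric
  have hpi := Real.pi_pos
  let g : Base hr → Sph 2 := Quotient.lift (s := zeroSetoid hr) (fun x => hopf (f x)) (by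
    intro x y (h : r x y = 0)
    refine Sph.eq_of_inner_eq_one ?_
    rw [hb, h, Real.cos_zero]
    norm_num)
  have hg : ∀ b c, inner ℝ (g b : EuclideanSpace ℝ (Fin 3)) (g c) = baseCos hr b c := by
    intro b c
    obtain ⟨x, rfl⟩ := Quotient.exists_rep b
    obtain ⟨y, rfl⟩ := Quotient.exists_rep c
    change inner ℝ (hopf (f x) : EuclideanSpace ℝ (Fin 3)) (hopf (f y)) = Real.cos (2 * r x y)
    rw [hb, Real.cos_two_mul]
  refine ⟨Equiv.ofBijective g ⟨fun b c hbc => ?_, fun v => ?_⟩, fun x => rfl, hg⟩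
  · have h1 := hg b c
    rw [hbc, Sph.inner_self] at h1
    obtain ⟨x, rfl⟩ := Quotient.exists_rep b
    obtain ⟨y, rfl⟩ := Quotient.exists_rep c
    refine Quotient.sound (s := zeroSetoid hr) (?_ : r x y = 0)
    change 1 = Real.cos (2 * r x y) at h1
    have h2 := Real.arccos_cos (x := 2 * r x y) (by linarith [hr.nonneg x y])
      (by linarith [hrθ.le_half_pi x y])
    rw [← h1, Real.arccos_one] at h2
    linarith
  · obtain ⟨u, hu⟩ := hopf_surjective v
    refine ⟨proj hr (f.symm u), ?_⟩
    change hopf (f (f.symm u)) = v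
    rw [f.apply_symm_apply, hu]

end BundleIsometry

/-! ### Coordinates from dual systems -/

section DualSystems

variable {X : Type*} {κ : X → X → ℝ} {n : ℕ}

/-- The points over the standard basis vectors, together with the coordinate functions. -/
lemma exists_isDualSystem (f : X ≃ Sph n)
    (hf : ∀ x y, inner ℝ (f x : EuclideanSpace ℝ (Fin (n + 1))) (f y) = κ x y) :
    ∃ (x : Fin (n + 1) → X) (φ : Fin (n + 1) → X → ℝ), IsDualSystem κ x φ := by
  have hs : ∀ i, EuclideanSpace.single i (1 : ℝ) ∈
      Metric.sphere (0 : EuclideanSpace ℝ (Fin (n + 1))) 1 := fun i => by simp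
  let x : Fin (n + 1) → X := fun i => f.symm ⟨_, hs i⟩
  let φ : Fin (n + 1) → X → ℝ := fun j y => (f y : EuclideanSpace ℝ (Fin (n + 1))) j
  have hκ : ∀ j, φ j = κ (x j) := by
    intro j
    funext y
    rw [← hf, f.apply_symm_apply]
    simp [φ, EuclideanSpace.inner_single_left]
  have hd : ∀ i j, φ j (x i) = if i = j then 1 else 0 := by
    intro i j
    simp [φ, x, eq_comm]
  refine ⟨x, φ, ?_, le_antisymm ?_ ?_, hd⟩
  · rw [Fintype.linearIndependent_iff]
    intro c hc i
    have := congrFun hc (x i)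
    simpa [hd] using this
  · rw [Submodule.span_le]
    rintro _ ⟨j, rfl⟩
    exact Submodule.subset_span ⟨x j, (hκ j).symm⟩
  · rw [Submodule.span_le]
    rintro _ ⟨y, rfl⟩
    have : κ y = ∑ j, (f y : EuclideanSpace ℝ (Fin (n + 1))) j • φ j := by
      funext z
      rw [← hf, PiLp.inner_apply]
      simp [φ, mul_comm]
    rw [this]
    exact Submodule.sum_mem _ fun j _ => Submodule.smul_mem _ _ (Submodule.subset_span ⟨j, rfl⟩)

variable {x : Fin (n + 1) → X} {φ : Fin (n + 1) → X → ℝ}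

/-- If `κ` is represented by the inner product of the sphere, then the functions of a dual system
are the coordinates with respect to the basis of the points of the dual system. -/
lemma IsDualSystem.exists_basis (h : IsDualSystem κ x φ) (f : X → Sph n)
    (hf : ∀ x y, inner ℝ (f x : EuclideanSpace ℝ (Fin (n + 1))) (f y) = κ x y) :
    ∃ e : Module.Basis (Fin (n + 1)) ℝ (EuclideanSpace ℝ (Fin (n + 1))),
      (∀ i, e i = f (x i)) ∧
        ∀ y, (f y : EuclideanSpace ℝ (Fin (n + 1))) = ∑ j, φ j y • e j := by
  have hφ : ∀ j, ∃ p : EuclideanSpace ℝ (Fin (n + 1)), ∀ y, φ j y = inner ℝ p (f y).1 := by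
    intro j
    have h1 : φ j ∈ Submodule.span ℝ (Set.range κ) := by
      rw [← h.span_eq]
      exact Submodule.subset_span ⟨j, rfl⟩
    generalize φ j = g at h1
    induction h1 using Submodule.span_induction with
    | mem g hg =>
      obtain ⟨y, rfl⟩ := hg
      exact ⟨f y, fun z => (hf y z).symm⟩
    | zero => exact ⟨0, fun z => by simp⟩
    | add g g' _ _ h1 h2 =>
      obtain ⟨p, hp⟩ := h1
      obtain ⟨q, hq⟩ := h2
      exact ⟨p + q, fun z => by rw [inner_add_left, Pi.add_apply, hp, hq]⟩
    | smul c g _ h1 =>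
      obtain ⟨p, hp⟩ := h1
      exact ⟨c • p, fun z => by rw [real_inner_smul_left, Pi.smul_apply, hp, smul_eq_mul]⟩
  choose p hp using hφ
  have hpe : ∀ i j, inner ℝ (p j) (f (x i)).1 = if i = j then (1 : ℝ) else 0 := fun i j => by
    rw [← hp, h.dual]
  have hli : LinearIndependent ℝ fun i => (f (x i) : EuclideanSpace ℝ (Fin (n + 1))) := by
    rw [Fintype.linearIndependent_iff]
    intro c hc i
    have := congrArg (inner ℝ (p i)) hc
    simpa [inner_sum, real_inner_smul_right, hpe] using this
  let e := basisOfLinearIndependentOfCardEqFinrank hli (by simp)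
  have he : ∀ i, e i = f (x i) := fun i => by simp [e]
  refine ⟨e, he, fun y => ?_⟩
  have h1 : ∀ j, e.repr (f y) j = φ j y := by
    intro j
    rw [hp]
    conv_rhs => rw [← e.sum_repr (f y).1]
    simp [inner_sum, real_inner_smul_right, he, hpe]
  conv_lhs => rw [← e.sum_repr (f y).1]
  simp only [h1]

lemma IsDualSystem.posDef_gram (h : IsDualSystem κ x φ) (f : X → Sph n)
    (hf : ∀ x y, inner ℝ (f x : EuclideanSpace ℝ (Fin (n + 1))) (f y) = κ x y) :
    (gram κ x).PosDef := by
  obtain ⟨e, he, -⟩ := h.exists_basis f hf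
  have h1 : gram κ x = Matrix.gram ℝ e := by
    ext i j
    rw [Matrix.gram_apply, he, he, hf]
    rfl
  rw [h1]
  exact Matrix.posDef_gram_of_linearIndependent e.linearIndependent

lemma IsDualSystem.isCoordinateMap (h : IsDualSystem κ x φ) (f : X → Sph n)
    (hf : ∀ x y, inner ℝ (f x : EuclideanSpace ℝ (Fin (n + 1))) (f y) = κ x y) :
    IsCoordinateMap κ x φ f := by
  obtain ⟨e, he, h1⟩ := h.exists_basis f hf
  exact ⟨e, fun i j => by rw [he, he, hf]; rfl, h1⟩

/-- Any two realizations of the same dual system differ by a linear isometry. -/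
lemma IsDualSystem.exists_isometry (h : IsDualSystem κ x φ) (f : X ≃ Sph n)
    (hf : ∀ x y, inner ℝ (f x : EuclideanSpace ℝ (Fin (n + 1))) (f y) = κ x y)
    {F : X → Sph n} (hF : IsCoordinateMap κ x φ F) :
    Function.Bijective F ∧
      ∃ A : EuclideanSpace ℝ (Fin (n + 1)) ≃ₗᵢ[ℝ] EuclideanSpace ℝ (Fin (n + 1)),
        ∀ y, A (F y) = f y := by
  obtain ⟨e, he, h1⟩ := h.isCoordinateMap f hf
  obtain ⟨e', he', h2⟩ := hF
  let A₀ := e'.equiv e (Equiv.refl _)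
  have hA₀ : ∀ i, A₀ (e' i) = e i := fun i => by simp [A₀]
  have hAi : ∀ v w, inner ℝ (A₀ v) (A₀ w) = inner ℝ v w := by
    intro v w
    conv_lhs => rw [← e'.sum_repr v, ← e'.sum_repr w]
    conv_rhs => rw [← e'.sum_repr v, ← e'.sum_repr w]
    simp only [map_sum, map_smul, hA₀, sum_inner, inner_sum, real_inner_smul_left,
      real_inner_smul_right, he, he']
  let A := A₀.isometryOfInner hAi
  have hA : ∀ y, A (F y) = f y := by
    intro y
    change A₀ (F y) = f y
    rw [h1, h2, map_sum]
    simp only [map_smul, hA₀]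
  have hAm : ∀ u : Sph n, A u ∈ Metric.sphere (0 : EuclideanSpace ℝ (Fin (n + 1))) 1 := fun u => by
    rw [mem_sphere_zero_iff_norm, A.norm_map, mem_sphere_zero_iff_norm.1 u.2]
  refine ⟨⟨fun y z hyz => f.injective (Subtype.ext ?_), fun u => ⟨f.symm ⟨A u, hAm u⟩, ?_⟩⟩, A, hA⟩
  · rw [← hA, ← hA, hyz]
  · refine Subtype.ext (A.injective ?_)
    rw [hA, f.apply_symm_apply]

end DualSystems

end HopfRigidity

end

open HopfRigidity in
theorem mainTheorem1 {M : Type*} [Nonempty M] [TopologicalSpace M] [MeasurableSpace M]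
    [BorelSpace M] (μ : Measure M) [SigmaFinite μ] [μ.IsOpenPosMeasure]
    (r θ : M → M → ℝ) (hrθ : IsAdmissiblePair r θ) (htop : IsCompatibleTopology r θ)
    (p : ℝ → M → M → ℝ) (hp : IsHeatKernel μ p)
    (hform : ∀ t > 0, ∀ x y, (p t x y : ℂ) = su2Kernel t (r x y) (θ x y)) :
    -- the dual systems from which the maps `Φ` and `Ψ` are built exist, and the associated
    -- bilinear forms are positive definite
    (∃ (x : Fin 4 → M) (φ : Fin 4 → M → ℝ), IsDualSystem (totalCos r θ) x φ) ∧
    (∃ (y : Fin 3 → Base hrθ.pseudoMetric) (ψ : Fin 3 → Base hrθ.pseudoMetric → ℝ),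
      IsDualSystem (baseCos hrθ.pseudoMetric) y ψ) ∧
    (∀ (x : Fin 4 → M) (φ : Fin 4 → M → ℝ), IsDualSystem (totalCos r θ) x φ →
      (gram (totalCos r θ) x).PosDef ∧ ∃ F, IsCoordinateMap (totalCos r θ) x φ F) ∧
    (∀ (y : Fin 3 → Base hrθ.pseudoMetric) (ψ : Fin 3 → Base hrθ.pseudoMetric → ℝ),
      IsDualSystem (baseCos hrθ.pseudoMetric) y ψ →
      (gram (baseCos hrθ.pseudoMetric) y).PosDef ∧
        ∃ G, IsCoordinateMap (baseCos hrθ.pseudoMetric) y ψ G) ∧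
    -- for every choice of the maps, `Π = Ψ ∘ π ∘ Φ⁻¹` is a Riemannian submersion with
    -- one-dimensional totally geodesic fibers and `(Φ, Ψ)` is a bundle isometry from `π` to `Π`
    (∀ (x : Fin 4 → M) (φ : Fin 4 → M → ℝ) (F : M → Sph 3)
      (y : Fin 3 → Base hrθ.pseudoMetric) (ψ : Fin 3 → Base hrθ.pseudoMetric → ℝ)
      (G : Base hrθ.pseudoMetric → Sph 2),
      IsDualSystem (totalCos r θ) x φ → IsCoordinateMap (totalCos r θ) x φ F →
      IsDualSystem (baseCos hrθ.pseudoMetric) y ψ →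
      IsCoordinateMap (baseCos hrθ.pseudoMetric) y ψ G →
      ∃ (Φ : M ≃ Sph 3) (Ψ : Base hrθ.pseudoMetric ≃ Sph 2),
        (∀ z, Φ z = F z) ∧ (∀ b, Ψ b = G b) ∧
        IsRiemannianSubmersion (1 / 2) (Ψ ∘ proj hrθ.pseudoMetric ∘ Φ.symm) ∧
        HasFiberDim (Ψ ∘ proj hrθ.pseudoMetric ∘ Φ.symm) 1 ∧
        HasTotallyGeodesicFibers (Ψ ∘ proj hrθ.pseudoMetric ∘ Φ.symm) ∧
        IsBundleIsometry hrθ.pseudoMetric θ Φ Ψ (Ψ ∘ proj hrθ.pseudoMetric ∘ Φ.symm) ∧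
        -- `Π` is the Hopf fibration up to isometries of the spheres
        ∃ (A : EuclideanSpace ℝ (Fin 4) ≃ₗᵢ[ℝ] EuclideanSpace ℝ (Fin 4))
          (C : EuclideanSpace ℝ (Fin 3) ≃ₗᵢ[ℝ] EuclideanSpace ℝ (Fin 3)),
          ∀ (u v : Sph 3), (v : EuclideanSpace ℝ (Fin 4)) = A u →
            C ((Ψ ∘ proj hrθ.pseudoMetric ∘ Φ.symm) u) = (hopf v : EuclideanSpace ℝ (Fin 3))) ∧
    -- hence `π` is bundle isometric to the Hopf fibration
    ∃ (Φ : M ≃ Sph 3) (Ψ : Base hrθ.pseudoMetric ≃ Sph 2),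
      IsBundleIsometry hrθ.pseudoMetric θ Φ Ψ hopf := by
  obtain ⟨f, ha, hb⟩ := exists_equiv_sphere hrθ htop hp hform
  obtain ⟨g, hg, hgi⟩ := exists_base_equiv hrθ f hb
  have hsub := isMetricSubmersion_of_equiv hrθ f ha hb
  refine ⟨exists_isDualSystem f ha, exists_isDualSystem g hgi,
    fun x φ h => ⟨h.posDef_gram f ha, f, h.isCoordinateMap f ha⟩,
    fun y ψ h => ⟨h.posDef_gram g hgi, g, h.isCoordinateMap g hgi⟩, ?_, f, g, ?_⟩
  · intro x φ F y ψ G hφ hF hψ hG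
    obtain ⟨hFb, A, hA⟩ := hφ.exists_isometry f ha hF
    obtain ⟨hGb, C, hC⟩ := hψ.exists_isometry g hgi hG
    let Φ : M ≃ Sph 3 := Equiv.ofBijective F hFb
    let Ψ : Base hrθ.pseudoMetric ≃ Sph 2 := Equiv.ofBijective G hGb
    have hP : ∀ u v : Sph 3, (v : EuclideanSpace ℝ (Fin 4)) = A u →
        C ((Ψ ∘ proj hrθ.pseudoMetric ∘ Φ.symm) u) = (hopf v : EuclideanSpace ℝ (Fin 3)) := by
      intro u v huv
      have h1 : f (Φ.symm u) = v := by
        refine Subtype.ext ?_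
        rw [huv, ← hA]
        exact congrArg (fun w : Sph 3 => A w) (Φ.apply_symm_apply u)
      rw [← h1, hg]
      exact hC _
    obtain ⟨Q, J, hQ⟩ := exists_isHopfLike A C hP
    refine ⟨Φ, Ψ, fun _ => rfl, fun _ => rfl, hQ.isRiemannianSubmersion, hQ.hasFiberDim,
      hQ.hasTotallyGeodesicFibers, ?_, A, C, hP⟩
    refine isBundleIsometry_of_inner hrθ hsub Φ Ψ hQ (fun z w => ?_) (fun b c => ?_) fun z => ?_
    · rw [← A.inner_map_map]
      exact (congrArg₂ (inner ℝ) (hA z) (hA w)).trans (ha z w)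
    · rw [← C.inner_map_map]
      exact (congrArg₂ (inner ℝ) (hC b) (hC c)).trans (hgi b c)
    · simp
  · obtain ⟨Q, J, hQ⟩ := exists_isHopfLike (P := hopf) (LinearIsometryEquiv.refl ℝ _)
      (LinearIsometryEquiv.refl ℝ _) fun u v huv => by
        have h1 : v = u := Subtype.ext huv
        rw [h1]
        rfl
    exact isBundleIsometry_of_inner hrθ hsub f g hQ ha hgi hg
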